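/- **Setting.** All spaces are real. Let $N\ge 1$, $K\in\{1,2,\dots\}\cup\{\infty\}$, and let $\{\phi_p\}_{p}$ ($K$ orbitals, indexed by natural numbers in increasing order) be an $L^2$-orthonormal family in $H^1(\mathbb R^3)$. Let $\mathfrak H^1$ be the space of antisymmetric functions in $H^1(\mathbb R^{3N})$ with its usual inner product, and $\langle\cdot,\cdot\rangle$ the $L^2(\mathbb R^{3N})$ inner product. A *state* is a set $\alpha=\{\alpha_1<\dots<\alpha_N\}$ of $N$ orbital indices, with Slater determinant $\Phi_\alpha(x_1,\dots,x_N)=N!^{-1/2}\det(\phi_{\alpha_i}(x_j))$. Let $\mathfrak H^1_K$ be the closed linear span of all $\Phi_\alpha$ in $\mathfrak H^1$, and embed $\mathfrak H^1_K\subset(\mathfrak H^1_K)^*$ by $\Psi\mapsto\langle\Psi,\cdot\rangle$; the duality pairing is also written $\langle\cdot,\cdot\rangle$. Let $\mathcal H:\mathfrak H^1_K\to(\mathfrak H^1_K)^*$ be a bounded operator. Fix $M\ge 1$ distinct reference states $0_1,\dots,0_M$. Let $L_m$ be the set of states different from all $0_n$, $n\ne m$, and $\overline L_m=L_m\setminus\{0_m\}$.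 For states $\alpha,\beta$ put $\alpha\vee_m\beta=(\alpha\cap\beta\cap 0_m)\cup((\alpha\cup\beta)\setminus 0_m)$. For $\alpha\in\overline L_m$ the excitation operator $X^{(m)}_\alpha$ maps $\Phi_\beta$ to $\sigma\,\Phi_{\alpha\vee_m\beta}$ if $\beta\in L_m$, $0_m\subset\alpha\cup\beta$, $(\alpha\cap\beta)\setminus 0_m=\emptyset$ and $\alpha\vee_m\beta\in L_m$, and to $0$ otherwise; here $\sigma=\pm1$ is the sign of the permutation sorting the concatenation of the increasing lists of $\beta\setminus 0_m$ and $\alpha\setminus 0_m$. Let $\mathbb V_m$ be the set of $t\in\ell^2(\overline L_m)$ with $\sum_{\alpha}t_\alpha\Phi_\alpha\in\mathfrak H^1_K$. The cluster operator of $t\in\mathbb V_m$ is the bounded operator $T=\sum_{\alpha\in\overline L_m} t_\alpha X_\alpha^{(m)}$ on $\mathfrak H^1_K$ (on each determinant the sum converges in $L^2$); we denote cluster operators by the capital letters of their amplitudes. In products such as $e^{-T}\mathcal He^{T}$, the factor $e^{-T}$ is its bounded extension to $(\mathfrak H^1_K)^*$. Put $\mathfrak N=\mathrm{Span}\{\Phi_{0_1},\dots,\Phi_{0_M}\}$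 and $\mathfrak N^\perp=\{\Phi\in\mathfrak H^1_K:\langle\Theta,\Phi\rangle=0\ \text{for all } \Theta\in\mathfrak N\}$. **Theorem.** For each $t\in\mathbb V_m$, the cluster operator $T$ and the extension of $e^{-T}$ exist and are unique. Let $\Psi_1,\dots,\Psi_M\in\mathfrak H^1_K$ be $L^2$-orthogonal, let $\mathfrak M=\mathrm{Span}\{\Psi_1,\dots,\Psi_M\}$, and suppose that for every $m$ there is an $n$ with $\langle\Psi_m,\Phi_{0_n}\rangle\ne0$. Consider the following statements. (i) $\mathfrak M$ is weakly $\mathcal H$-invariant: for every $m$ there is $\widetilde\Psi_m\in\mathfrak M$ with $\langle\mathcal H\Psi_m,\Phi'\rangle=\langle\widetilde\Psi_m,\Phi'\rangle$ for all $\Phi'\in\mathfrak H^1_K$. (ii) (Full JM-MRCC) $\mathfrak M=\mathrm{Span}\{e^{T^{(m)}}\Phi_{0_m}: m=1,\dots,M\}$ for some $t^{(m)}\in\mathbb V_m$ such that, for all $m$ and all $s\in\mathbb V_m$, $$\langle e^{-T^{(m)}}\mathcal He^{T^{(m)}}\Phi_{0_m},S\Phi_{0_m}\rangle=\sum_{n=1}^M\mathcal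 H^{\mathrm{eff}}_{mn}\langle e^{-T^{(m)}}e^{T^{(n)}}\Phi_{0_n},S\Phi_{0_m}\rangle,\qquad \mathcal H^{\mathrm{eff}}_{mn}=\langle e^{-T^{(m)}}\mathcal He^{T^{(m)}}\Phi_{0_m},\Phi_{0_n}\rangle.$$ (iii) (Full MRCI) $\mathfrak M=\mathrm{Span}\{(I+C^{(m)})\Phi_{0_m}: m=1,\dots,M\}$ for some $c^{(m)}\in\mathbb V_m$ such that, for all $m$ and all $s\in\mathbb V_m$, $$\langle\mathcal H(I+C^{(m)})\Phi_{0_m},S\Phi_{0_m}\rangle=\sum_{n=1}^M\widehat{\mathcal H}^{\mathrm{eff}}_{mn}\langle(I+C^{(n)})\Phi_{0_n},S\Phi_{0_m}\rangle,\qquad \widehat{\mathcal H}^{\mathrm{eff}}_{mn}=\langle\mathcal H(I+C^{(m)})\Phi_{0_m},\Phi_{0_n}\rangle.$$ If the complementarity condition $\mathfrak M\oplus\mathfrak N^\perp=\mathfrak H^1_K$ holds, then (i), (ii) and (iii) are equivalent. Even without assuming it, each of (ii) and (iii) implies both (i) and the complementarity condition. Furthermore, suppose that $\langle\mathcal H\Psi_m,\Phi\rangle=\mathcal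 E_m\langle\Psi_m,\Phi\rangle$ for all $\Phi\in\mathfrak H^1_K$ and all $m$, with $\mathcal E_m\in\mathbb R$. (a) If $\mathfrak M$ is given as in (ii), then for every $j$ there are unique coefficients $a_j^{(n)}$ with $\Psi_j=\sum_n a_j^{(n)}e^{T^{(n)}}\Phi_{0_n}$; they are not all zero, and $\sum_{n}\mathcal H^{\mathrm{eff}}_{nm}a_j^{(n)}=\mathcal E_j a_j^{(m)}$ for all $m$. (b) If $\mathfrak M$ is given as in (iii), then for every $j$ there are unique coefficients $\widehat a_j^{(n)}$ with $\Psi_j=\sum_n \widehat a_j^{(n)}(I+C^{(n)})\Phi_{0_n}$; they are not all zero, and $\sum_{n}\widehat{\mathcal H}^{\mathrm{eff}}_{nm}\widehat a_j^{(n)}=\mathcal E_j \widehat a_j^{(m)}$ for all $m$. -/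

import Mathlib

open MeasureTheory Finset
open scoped ContDiff

noncomputable section

namespace JM

/-- The one-particle configuration space `ℝ³`. -/
abbrev E3 : Type := EuclideanSpace ℝ (Fin 3)

/-- The `N`-particle configuration space `(ℝ³)^N`. -/
abbrev Conf (N : ℕ) : Type := Fin N → E3

/-- `g` is the distributional derivative of `f` in direction `v`. -/
def IsWeakDeriv {E : Type} [NormedAddCommGroup E] [NormedSpace ℝ E] [MeasureSpace E]
    (v : E) (f g : E → ℝ) : Prop :=
  ∀ ψ : E → ℝ, ContDiff ℝ ∞ ψ → HasCompactSupport ψ →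
    ∫ x, f x * fderiv ℝ ψ x v = - ∫ x, g x * ψ x

/-- The `i`-th coordinate direction of the `k`-th particle. -/
def dir {N : ℕ} (k : Fin N) (i : Fin 3) : Conf N :=
  Pi.single k (EuclideanSpace.single i (1 : ℝ))

/-- The real space `L²(ℝ^{3N})`. -/
abbrev L2 (N : ℕ) : Type := Lp ℝ 2 (volume : Measure (Conf N))

/-- Fermionic symmetry: permuting the particles multiplies the wavefunction by the sign. -/
def IsAntisymmetric {N : ℕ} (f : Conf N → ℝ) : Prop :=
  ∀ π : Equiv.Perm (Fin N), ∀ᵐ X : Conf N, f (X ∘ π) = (Equiv.Perm.sign π : ℝ) * f X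

/-- Pairs (function, candidate gradient), with the Hilbert norm `‖f‖² + ∑_{k,i} ‖g_{k,i}‖²`. -/
def Jet (N : ℕ) : Type := WithLp 2 (L2 N × PiLp 2 (fun _ : Fin N × Fin 3 => L2 N))

instance (N : ℕ) : NormedAddCommGroup (Jet N) :=
  inferInstanceAs (NormedAddCommGroup (WithLp 2 (L2 N × PiLp 2 (fun _ : Fin N × Fin 3 => L2 N))))

instance (N : ℕ) : InnerProductSpace ℝ (Jet N) :=
  inferInstanceAs (InnerProductSpace ℝ (WithLp 2 (L2 N × PiLp 2 (fun _ : Fin N × Fin 3 => L2 N))))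

instance (N : ℕ) : CompleteSpace (Jet N) :=
  inferInstanceAs (CompleteSpace (WithLp 2 (L2 N × PiLp 2 (fun _ : Fin N × Fin 3 => L2 N))))

/-- The function component. -/
def Jet.fn {N : ℕ} : Jet N →L[ℝ] L2 N :=
  WithLp.fstL 2 ℝ (L2 N) (PiLp 2 fun _ : Fin N × Fin 3 => L2 N)

/-- The component for the partial derivative by the `i`-th coordinate of the `k`-th particle. -/
def Jet.deriv {N : ℕ} (k : Fin N) (i : Fin 3) : Jet N →L[ℝ] L2 N :=
  (PiLp.proj 2 (fun _ : Fin N × Fin 3 => L2 N) (k, i)).comp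
    (WithLp.sndL 2 ℝ (L2 N) (PiLp 2 fun _ : Fin N × Fin 3 => L2 N))

theorem Jet.inner_eq {N : ℕ} (u v : Jet N) :
    inner ℝ u v = inner ℝ (Jet.fn u) (Jet.fn v) +
      ∑ k, ∑ i, inner ℝ (Jet.deriv k i u) (Jet.deriv k i v) := by
  rw [← Fintype.sum_prod_type' (f := fun k i => inner ℝ (Jet.deriv k i u) (Jet.deriv k i v))]
  rfl

/-- The pair with given components. -/
def Jet.mk {N : ℕ} (f : L2 N) (g : Fin N → Fin 3 → L2 N) : Jet N :=
  WithLp.toLp 2 (f, WithLp.toLp 2 fun ki => g ki.1 ki.2)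

theorem Jet.fn_mk {N : ℕ} (f : L2 N) (g : Fin N → Fin 3 → L2 N) : Jet.fn (Jet.mk f g) = f := rfl

theorem Jet.deriv_mk {N : ℕ} (f : L2 N) (g : Fin N → Fin 3 → L2 N) (k : Fin N) (i : Fin 3) :
    Jet.deriv k i (Jet.mk f g) = g k i := rfl

theorem integrable_lp_mul_test {E : Type} [NormedAddCommGroup E] [NormedSpace ℝ E]
    [MeasureSpace E] [BorelSpace E] [IsFiniteMeasureOnCompacts (volume : Measure E)]
    {f : E → ℝ} (hf : MemLp f 2) {ψ : E → ℝ} (hψ : Continuous ψ)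
    (hc : HasCompactSupport ψ) : Integrable (fun x => f x * ψ x) :=
  MemLp.integrable_mul (p := 2) (q := 2) hf (hψ.memLp_of_hasCompactSupport hc)

theorem continuous_fderiv_test {E : Type} [NormedAddCommGroup E] [NormedSpace ℝ E]
    {ψ : E → ℝ} (hψ : ContDiff ℝ ∞ ψ) (hc : HasCompactSupport ψ) (v : E) :
    Continuous (fun x => fderiv ℝ ψ x v) ∧ HasCompactSupport (fun x => fderiv ℝ ψ x v) :=
  ⟨(hψ.continuous_fderiv (by simp)).clm_apply continuous_const, hc.fderiv_apply ℝ v⟩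

theorem isWeakDeriv_smul_add {E : Type} [NormedAddCommGroup E] [NormedSpace ℝ E]
    [MeasureSpace E] [BorelSpace E] [IsFiniteMeasureOnCompacts (volume : Measure E)] {v : E}
    {f g f' g' : E → ℝ} (hf : MemLp f 2) (hg : MemLp g 2) (hf' : MemLp f' 2)
    (hg' : MemLp g' 2) (h : IsWeakDeriv v f g) (h' : IsWeakDeriv v f' g') (c : ℝ) :
    IsWeakDeriv v (fun x => c * f x + f' x) (fun x => c * g x + g' x) := by
  intro ψ hψ hc
  obtain ⟨h1, h2⟩ := continuous_fderiv_test hψ hc v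
  simp only [add_mul, mul_assoc]
  rw [integral_add ((integrable_lp_mul_test hf h1 h2).const_mul c)
      (integrable_lp_mul_test hf' h1 h2),
    integral_add ((integrable_lp_mul_test hg hψ.continuous hc).const_mul c)
      (integrable_lp_mul_test hg' hψ.continuous hc),
    integral_const_mul, integral_const_mul, h ψ hψ hc, h' ψ hψ hc]
  ring

theorem IsWeakDeriv.congr {E : Type} [NormedAddCommGroup E] [NormedSpace ℝ E]
    [MeasureSpace E] {v : E} {f g f' g' : E → ℝ} (h : IsWeakDeriv v f g)
    (hf : f =ᵐ[volume] f') (hg : g =ᵐ[volume] g') : IsWeakDeriv v f' g' := by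
  intro ψ hψ hc
  have e1 : ∫ x, f' x * fderiv ℝ ψ x v = ∫ x, f x * fderiv ℝ ψ x v :=
    integral_congr_ae (hf.mono fun x hx => by simp only [hx])
  have e2 : ∫ x, g' x * ψ x = ∫ x, g x * ψ x :=
    integral_congr_ae (hg.mono fun x hx => by simp only [hx])
  rw [e1, e2, h ψ hψ hc]

theorem measurePreserving_comp_perm {N : ℕ} (π : Equiv.Perm (Fin N)) :
    MeasurePreserving (fun X : Conf N => X ∘ π) := by
  have := volume_preserving_arrowCongr' (β₁ := E3) (β₂ := E3) π.symm (MeasurableEquiv.refl E3) (MeasurePreserving.id _)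
  exact this

/-- The fermionic Sobolev space `ℌ¹ = 𝔏² ∩ H¹(ℝ^{3N})`: antisymmetric square integrable functions
together with their square integrable distributional gradient. The function determines the
gradient. The inherited inner product is `⟪Ψ, Φ⟫ + ∑ₖ ∫ ∇ₖΨ · ∇ₖΦ`. -/
def H1 (N : ℕ) : Submodule ℝ (Jet N) where
  carrier := {u | IsAntisymmetric (Jet.fn u : Conf N → ℝ) ∧
    ∀ (k : Fin N) (i : Fin 3), IsWeakDeriv (dir k i) (Jet.fn u : Conf N → ℝ) (Jet.deriv k i u : Conf N → ℝ)}
  zero_mem' := by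
    refine ⟨fun π => ?_, fun k i => ?_⟩
    · have h0 : ((0 : L2 N) : Conf N → ℝ) =ᵐ[volume] 0 := Lp.coeFn_zero ..
      filter_upwards [h0, (measurePreserving_comp_perm π).quasiMeasurePreserving.ae h0]
        with X h1 h2
      simp_all
    · have h0 : ((0 : L2 N) : Conf N → ℝ) =ᵐ[volume] 0 := Lp.coeFn_zero ..
      have : IsWeakDeriv (dir k i) (0 : Conf N → ℝ) 0 := by
        intro ψ _ _; simp
      exact this.congr h0.symm h0.symm
  add_mem' := by
    rintro u w ⟨hu, hu'⟩ ⟨hw, hw'⟩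
    refine ⟨fun π => ?_, fun k i => ?_⟩
    · have h0 := Lp.coeFn_add (Jet.fn u) (Jet.fn w)
      filter_upwards [h0, (measurePreserving_comp_perm π).quasiMeasurePreserving.ae h0,
        hu π, hw π] with X h1 h2 h3 h4
      simp only [map_add, Pi.add_apply] at *
      rw [h1, h2, h3, h4]; ring
    · have := isWeakDeriv_smul_add (Lp.memLp _) (Lp.memLp _) (Lp.memLp _) (Lp.memLp _)
        (hu' k i) (hw' k i) 1
      simp only [one_mul] at this
      exact this.congr (Lp.coeFn_add _ _).symm (Lp.coeFn_add _ _).symm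
  smul_mem' := by
    rintro c u ⟨hu, hu'⟩
    refine ⟨fun π => ?_, fun k i => ?_⟩
    · have h0 := Lp.coeFn_smul c (Jet.fn u)
      filter_upwards [h0, (measurePreserving_comp_perm π).quasiMeasurePreserving.ae h0,
        hu π] with X h1 h2 h3
      simp only [map_smul, Pi.smul_apply, smul_eq_mul] at *
      rw [h1, h2, h3]; ring
    · have h0 : IsWeakDeriv (dir k i) (0 : Conf N → ℝ) 0 := by
        intro ψ _ _; simp
      have := isWeakDeriv_smul_add (Lp.memLp _) (Lp.memLp _) MemLp.zero MemLp.zero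
        (hu' k i) h0 c
      simp only [Pi.zero_apply, add_zero] at this
      exact this.congr (Lp.coeFn_smul c _).symm (Lp.coeFn_smul c _).symm

theorem memLp_prod {N : ℕ} {f : Fin N → E3 → ℝ} (hf : ∀ j, MemLp (f j) 2) :
    MemLp (fun X : Conf N => ∏ j, f j (X j)) 2 := by
  have hm : AEStronglyMeasurable (fun X : Conf N => ∏ j, f j (X j)) volume := by
    have := fun j => ((hf j).aestronglyMeasurable).comp_quasiMeasurePreserving
      (Measure.quasiMeasurePreserving_eval (fun _ : Fin N => (volume : Measure E3)) j)
    exact Finset.aestronglyMeasurable_fun_prod _ fun j _ => this j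
  rw [memLp_two_iff_integrable_sq hm]
  simp_rw [← Finset.prod_pow]
  exact Integrable.fintype_prod (f := fun j x => f j x ^ 2) fun j => (hf j).integrable_sq

theorem isWeakDeriv_prod {N : ℕ} {f : Fin N → E3 → ℝ} (hf : ∀ j, MemLp (f j) 2)
    {g : E3 → ℝ} (hg : MemLp g 2) (k : Fin N) (i : Fin 3)
    (h : IsWeakDeriv (EuclideanSpace.single i (1 : ℝ)) (f k) g) :
    IsWeakDeriv (dir k i) (fun X : Conf N => ∏ j, f j (X j))
      (fun X => ∏ j, Function.update f k g j (X j)) := by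
  intro ψ hψ hc
  obtain ⟨n, rfl⟩ : ∃ n, N = n + 1 := ⟨N - 1, by have := k.2; omega⟩
  obtain ⟨h1, h2⟩ := continuous_fderiv_test hψ hc (dir k i)
  have hg' : ∀ j, MemLp (Function.update f k g j) 2 := by
    intro j
    rcases eq_or_ne j k with rfl | hj
    · simpa using hg
    · simpa [hj] using hf j
  have key : ∀ F : Conf (n + 1) → ℝ, Integrable F →
      ∫ X, F X = ∫ y : Conf n, ∫ a : E3, F (k.insertNth a y) := by
    intro F hF
    have e := (volume_preserving_piFinSuccAbove (fun _ : Fin (n + 1) => E3) k).symm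
    rw [← e.integral_comp' F]
    have hF' := (e.integrable_comp_emb (MeasurableEquiv.measurableEmbedding _)).2 hF
    exact integral_prod_symm _ hF'
  rw [key _ (integrable_lp_mul_test (memLp_prod hf) h1 h2),
    key _ (integrable_lp_mul_test (memLp_prod hg') hψ.continuous hc), ← integral_neg]
  congr 1
  ext y
  have hins : ContDiff ℝ ∞ (fun a : E3 => (k.insertNth a y : Conf (n + 1))) := by
    rw [contDiff_pi]
    intro j
    refine Fin.succAboveCases k ?_ (fun j => ?_) j
    · simp only [Fin.insertNth_apply_same]; exact contDiff_id
    · simp only [Fin.insertNth_apply_succAbove]; exact contDiff_const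
  have hemb : Topology.IsClosedEmbedding (fun a : E3 => (k.insertNth a y : Conf (n + 1))) :=
    Function.LeftInverse.isClosedEmbedding (f := fun X : Conf (n + 1) => X k)
      (fun a => by simp) (continuous_apply k) hins.continuous
  have hy := h (fun a => ψ (k.insertNth a y)) (hψ.comp hins) (hc.comp_isClosedEmbedding hemb)
  have hd : ∀ a : E3, fderiv ℝ (fun a => ψ (k.insertNth a y)) a (EuclideanSpace.single i 1)
      = fderiv ℝ ψ (k.insertNth a y) (dir k i) := by
    intro a
    have hψd : HasFDerivAt ψ (fderiv ℝ ψ (k.insertNth a y)) (k.insertNth a y) :=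
      (hψ.differentiable (by simp) _).hasFDerivAt
    have hi : HasFDerivAt (fun a : E3 => (k.insertNth a y : Conf (n + 1)))
        (ContinuousLinearMap.pi (Pi.single k (.id ℝ E3))) a := by
      rw [hasFDerivAt_pi]
      intro j
      refine Fin.succAboveCases k ?_ (fun j => ?_) j
      · simp only [Fin.insertNth_apply_same, Pi.single_eq_same]; exact hasFDerivAt_id a
      · simpa using hasFDerivAt_const _ _
    have hcomp : HasFDerivAt (fun a : E3 => ψ (k.insertNth a y)) _ a := hψd.comp a hi
    rw [hcomp.fderiv]
    simp only [ContinuousLinearMap.comp_apply]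
    congr 1
    ext j : 1
    refine Fin.succAboveCases k ?_ (fun j => ?_) j
    · simp [dir]
    · simp [dir]
  simp only [hd] at hy
  simp only [Fin.prod_univ_succAbove _ k, Fin.insertNth_apply_same, Fin.insertNth_apply_succAbove,
    Function.update_self, Function.update_of_ne (Fin.succAbove_ne k _)]
  simp_rw [mul_right_comm _ (∏ j : Fin n, _) _]
  rw [integral_mul_const, integral_mul_const, hy]
  ring

theorem isWeakDeriv_sum {E : Type} [NormedAddCommGroup E] [NormedSpace ℝ E]
    [MeasureSpace E] [BorelSpace E] [IsFiniteMeasureOnCompacts (volume : Measure E)] {v : E}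
    {ι : Type} (s : Finset ι) (c : ι → ℝ) {f g : ι → E → ℝ} (hf : ∀ j, MemLp (f j) 2)
    (hg : ∀ j, MemLp (g j) 2) (h : ∀ j, IsWeakDeriv v (f j) (g j)) :
    IsWeakDeriv v (fun x => ∑ j ∈ s, c j * f j x) (fun x => ∑ j ∈ s, c j * g j x) := by
  classical
  induction s using Finset.induction_on with
  | empty => intro ψ _ _; simp
  | insert j s hj ih =>
    simp only [Finset.sum_insert hj]
    exact isWeakDeriv_smul_add (hf j) (hg j)
      (memLp_finsetSum s fun j _ => (hf j).const_mul (c j))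
      (memLp_finsetSum s fun j _ => (hg j).const_mul (c j)) (h j) ih (c j)

/-- The orbital labels: `K` of them, where `K = ∞` is allowed. -/
abbrev Orb (K : ℕ∞) : Type := {p : ℕ // (p : ℕ∞) < K}

/-- An `L²`-orthonormal family of orbitals in `H¹(ℝ³)`. -/
structure OrbitalSet (K : ℕ∞) where
  φ : Orb K → Lp ℝ 2 (volume : Measure E3)
  orthonormal : Orthonormal ℝ φ
  mem_H1 : ∀ p (i : Fin 3), ∃ g : Lp ℝ 2 (volume : Measure E3),
    IsWeakDeriv (EuclideanSpace.single i (1 : ℝ)) (φ p : E3 → ℝ) g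

/-- The `N`-particle states: sets of `N` orbital labels. -/
abbrev State (N : ℕ) (K : ℕ∞) : Type := {α : Finset (Orb K) // α.card = N}

variable {N M : ℕ} {K : ℕ∞}

/-- The Slater determinant `X ↦ N!^{-1/2} det(φ_{α_i}(x_j))`, with `α_1 < ... < α_N`. -/
def slaterFun (B : OrbitalSet K) (α : State N K) (X : Conf N) : ℝ :=
  (Real.sqrt (N.factorial : ℝ))⁻¹ *
    (Matrix.of fun i j : Fin N => B.φ (α.1.orderEmbOfFin α.2 i) (X j)).det

theorem exists_slater (B : OrbitalSet K) (α : State N K) :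
    ∃ u : H1 N, (Jet.fn u.1 : Conf N → ℝ) =ᵐ[volume] slaterFun B α := by
  classical
  choose D hD using B.mem_H1
  let o : Fin N → Orb K := fun i => α.1.orderEmbOfFin α.2 i
  let c : Equiv.Perm (Fin N) → ℝ := fun σ =>
    (Real.sqrt (N.factorial : ℝ))⁻¹ * (Equiv.Perm.sign σ : ℝ)
  let F : Equiv.Perm (Fin N) → Conf N → ℝ := fun σ X => ∏ j, B.φ (o (σ j)) (X j)
  let G : Fin N → Fin 3 → Equiv.Perm (Fin N) → Conf N → ℝ := fun k i σ X =>
    ∏ j, Function.update (fun j => (B.φ (o (σ j)) : E3 → ℝ)) k (D (o (σ k)) i) j (X j)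
  have hF : ∀ σ, MemLp (F σ) 2 := fun σ => memLp_prod fun j => Lp.memLp _
  have hG : ∀ k i σ, MemLp (G k i σ) 2 := by
    intro k i σ
    refine memLp_prod fun j => ?_
    rcases eq_or_ne j k with rfl | hj
    · simpa using Lp.memLp _
    · simpa [hj] using Lp.memLp _
  have hW : ∀ k i σ, IsWeakDeriv (dir k i) (F σ) (G k i σ) := fun k i σ =>
    isWeakDeriv_prod (f := fun j => (B.φ (o (σ j)) : E3 → ℝ)) (fun j => Lp.memLp _)
      (Lp.memLp _) k i (hD _ i)
  have hS : slaterFun B α = fun X => ∑ σ, c σ * F σ X := by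
    funext X
    simp only [slaterFun, Matrix.det_apply', Finset.mul_sum, c, F, o, Matrix.of_apply, mul_assoc]
  have hSm : MemLp (fun X => ∑ σ, c σ * F σ X) 2 :=
    memLp_finsetSum _ fun σ _ => (hF σ).const_mul (c σ)
  have hGm : ∀ k i, MemLp (fun X => ∑ σ, c σ * G k i σ X) 2 := fun k i =>
    memLp_finsetSum _ fun σ _ => (hG k i σ).const_mul (c σ)
  refine ⟨⟨Jet.mk (hSm.toLp _) fun k i => (hGm k i).toLp _, ?_, ?_⟩, ?_⟩
  · intro π
    have h0 := hSm.coeFn_toLp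
    have h0' : ∀ᵐ X : Conf N, hSm.toLp _ X = ∑ σ, c σ * F σ X := h0
    filter_upwards [h0', (measurePreserving_comp_perm π).quasiMeasurePreserving.ae h0'] with X h1 h2
    simp only [Jet.fn_mk]
    rw [h1, h2, ← congrFun hS X, ← congrFun hS (X ∘ π)]
    simp only [slaterFun]
    have := Matrix.det_permute' π (Matrix.of fun i j : Fin N => B.φ (α.1.orderEmbOfFin α.2 i) (X j))
    have e : (Matrix.of fun i j : Fin N => B.φ (α.1.orderEmbOfFin α.2 i) ((X ∘ π) j)) =
      (Matrix.of fun i j : Fin N => B.φ (α.1.orderEmbOfFin α.2 i) (X j)).submatrix id π := rfl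
    rw [e, this]; ring
  · intro k i
    exact (isWeakDeriv_sum Finset.univ c hF (hG k i) (hW k i)).congr hSm.coeFn_toLp.symm
      (hGm k i).coeFn_toLp.symm
  · exact hSm.coeFn_toLp.trans (Filter.EventuallyEq.of_eq hS.symm)

/-- The Slater determinant `Φ_α` as an element of `ℌ¹`. -/
def slater (B : OrbitalSet K) (α : State N K) : H1 N := (exists_slater B α).choose

theorem slater_ae (B : OrbitalSet K) (α : State N K) :
    (Jet.fn (slater B α).1 : Conf N → ℝ) =ᵐ[volume] slaterFun B α := (exists_slater B α).choose_spec

/-- The closed linear span of the Slater determinants in `ℌ¹`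
(for finite `K` this is just the linear span). -/
def slaterSpan (B : OrbitalSet K) (N : ℕ) : Submodule ℝ (H1 N) :=
  (Submodule.span ℝ (Set.range fun α : State N K => slater B α)).topologicalClosure

/-- The space `ℌ¹_K`, with the `ℌ¹` inner product. -/
def H1K (B : OrbitalSet K) (N : ℕ) : Type := slaterSpan B N

instance (B : OrbitalSet K) (N : ℕ) : NormedAddCommGroup (H1K B N) :=
  inferInstanceAs (NormedAddCommGroup (slaterSpan B N))

instance (B : OrbitalSet K) (N : ℕ) : InnerProductSpace ℝ (H1K B N) :=
  inferInstanceAs (InnerProductSpace ℝ (slaterSpan B N))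

/-- The inclusion `ℌ¹_K ⊂ ℌ¹`. -/
def incl (B : OrbitalSet K) (N : ℕ) : H1K B N →L[ℝ] H1 N := (slaterSpan B N).subtypeL

theorem norm_incl (B : OrbitalSet K) (Θ : H1K B N) : ‖incl B N Θ‖ = ‖Θ‖ := rfl

/-- The determinant `Φ_α` as an element of `ℌ¹_K`. -/
def det (B : OrbitalSet K) (α : State N K) : H1K B N :=
  (⟨slater B α, Submodule.le_topologicalClosure _ (Submodule.subset_span ⟨α, rfl⟩)⟩ :
    slaterSpan B N)

theorem incl_det (B : OrbitalSet K) (α : State N K) : incl B N (det B α) = slater B α := rfl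

/-- Bounded operators on `ℌ¹_K`. -/
abbrev Op (B : OrbitalSet K) (N : ℕ) : Type := H1K B N →L[ℝ] H1K B N

/-- The continuous dual `(ℌ¹_K)*`. -/
abbrev Dual (B : OrbitalSet K) (N : ℕ) : Type := StrongDual ℝ (H1K B N)

/-- The embedding `ℌ¹_K ⊂ L²`. -/
def toL2 (B : OrbitalSet K) (N : ℕ) : H1K B N →L[ℝ] L2 N :=
  Jet.fn.comp ((H1 N).subtypeL.comp (incl B N))

/-- The Gelfand embedding `ℌ¹_K ⊂ (ℌ¹_K)*`, i.e. `gelfand B N Ψ Φ` is the `L²` inner product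
`⟨Ψ, Φ⟩`. -/
def gelfand (B : OrbitalSet K) (N : ℕ) : H1K B N →L[ℝ] Dual B N :=
  (innerSL ℝ).bilinearComp (toL2 B N) (toL2 B N)

/-- The `L²` inner product `⟨Ψ, Φ⟩` on `ℌ¹_K`. -/
abbrev ip {B : OrbitalSet K} (Ψ Φ : H1K B N) : ℝ := gelfand B N Ψ Φ

theorem ip_eq_inner {B : OrbitalSet K} (Ψ Φ : H1K B N) :
    ip Ψ Φ = inner ℝ (toL2 B N Ψ) (toL2 B N Φ) := rfl

/-! ### Excitation graphs -/

/-- The occupied part of `α` with respect to the reference `o`. -/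
def occ (o α : State N K) : Finset (Orb K) := α.1 ∩ o.1

/-- The virtual part of `α` with respect to the reference `o`. -/
def virt (o α : State N K) : Finset (Orb K) := α.1 \ o.1

/-- The join of `α` and `β` with respect to the reference `o`. -/
def join (o α β : State N K) : Finset (Orb K) := (occ o α ∩ occ o β) ∪ (virt o α ∪ virt o β)

theorem card_join {o α β : State N K} (h : (occ o α ∪ occ o β).card = N)
    (h' : virt o α ∩ virt o β = ∅) : (join o α β).card = N := by
  have hd : Disjoint (occ o α ∩ occ o β) (virt o α ∪ virt o β) := by
    rw [Finset.disjoint_left]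
    intro p
    simp only [occ, virt, mem_inter, mem_union, mem_sdiff]
    tauto
  have h1 := Finset.card_union_add_card_inter (occ o α) (occ o β)
  have h2 := Finset.card_union_of_disjoint (Finset.disjoint_iff_inter_eq_empty.2 h')
  have h3 : (occ o α).card + (virt o α).card = N := by
    exact (Finset.card_inter_add_card_sdiff _ _).trans α.2
  have h4 : (occ o β).card + (virt o β).card = N := by
    exact (Finset.card_inter_add_card_sdiff _ _).trans β.2
  rw [join, Finset.card_union_of_disjoint hd]
  omega

/-- The vertex set `L_m`: all states except the references other than the `m`-th one. -/
def IsVertex (ref : Fin M → State N K) (m : Fin M) (α : State N K) : Prop :=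
  ∀ n, n ≠ m → α ≠ ref n

/-- The full excitation graph with respect to the `m`-th reference has an edge with label `α`
from `β` to the join of `α` and `β`. -/
structure IsEdge (ref : Fin M → State N K) (m : Fin M) (α β : State N K) : Prop where
  left : IsVertex ref m α
  right : IsVertex ref m β
  ne : α ≠ ref m
  occ_union : (occ (ref m) α ∪ occ (ref m) β).card = N
  virt_inter : virt (ref m) α ∩ virt (ref m) β = ∅
  target : IsVertex ref m ⟨join (ref m) α β, card_join occ_union virt_inter⟩

/-- The excitations `Ξ(G_m)` of the full excitation graph, namely `L_m` without the `m`-th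
reference. -/
abbrev Exc (ref : Fin M → State N K) (m : Fin M) : Type :=
  {α : State N K // IsVertex ref m α ∧ α ≠ ref m}

/-- `σ(α, β)`: the sign of the permutation that sorts the increasing virtual orbitals of `β`
followed by the increasing virtual orbitals of `α`, i.e. `-1` to the number of inversions. -/
def excSign (o α β : State N K) : ℝ :=
  (-1) ^ ((virt o β ×ˢ virt o α).filter fun p => p.2 < p.1).card

open Classical in
/-- `X_α^{(m)} Φ_β`, the action of an excitation operator of the full excitation graph on a
determinant. -/
def excite (B : OrbitalSet K) (ref : Fin M → State N K) (m : Fin M) (α β : State N K) :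
    H1K B N :=
  if h : IsEdge ref m α β then
    excSign (ref m) α β • det B ⟨join (ref m) α β, card_join h.occ_union h.virt_inter⟩
  else 0

/-! ### Cluster amplitudes and cluster operators -/

/-- The amplitude space `𝕍(G_m)` of the full excitation graph: the square summable amplitudes `t`
for which `T Φ_{0_m} = ∑ t_α Φ_α` (an `L²`-convergent sum) lies in `ℌ¹_K`. -/
def ampSpace (B : OrbitalSet K) (ref : Fin M → State N K) (m : Fin M) :
    Set (lp (fun _ : Exc ref m => ℝ) 2) :=
  {t | ∃ Θ : H1K B N, HasSum (fun α : Exc ref m => t α • toL2 B N (det B α.1)) (toL2 B N Θ)}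

/-- `T = ∑ t_α X_α^{(m)}` as a bounded operator on `ℌ¹_K`: on every determinant, the sum converges
in `L²`. Since the determinants span a dense subspace, `T` is unique. -/
def IsClusterOp (B : OrbitalSet K) (ref : Fin M → State N K) (m : Fin M)
    (t : lp (fun _ : Exc ref m => ℝ) 2) (T : Op B N) : Prop :=
  ∀ β : State N K,
    HasSum (fun α : Exc ref m => t α • toL2 B N (excite B ref m α.1 β)) (toL2 B N (T (det B β)))

open Classical in
/-- The cluster operator `T` with amplitudes `t`. -/
def clusterOp (B : OrbitalSet K) (ref : Fin M → State N K) (m : Fin M)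
    (t : lp (fun _ : Exc ref m => ℝ) 2) : Op B N :=
  if h : ∃ T, IsClusterOp B ref m t T then h.choose else 0

/-- `E` is a bounded extension of `A` from `ℌ¹_K` to `(ℌ¹_K)*`. -/
def IsDualExt {B : OrbitalSet K} (A : Op B N) (E : Dual B N →L[ℝ] Dual B N) : Prop :=
  ∀ Ψ, E (gelfand B N Ψ) = gelfand B N (A Ψ)

open Classical in
/-- The bounded extension of `A` from `ℌ¹_K` to `(ℌ¹_K)*`. -/
def dualExt {B : OrbitalSet K} (A : Op B N) : Dual B N →L[ℝ] Dual B N :=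
  if h : ∃ E, IsDualExt A E then h.choose else 0

/-! ### The JM-MRCC and MRCI equations -/

/-- A choice of amplitudes for every reference. -/
abbrev Amps (ref : Fin M → State N K) : Type :=
  (m : Fin M) → lp (fun _ : Exc ref m => ℝ) 2

/-- The exponential Ansatz `e^{T^{(m)}} Φ_{0_m}`. -/
def ccState (B : OrbitalSet K) (ref : Fin M → State N K) (t : Amps ref) (m : Fin M) : H1K B N :=
  NormedSpace.exp (clusterOp B ref m (t m)) (det B (ref m))

/-- The linear Ansatz `(I + C^{(m)}) Φ_{0_m}`. -/
def ciState (B : OrbitalSet K) (ref : Fin M → State N K) (c : Amps ref) (m : Fin M) : H1K B N :=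
  (1 + clusterOp B ref m (c m)) (det B (ref m))

/-- The functional `e^{-T^{(m)}} H e^{T^{(m)}} Φ_{0_m}`. -/
def ccFunctional (B : OrbitalSet K) (ref : Fin M → State N K) (H : H1K B N →L[ℝ] Dual B N)
    (t : Amps ref) (m : Fin M) : Dual B N :=
  dualExt (NormedSpace.exp (-clusterOp B ref m (t m))) (H (ccState B ref t m))

/-- `H^eff_{mn} = ⟨e^{-T^{(m)}} H e^{T^{(m)}} Φ_{0_m}, Φ_{0_n}⟩`. -/
def ccHeff (B : OrbitalSet K) (ref : Fin M → State N K) (H : H1K B N →L[ℝ] Dual B N)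
    (t : Amps ref) : Matrix (Fin M) (Fin M) ℝ :=
  Matrix.of fun m n => ccFunctional B ref H t m (det B (ref n))

/-- `Ĥ^eff_{mn} = ⟨H (I + C^{(m)}) Φ_{0_m}, Φ_{0_n}⟩`. -/
def ciHeff (B : OrbitalSet K) (ref : Fin M → State N K) (H : H1K B N →L[ℝ] Dual B N)
    (c : Amps ref) : Matrix (Fin M) (Fin M) ℝ :=
  Matrix.of fun m n => H (ciState B ref c m) (det B (ref n))

/-- The amplitudes `t` parametrize `𝔐` and solve the full JM-MRCC equations. -/
structure FullJMMRCC (B : OrbitalSet K) (ref : Fin M → State N K) (H : H1K B N →L[ℝ] Dual B N)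
    (𝔐 : Submodule ℝ (H1K B N)) (t : Amps ref) : Prop where
  mem : ∀ m, t m ∈ ampSpace B ref m
  span_eq : 𝔐 = Submodule.span ℝ (Set.range (ccState B ref t))
  eqn : ∀ m, ∀ s ∈ ampSpace B ref m,
    ccFunctional B ref H t m (clusterOp B ref m s (det B (ref m))) =
      ∑ n, ccHeff B ref H t m n *
        ip (NormedSpace.exp (-clusterOp B ref m (t m)) (ccState B ref t n))
          (clusterOp B ref m s (det B (ref m)))

/-- The amplitudes `c` parametrize `𝔐` and solve the full MRCI equations. -/
structure FullMRCI (B : OrbitalSet K) (ref : Fin M → State N K) (H : H1K B N →L[ℝ] Dual B N)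
    (𝔐 : Submodule ℝ (H1K B N)) (c : Amps ref) : Prop where
  mem : ∀ m, c m ∈ ampSpace B ref m
  span_eq : 𝔐 = Submodule.span ℝ (Set.range (ciState B ref c))
  eqn : ∀ m, ∀ s ∈ ampSpace B ref m,
    H (ciState B ref c m) (clusterOp B ref m s (det B (ref m))) =
      ∑ n, ciHeff B ref H c m n *
        ip (ciState B ref c n) (clusterOp B ref m s (det B (ref m)))

/-- The span of the targets `Ψ_1, ..., Ψ_M`. -/
abbrev targetSpan {B : OrbitalSet K} (Ψ : Fin M → H1K B N) : Submodule ℝ (H1K B N) :=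
  Submodule.span ℝ (Set.range Ψ)

/-- The span of `Ψ_1, ..., Ψ_M` is weakly `H`-invariant. -/
def WeaklyInvariant {B : OrbitalSet K} (H : H1K B N →L[ℝ] Dual B N) (Ψ : Fin M → H1K B N) : Prop :=
  ∀ m, ∃ Θ ∈ targetSpan Ψ, ∀ Φ, H (Ψ m) Φ = ip Θ Φ

/-- `𝔑 = Span {Φ_{0_1}, ..., Φ_{0_M}}`. -/
def modelSpace (B : OrbitalSet K) (ref : Fin M → State N K) : Submodule ℝ (H1K B N) :=
  Submodule.span ℝ (Set.range fun m => det B (ref m))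

/-- The `L²`-orthogonal complement in `ℌ¹_K` of a subspace of `ℌ¹_K`. -/
def l2Perp {B : OrbitalSet K} (𝔘 : Submodule ℝ (H1K B N)) : Submodule ℝ (H1K B N) where
  carrier := {Φ | ∀ Θ ∈ 𝔘, ip Θ Φ = 0}
  zero_mem' := fun Θ _ => by simp
  add_mem' := fun {a b} ha hb Θ h => by simp [ha Θ h, hb Θ h]
  smul_mem' := fun c a ha Θ h => by simp [ha Θ h]

end JM

end

open JM

noncomputable section

namespace JM

variable {N M : ℕ} {K : ℕ∞}

/-! ### Weak derivatives and completeness -/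

/-! The algebra rests on one fact: an excitation never produces a reference. The references `0_n`,
`n ≠ m`, are not vertices of the `m`-th graph, and every excitation adds a virtual orbital, so `0_m`
is not a target either. Hence the range of every cluster operator is `L²`-orthogonal to all
`Φ_{0_n}` (`IsClusterOp.ip_ref`), and the families `(I + C^{(m)})Φ_{0_m}` and `e^{T^{(m)}}Φ_{0_m}`
are biorthogonal to the references (`IsNormalized`). The span of such a family is complementary to
`𝔑^⊥`, and every complement of `𝔑^⊥` is spanned by such a family. Each of its members has both
forms: the linear one by expansion in determinants, the exponential one by correcting the amplitudes
rank by rank, which ends because ranks are at most `N` (`exists_exp_clusterOp_eq`).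

The test vectors `SΦ_{0_m}` exhaust `𝔑^⊥` (`forall_clusterOp_ref`). On the references both sides of
the equations agree by the choice of the effective matrix, so the equations hold against all of
`ℌ¹_K` (`eqOn_perp_iff`). In the coupled-cluster case `e^{-T}` is moved to the test vector as its
`L²`-adjoint, which is onto. What remains is `H Ω_m = ∑ A_{mn} Ω_n`, which is weak invariance, with
the effective matrix as `A`. Testing an eigenvalue equation against the references then gives the
matrix eigenvalue problem.

The analytic part is that cluster operators and their `L²`-adjoints are bounded on `ℌ¹_K`; the
adjoint yields the extension to the dual. A finite combination of determinants is described by its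
coefficient tensor, and its Sobolev norm by `nsq`. The cluster operator takes some slots from the
tensor of `Θ = ∑ t_α Φ_α` and the others from its argument, with signs, and antisymmetrizes. The
sign that compares a virtual orbital of `α` with one of `β` is no product of one-slot weights, but
antisymmetrization produces it by itself (`tsgn_merge`). The other signs compare one orbital with
the reference and are constant beyond finitely many orbitals, so they are bounded multipliers even
if the orbital gradients are unbounded. Merging tensors and its transpose, contraction, obey bounds
independent of the number of orbitals, and density does the rest (`exists_fullCluster`,
`exists_isAdj`). -/

theorem IsWeakDeriv.ae_unique {E : Type} [NormedAddCommGroup E] [NormedSpace ℝ E]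
    [FiniteDimensional ℝ E] [MeasureSpace E] [BorelSpace E]
    [IsFiniteMeasureOnCompacts (volume : Measure E)] {v : E} {f g g' : E → ℝ}
    (hg : MemLp g 2) (hg' : MemLp g' 2) (h : IsWeakDeriv v f g) (h' : IsWeakDeriv v f g') :
    g =ᵐ[volume] g' := by
  have hl : LocallyIntegrable (fun x => g x - g' x) volume :=
    (hg.sub hg').locallyIntegrable (by norm_num)
  have : ∀ᵐ x, g x - g' x = 0 := by
    refine ae_eq_zero_of_integral_contDiff_smul_eq_zero hl fun ψ hψ hc => ?_
    have h1 := h ψ hψ hc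
    rw [h' ψ hψ hc, neg_inj] at h1
    have h2 : ∀ x, ψ x • (g x - g' x) = g x * ψ x - g' x * ψ x := fun x => by
      simp only [smul_eq_mul]; ring
    simp only [h2]
    rw [integral_sub (integrable_lp_mul_test hg hψ.continuous hc)
      (integrable_lp_mul_test hg' hψ.continuous hc), h1, sub_self]
  exact this.mono fun x hx => sub_eq_zero.1 hx

/-- The components of a jet are the weak derivatives of its function. -/
def Jet.IsWeak (u : Jet N) : Prop :=
  ∀ (k : Fin N) (i : Fin 3),
    IsWeakDeriv (dir k i) (Jet.fn u : Conf N → ℝ) (Jet.deriv k i u : Conf N → ℝ)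

theorem Jet.ext' {u v : Jet N} (h : Jet.fn u = Jet.fn v)
    (h' : ∀ k i, Jet.deriv k i u = Jet.deriv k i v) : u = v := by
  rw [← sub_eq_zero, ← inner_self_eq_zero (𝕜 := ℝ), Jet.inner_eq]
  simp [map_sub, h, h']

theorem Jet.IsWeak.ext {u v : Jet N} (hu : u.IsWeak) (hv : v.IsWeak)
    (h : Jet.fn u = Jet.fn v) : u = v := by
  refine Jet.ext' h fun k i => Lp.ext ?_
  have h1 := hu k i
  rw [h] at h1
  exact IsWeakDeriv.ae_unique (Lp.memLp _) (Lp.memLp _) h1 (hv k i)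

theorem Jet.isWeak_sum {ι : Type} (s : Finset ι) (c : ι → ℝ) {u : ι → Jet N}
    (hu : ∀ j, (u j).IsWeak) : (∑ j ∈ s, c j • u j).IsWeak := by
  classical
  intro k i
  have := isWeakDeriv_sum s c (f := fun j => (Jet.fn (u j) : Conf N → ℝ))
    (g := fun j => (Jet.deriv k i (u j) : Conf N → ℝ)) (fun j => Lp.memLp _)
    (fun j => Lp.memLp _) (fun j => hu j k i)
  have key : ∀ f : ι → L2 N, (fun x => ∑ j ∈ s, c j * f j x) =ᵐ[volume]
      (∑ j ∈ s, c j • f j : L2 N) := by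
    intro f
    refine Filter.EventuallyEq.trans ?_ (Lp.coeFn_finsetSum s _).symm
    have : ∀ᵐ x : Conf N, ∀ j ∈ s, (c j • f j : L2 N) x = c j * f j x := by
      rw [Filter.eventually_all_finset]
      exact fun j _ => (Lp.coeFn_smul (c j) (f j)).mono fun x hx => by
        rw [hx]; rfl
    filter_upwards [this] with x hx
    simp only [Finset.sum_apply]
    exact Finset.sum_congr rfl fun j hj => (hx j hj).symm
  refine this.congr ?_ ?_
  · simpa [map_sum] using key fun j => Jet.fn (u j)
  · simpa [map_sum] using key fun j => Jet.deriv k i (u j)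

/-- Permuting particles is an isometry of `L²`, and for a fixed test function both sides of the weak
derivative identity are continuous in the jet. The defining conditions are therefore an intersection
of closed ones. -/
theorem isClosed_H1 (N : ℕ) : IsClosed (H1 N : Set (Jet N)) := by
  have hset : (H1 N : Set (Jet N)) =
      (⋂ π : Equiv.Perm (Fin N), {u | Lp.compMeasurePreserving _ (measurePreserving_comp_perm π)
          (Jet.fn u) = (Equiv.Perm.sign π : ℝ) • Jet.fn u}) ∩
      ⋂ (k : Fin N) (i : Fin 3) (ψ : {ψ : Conf N → ℝ // ContDiff ℝ ∞ ψ ∧ HasCompactSupport ψ}),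
        {u | ∫ x, (Jet.fn u : Conf N → ℝ) x * fderiv ℝ ψ.1 x (dir k i) =
          -∫ x, (Jet.deriv k i u : Conf N → ℝ) x * ψ.1 x} := by
    ext u
    simp only [Set.mem_inter_iff, Set.mem_iInter, Set.mem_ofPred_eq]
    refine and_congr (forall_congr' fun π => ?_)
      (forall₂_congr fun k i => ⟨fun h ψ => h ψ.1 ψ.2.1 ψ.2.2, fun h ψ h1 h2 => h ⟨ψ, h1, h2⟩⟩)
    have e1 := Lp.coeFn_compMeasurePreserving (Jet.fn u) (measurePreserving_comp_perm π)
    have e2 := Lp.coeFn_smul (Equiv.Perm.sign π : ℝ) (Jet.fn u)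
    constructor
    · intro h
      refine Lp.ext ?_
      filter_upwards [e1, e2, h] with X h1 h2 h3
      rw [h1, h2]; exact h3
    · intro h
      filter_upwards [e1, e2] with X h1 h2
      rw [h, h2] at h1
      exact h1.symm
  rw [hset]
  have hint : ∀ (D : Jet N →L[ℝ] L2 N) (ψ : Conf N → ℝ), Continuous ψ → HasCompactSupport ψ →
      Continuous fun u => ∫ x, (D u : Conf N → ℝ) x * ψ x := by
    intro D ψ h1 h2
    have hm : MemLp ψ 2 (volume : Measure (Conf N)) := h1.memLp_of_hasCompactSupport h2
    have : (fun u => ∫ x, (D u : Conf N → ℝ) x * ψ x) =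
        fun u => inner ℝ (hm.toLp ψ) (D u) := by
      funext u
      rw [L2.inner_def]
      refine integral_congr_ae ?_
      filter_upwards [hm.coeFn_toLp] with x hx
      simp [hx]
    rw [this]
    fun_prop
  refine IsClosed.inter (isClosed_iInter fun π => isClosed_eq ?_ ?_)
    (isClosed_iInter fun k => isClosed_iInter fun i => isClosed_iInter fun ψ => isClosed_eq ?_ ?_)
  · exact (Lp.isometry_compMeasurePreserving _).continuous.comp (Jet.fn (N := N)).continuous
  · exact Continuous.const_smul (Jet.fn (N := N)).continuous (Equiv.Perm.sign π : ℝ)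
  · obtain ⟨h1, h2⟩ := continuous_fderiv_test ψ.2.1 ψ.2.2 (dir k i)
    exact hint Jet.fn _ h1 h2
  · exact (hint (Jet.deriv k i) _ ψ.2.1.continuous ψ.2.2).neg

instance (N : ℕ) : CompleteSpace (H1 N) := (isClosed_H1 N).completeSpace_coe

instance (B : OrbitalSet K) (N : ℕ) : CompleteSpace (H1K B N) :=
  (Submodule.isClosed_topologicalClosure _).completeSpace_coe

/-! ### Embeddings and dense subspaces of `ℌ¹_K` -/

/-- The inclusion of `ℌ¹_K` into the jets. -/
def toJet (B : OrbitalSet K) (N : ℕ) : H1K B N →L[ℝ] Jet N :=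
  (H1 N).subtypeL.comp (incl B N)

theorem norm_toJet (B : OrbitalSet K) (Ψ : H1K B N) : ‖toJet B N Ψ‖ = ‖Ψ‖ := rfl

theorem fn_toJet (B : OrbitalSet K) (Ψ : H1K B N) : Jet.fn (toJet B N Ψ) = toL2 B N Ψ := rfl

theorem toJet_isWeak (B : OrbitalSet K) (Ψ : H1K B N) : (toJet B N Ψ).IsWeak :=
  (incl B N Ψ).2.2

/-- Weak gradients are unique, so the function component determines the whole jet. This makes the
form `ip` positive definite. -/
theorem toL2_injective (B : OrbitalSet K) : Function.Injective (toL2 B N) := by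
  intro Ψ Φ h
  have : toJet B N Ψ = toJet B N Φ := (toJet_isWeak B Ψ).ext (toJet_isWeak B Φ) h
  exact Subtype.ext (Subtype.ext this)

theorem ip_self_eq_zero {B : OrbitalSet K} {Ψ : H1K B N} (h : ip Ψ Ψ = 0) : Ψ = 0 := by
  rw [ip_eq_inner, inner_self_eq_zero] at h
  exact toL2_injective B (h.trans (map_zero _).symm)

theorem ip_comm {B : OrbitalSet K} (Ψ Φ : H1K B N) : ip Ψ Φ = ip Φ Ψ := by
  rw [ip_eq_inner, ip_eq_inner, real_inner_comm]

theorem ip_zero_left {B : OrbitalSet K} (Φ : H1K B N) : ip 0 Φ = 0 := by simp [ip]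

theorem ip_smul_left {B : OrbitalSet K} (c : ℝ) (Ψ Φ : H1K B N) : ip (c • Ψ) Φ = c * ip Ψ Φ := by
  simp [ip]

theorem ip_sum_left {B : OrbitalSet K} {ι : Type} (s : Finset ι) (Ψ : ι → H1K B N)
    (Φ : H1K B N) : ip (∑ j ∈ s, Ψ j) Φ = ∑ j ∈ s, ip (Ψ j) Φ := by
  simp [ip]

/-- The span of the determinants is dense in `ℌ¹_K`. -/
theorem dense_span_det (B : OrbitalSet K) (N : ℕ) :
    Dense (Submodule.span ℝ (Set.range fun α : State N K => det B α) : Set (H1K B N)) := by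
  have hmap : (Submodule.span ℝ (Set.range fun α : State N K => det B α)).map
      (incl B N).toLinearMap =
      Submodule.span ℝ (Set.range fun α : State N K => slater B α) := by
    rw [Submodule.map_span, ← Set.range_comp]; rfl
  intro Ψ
  have h1 : incl B N Ψ ∈ closure (incl B N '' (Submodule.span ℝ
      (Set.range fun α : State N K => det B α) : Set (H1K B N))) := by
    have : (incl B N Ψ : H1 N) ∈ slaterSpan B N := Subtype.property (p := (· ∈ slaterSpan B N)) Ψ
    rw [slaterSpan, ← hmap] at this
    exact this
  have hi : Topology.IsInducing (incl B N) := Topology.IsInducing.subtypeVal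
  rw [hi.closure_eq_preimage_closure_image]
  exact h1

theorem denseRange_linearCombination_det (B : OrbitalSet K) (N : ℕ) :
    DenseRange (Finsupp.linearCombination ℝ fun α : State N K => det B α) := by
  have := dense_span_det B N
  rw [← Finsupp.range_linearCombination] at this
  exact this

/-- After Riesz identification, a vector `Φ` orthogonal to the range satisfies `⟨Φ, Φ⟩ = 0`. Density
makes extensions to the dual unique, and allows operators to be defined by their values on the
range. -/
theorem gelfand_denseRange (B : OrbitalSet K) (N : ℕ) : DenseRange (gelfand B N) := by
  set G : H1K B N →L[ℝ] H1K B N :=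
    (InnerProductSpace.toDual ℝ (H1K B N)).symm.toContinuousLinearEquiv.toContinuousLinearMap.comp
      (gelfand B N)
  have hG : ∀ Ψ Φ, inner ℝ (G Ψ) Φ = ip Ψ Φ := fun Ψ Φ =>
    InnerProductSpace.toDual_symm_apply
  have hd : DenseRange G := by
    have h0 : (LinearMap.range G.toLinearMap)ᗮ = ⊥ := by
      rw [Submodule.eq_bot_iff]
      intro Φ hΦ
      have := (Submodule.mem_orthogonal _ _).1 hΦ (G Φ) ⟨Φ, rfl⟩
      rw [hG] at this
      exact ip_self_eq_zero this
    have := Submodule.dense_iff_topologicalClosure_eq_top.2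
      (Submodule.topologicalClosure_eq_top_iff.2 h0)
    exact this
  have h2 := (InnerProductSpace.toDual ℝ (H1K B N)).surjective.denseRange.comp hd
    (InnerProductSpace.toDual ℝ (H1K B N)).continuous
  convert h2 using 1
  funext Ψ
  simp [G]

/-! ### Tensor products of orbitals -/

/-- The space of one-particle functions. -/
abbrev L21 : Type := Lp ℝ 2 (volume : Measure E3)

/-- The tensor product of one-particle functions. -/
def tens (f : Fin N → L21) : L2 N :=
  (memLp_prod (f := fun j => (f j : E3 → ℝ)) fun _ => Lp.memLp _).toLp _

theorem tens_ae (f : Fin N → L21) :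
    (tens f : Conf N → ℝ) =ᵐ[volume] fun X => ∏ j, f j (X j) := MemLp.coeFn_toLp _

theorem inner_tens (f g : Fin N → L21) :
    inner ℝ (tens f) (tens g) = ∏ j, inner ℝ (f j) (g j) := by
  rw [L2.inner_def]
  simp only [L2.inner_def]
  rw [← integral_fintype_prod_volume_eq_prod]
  refine integral_congr_ae ?_
  filter_upwards [tens_ae f, tens_ae g] with X h1 h2
  simp [h1, h2, Finset.prod_mul_distrib]

/-- The partial derivatives of the orbitals. -/
def OrbitalSet.pd (B : OrbitalSet K) (p : Orb K) (a : Fin 3) : L21 := (B.mem_H1 p a).choose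

theorem OrbitalSet.pd_spec (B : OrbitalSet K) (p : Orb K) (a : Fin 3) :
    IsWeakDeriv (EuclideanSpace.single a (1 : ℝ)) (B.φ p : E3 → ℝ) (B.pd p a) :=
  (B.mem_H1 p a).choose_spec

/-- The gradients of the orbitals. -/
def OrbitalSet.grad (B : OrbitalSet K) (p : Orb K) : PiLp 2 (fun _ : Fin 3 => L21) :=
  WithLp.toLp 2 (B.pd p)

theorem OrbitalSet.inner_grad (B : OrbitalSet K) (p q : Orb K) :
    inner ℝ (B.grad p) (B.grad q) = ∑ a, inner ℝ (B.pd p a) (B.pd q a) := rfl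

theorem OrbitalSet.inner_φ (B : OrbitalSet K) (p q : Orb K) :
    inner ℝ (B.φ p) (B.φ q) = if p = q then 1 else 0 := orthonormal_iff_ite.1 B.orthonormal p q

/-- The tensor product of orbitals together with its weak gradient. -/
def tensJet (B : OrbitalSet K) (i : Fin N → Orb K) : Jet N :=
  Jet.mk (tens fun j => B.φ (i j)) fun k a =>
    tens (Function.update (fun j => B.φ (i j)) k (B.pd (i k) a))

theorem tensJet_isWeak (B : OrbitalSet K) (i : Fin N → Orb K) : (tensJet B i).IsWeak := by
  intro k a
  have := isWeakDeriv_prod (f := fun j => (B.φ (i j) : E3 → ℝ)) (fun j => Lp.memLp _)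
    (Lp.memLp (B.pd (i k) a)) k a (B.pd_spec _ _)
  refine this.congr (tens_ae _).symm ?_
  refine Filter.EventuallyEq.trans (Filter.EventuallyEq.of_eq ?_) (tens_ae _).symm
  funext X
  refine Finset.prod_congr rfl fun j _ => ?_
  rcases eq_or_ne j k with rfl | hj
  · simp
  · simp [hj]

theorem inner_tens_orb (B : OrbitalSet K) (i j : Fin N → Orb K) :
    inner ℝ (tens fun l => B.φ (i l)) (tens fun l => B.φ (j l)) = if i = j then 1 else 0 := by
  rw [inner_tens]
  simp only [B.inner_φ, Finset.prod_ite_zero, Finset.mem_univ, true_imp_iff, funext_iff,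
    Finset.prod_const_one]

/-- A derivative in particle `k` changes only the factor `k`; orthonormality of the other factors
forces the tuples to agree off `k`. What is left in slot `k` is the Gram matrix of the orbital
gradients. -/
theorem inner_tensJet (B : OrbitalSet K) (i j : Fin N → Orb K) :
    inner ℝ (tensJet B i) (tensJet B j) = (if i = j then 1 else 0) +
      ∑ k, if ∀ l, l ≠ k → i l = j l then inner ℝ (B.grad (i k)) (B.grad (j k)) else 0 := by
  rw [Jet.inner_eq]
  simp only [tensJet, Jet.fn_mk, Jet.deriv_mk, inner_tens_orb]
  congr 1
  refine Finset.sum_congr rfl fun k _ => ?_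
  have h : ∀ a, inner ℝ (tens (Function.update (fun l => B.φ (i l)) k (B.pd (i k) a)))
      (tens (Function.update (fun l => B.φ (j l)) k (B.pd (j k) a))) =
      if ∀ l, l ≠ k → i l = j l then inner ℝ (B.pd (i k) a) (B.pd (j k) a) else 0 := by
    intro a
    rw [inner_tens, ← Finset.mul_prod_erase _ _ (Finset.mem_univ k)]
    have : ∀ l ∈ Finset.univ.erase k,
        inner ℝ (Function.update (fun l => B.φ (i l)) k (B.pd (i k) a) l)
          (Function.update (fun l => B.φ (j l)) k (B.pd (j k) a) l) =
        if i l = j l then (1 : ℝ) else 0 := by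
      intro l hl
      simp [Finset.ne_of_mem_erase hl, B.inner_φ]
    rw [Finset.prod_congr rfl this, Finset.prod_ite_zero]
    simp
  simp only [h]
  split_ifs
  · rw [B.inner_grad]
  · simp

/-- The determinants as antisymmetrized tensor products. -/
theorem toJet_det (B : OrbitalSet K) (α : State N K) :
    toJet B N (det B α) = ∑ σ : Equiv.Perm (Fin N),
      ((Real.sqrt (N.factorial : ℝ))⁻¹ * (Equiv.Perm.sign σ : ℝ)) •
        tensJet B (fun j => α.1.orderEmbOfFin α.2 (σ j)) := by
  refine (toJet_isWeak B _).ext (Jet.isWeak_sum _ _ fun σ => tensJet_isWeak B _) ?_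
  refine Lp.ext ((slater_ae B α).trans ?_)
  rw [map_sum]
  refine Filter.EventuallyEq.trans ?_ (Lp.coeFn_finsetSum Finset.univ _).symm
  have : ∀ᵐ X : Conf N, ∀ σ : Equiv.Perm (Fin N),
      (Jet.fn (((Real.sqrt (N.factorial : ℝ))⁻¹ * (Equiv.Perm.sign σ : ℝ)) •
        tensJet B (fun j => α.1.orderEmbOfFin α.2 (σ j))) : Conf N → ℝ) X =
      ((Real.sqrt (N.factorial : ℝ))⁻¹ * (Equiv.Perm.sign σ : ℝ)) *
        ∏ j, B.φ (α.1.orderEmbOfFin α.2 (σ j)) (X j) := by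
    rw [ae_all_iff]
    intro σ
    rw [map_smul]
    filter_upwards [Lp.coeFn_smul ((Real.sqrt (N.factorial : ℝ))⁻¹ * (Equiv.Perm.sign σ : ℝ))
      (Jet.fn (tensJet B (fun j => α.1.orderEmbOfFin α.2 (σ j)))),
      tens_ae (fun j => B.φ (α.1.orderEmbOfFin α.2 (σ j)))] with X h1 h2
    rw [h1, Pi.smul_apply, smul_eq_mul]
    congr 1
  filter_upwards [this] with X hX
  simp only [Finset.sum_apply, hX, slaterFun, Matrix.det_apply', Finset.mul_sum, Matrix.of_apply,
    mul_assoc]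

/-- The coefficient of a wavefunction with respect to a tensor product of orbitals. -/
def coef (B : OrbitalSet K) (i : Fin N → Orb K) : H1K B N →L[ℝ] ℝ :=
  (innerSL ℝ (tens fun j => B.φ (i j))).comp (toL2 B N)

theorem coef_apply (B : OrbitalSet K) (i : Fin N → Orb K) (Ψ : H1K B N) :
    coef B i Ψ = inner ℝ (tens fun j => B.φ (i j)) (toL2 B N Ψ) := rfl

theorem toL2_det (B : OrbitalSet K) (α : State N K) :
    toL2 B N (det B α) = ∑ σ : Equiv.Perm (Fin N),
      ((Real.sqrt (N.factorial : ℝ))⁻¹ * (Equiv.Perm.sign σ : ℝ)) •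
        tens (fun j => B.φ (α.1.orderEmbOfFin α.2 (σ j))) := by
  rw [← fn_toJet, toJet_det, map_sum]
  simp only [map_smul, tensJet, Jet.fn_mk]

theorem coef_det (B : OrbitalSet K) (i : Fin N → Orb K) (α : State N K) :
    coef B i (det B α) = ∑ σ : Equiv.Perm (Fin N),
      ((Real.sqrt (N.factorial : ℝ))⁻¹ * (Equiv.Perm.sign σ : ℝ)) *
        if i = (fun j => α.1.orderEmbOfFin α.2 (σ j)) then 1 else 0 := by
  rw [coef_apply, toL2_det, inner_sum]
  simp only [inner_smul_right, inner_tens_orb]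

theorem coef_comp_perm_det (B : OrbitalSet K) (i : Fin N → Orb K) (α : State N K)
    (π : Equiv.Perm (Fin N)) :
    coef B (i ∘ π) (det B α) = (Equiv.Perm.sign π : ℝ) * coef B i (det B α) := by
  rw [coef_det, coef_det, Finset.mul_sum, ← Equiv.sum_comp (Equiv.mulRight π)]
  refine Finset.sum_congr rfl fun σ _ => ?_
  have : (i ∘ π = fun j => α.1.orderEmbOfFin α.2 ((Equiv.mulRight π) σ j)) ↔
      i = fun j => α.1.orderEmbOfFin α.2 (σ j) := by
    constructor
    · intro h
      funext j
      have := congrFun h (π.symm j)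
      simpa using this
    · rintro rfl
      rfl
  rw [if_congr this rfl rfl]
  simp only [Equiv.coe_mulRight, Equiv.Perm.sign_mul]
  push_cast
  ring

/-- An eventually sorted enumeration of a state. -/
def State.enum (α : State N K) : Fin N → Orb K := α.1.orderEmbOfFin α.2

theorem State.enum_strictMono (α : State N K) : StrictMono α.enum :=
  (α.1.orderEmbOfFin α.2).strictMono

theorem State.image_enum (α : State N K) : Finset.univ.image α.enum = α.1 := by
  ext x
  have := Finset.range_orderEmbOfFin α.1 α.2
  simp only [Finset.mem_image, Finset.mem_univ, true_and]
  rw [← Finset.mem_coe, ← this]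
  rfl

theorem State.enum_inj {α β : State N K} (h : α.enum = β.enum) : α = β :=
  Subtype.ext (by rw [← α.image_enum, h, β.image_enum])

theorem coef_enum_det (B : OrbitalSet K) (α β : State N K) :
    coef B β.enum (det B α) = if β = α then (Real.sqrt (N.factorial : ℝ))⁻¹ else 0 := by
  rw [coef_det, Finset.sum_eq_single 1]
  · have : (β.enum = fun j => α.1.orderEmbOfFin α.2 ((1 : Equiv.Perm (Fin N)) j)) ↔ β = α :=
      ⟨fun h => State.enum_inj h, fun h => by rw [h]; rfl⟩
    rw [if_congr this rfl rfl]
    simp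
  · intro σ _ hσ
    rw [if_neg, mul_zero]
    intro h
    apply hσ
    have himg : β.1 = α.1 := by
      rw [← β.image_enum, ← α.image_enum, h]
      ext x
      simp only [Finset.mem_image, Finset.mem_univ, true_and]
      exact ⟨fun ⟨a, ha⟩ => ⟨σ a, ha⟩, fun ⟨a, ha⟩ => ⟨σ.symm a, by rw [Equiv.apply_symm_apply]; exact ha⟩⟩
    obtain rfl : β = α := Subtype.ext himg
    ext j
    have := congrFun h j
    have := β.enum_strictMono.injective this
    simp [← this]
  · simp

/-! ### Orthonormality and completeness of the determinants -/

theorem ip_det (B : OrbitalSet K) (α β : State N K) :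
    ip (det B α) (det B β) = if α = β then 1 else 0 := by
  rw [ip_eq_inner, toL2_det, sum_inner]
  -- By antisymmetry of the coefficients of a determinant, all `N!` terms of the expansion
  -- contribute the same, which compensates the two factors `N!^{-1/2}`.
  have : ∀ σ : Equiv.Perm (Fin N),
      inner ℝ (((Real.sqrt (N.factorial : ℝ))⁻¹ * (Equiv.Perm.sign σ : ℝ)) •
        tens (fun j => B.φ (α.1.orderEmbOfFin α.2 (σ j)))) (toL2 B N (det B β)) =
      (Real.sqrt (N.factorial : ℝ))⁻¹ * coef B α.enum (det B β) := by
    intro σ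
    rw [inner_smul_left]
    have h1 := coef_comp_perm_det B α.enum β σ
    rw [coef_apply] at h1
    have h2 : inner ℝ (tens (fun j => B.φ (α.1.orderEmbOfFin α.2 (σ j)))) (toL2 B N (det B β)) =
      (Equiv.Perm.sign σ : ℝ) * coef B α.enum (det B β) := h1
    rw [h2]
    have h3 : (Equiv.Perm.sign σ : ℝ) * (Equiv.Perm.sign σ : ℝ) = 1 := by
      rcases Int.units_eq_one_or (Equiv.Perm.sign σ) with h | h <;> simp [h]
    simp only [conj_trivial]
    linear_combination (Real.sqrt (N.factorial : ℝ))⁻¹ * coef B α.enum (det B β) * h3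
  rw [Finset.sum_congr rfl fun σ _ => this σ, Finset.sum_const, coef_enum_det, Finset.card_univ,
    Fintype.card_perm, Fintype.card_fin, nsmul_eq_mul]
  split_ifs with h
  · have h0 : (0 : ℝ) < N.factorial := by exact_mod_cast N.factorial_pos
    rw [← mul_inv, Real.mul_self_sqrt h0.le, mul_inv_cancel₀ h0.ne']
  · simp

theorem orthonormal_det (B : OrbitalSet K) (N : ℕ) :
    Orthonormal ℝ fun α : State N K => toL2 B N (det B α) := by
  rw [orthonormal_iff_ite]
  intro α β
  rw [← ip_eq_inner, ip_det]

/-- The determinants span a dense subspace of the image of `ℌ¹_K` in `L²`. -/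
theorem hasSum_det (B : OrbitalSet K) (Ψ : H1K B N) :
    HasSum (fun α : State N K => ip (det B α) Ψ • toL2 B N (det B α)) (toL2 B N Ψ) := by
  -- The determinants are a Hilbert basis of the closed `L²`-span `S`, which contains the image of
  -- `ℌ¹_K` because `toL2` is continuous and the determinants span a dense subspace of `ℌ¹_K`.
  set S : Submodule ℝ (L2 N) :=
    (Submodule.span ℝ (Set.range fun α : State N K => toL2 B N (det B α))).topologicalClosure
  have hmem : ∀ Ψ : H1K B N, toL2 B N Ψ ∈ S := by
    intro Ψ
    have hc : IsClosed (toL2 B N ⁻¹' (S : Set (L2 N))) :=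
      (Submodule.isClosed_topologicalClosure _).preimage (toL2 B N).continuous
    have hd := dense_span_det B N
    have : (Submodule.span ℝ (Set.range fun α : State N K => det B α) : Set (H1K B N)) ⊆
        toL2 B N ⁻¹' (S : Set (L2 N)) := by
      intro Φ hΦ
      have : (Submodule.span ℝ (Set.range fun α : State N K => det B α)) ≤
          S.comap (toL2 B N).toLinearMap := by
        rw [Submodule.span_le]
        rintro _ ⟨α, rfl⟩
        exact Submodule.le_topologicalClosure _ (Submodule.subset_span ⟨α, rfl⟩)
      exact this hΦ
    exact closure_minimal this hc (hd Ψ)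
  have : CompleteSpace S := (Submodule.isClosed_topologicalClosure _).completeSpace_coe
  let v : State N K → S := fun α => ⟨toL2 B N (det B α), hmem _⟩
  have hv : Orthonormal ℝ v := by
    rw [orthonormal_iff_ite]
    exact orthonormal_iff_ite.1 (orthonormal_det B N)
  have hsp : ⊤ ≤ (Submodule.span ℝ (Set.range v)).topologicalClosure := by
    intro x _
    have hx : (x : L2 N) ∈ closure (Subtype.val '' (Submodule.span ℝ (Set.range v) : Set S)) := by
      have h1 : Subtype.val '' (Submodule.span ℝ (Set.range v) : Set S) =
          (Submodule.span ℝ (Set.range fun α : State N K => toL2 B N (det B α)) : Set (L2 N)) := by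
        have := Submodule.map_span S.subtype (Set.range v)
        rw [← Set.range_comp] at this
        exact congrArg (fun T : Submodule ℝ (L2 N) => (T : Set (L2 N))) this
      rw [h1]
      exact x.2
    have hi : Topology.IsInducing (Subtype.val : S → L2 N) := Topology.IsInducing.subtypeVal
    change x ∈ closure _
    rw [hi.closure_eq_preimage_closure_image]
    exact hx
  let b := HilbertBasis.mk hv hsp
  have h := (b.hasSum_repr ⟨toL2 B N Ψ, hmem Ψ⟩).mapL S.subtypeL
  have e : ∀ α, S.subtypeL (b.repr ⟨toL2 B N Ψ, hmem Ψ⟩ α • b α) =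
      ip (det B α) Ψ • toL2 B N (det B α) := by
    intro α
    simp only [b, HilbertBasis.repr_apply_apply, HilbertBasis.coe_mk, map_smul]
    rfl
  simp only [e] at h
  exact h

/-- Parseval's identity. -/
theorem hasSum_ip (B : OrbitalSet K) (Ψ Φ : H1K B N) :
    HasSum (fun α : State N K => ip (det B α) Ψ * ip (det B α) Φ) (ip Ψ Φ) := by
  have := (hasSum_det B Ψ).mapL (innerSL ℝ (toL2 B N Φ))
  rw [innerSL_apply_apply, real_inner_comm, ← ip_eq_inner] at this
  simp only [map_smul, innerSL_apply_apply, smul_eq_mul, ← ip_eq_inner] at this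
  simpa only [ip_comm Φ] using this

theorem ext_ip {B : OrbitalSet K} {Ψ Φ : H1K B N}
    (h : ∀ α : State N K, ip (det B α) Ψ = ip (det B α) Φ) : Ψ = Φ := by
  have h1 : ip (Ψ - Φ) (Ψ - Φ) = 0 := by
    refine (hasSum_ip B (Ψ - Φ) (Ψ - Φ)).unique ?_
    simp only [map_sub, h, sub_self, mul_zero]
    exact hasSum_zero
  exact sub_eq_zero.1 (ip_self_eq_zero h1)

/-! ### Estimates for coefficient tensors -/

section Tensors

variable {κ ι W : Type} [Fintype κ] [DecidableEq κ] [Fintype ι] [DecidableEq ι]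
  [NormedAddCommGroup W] [InnerProductSpace ℝ W]

theorem norm_sum_smul_sq_le {ι' : Type} (s : Finset ι') (a : ι' → ℝ) (v : ι' → W) :
    ‖∑ p ∈ s, a p • v p‖ ^ 2 ≤ (∑ p ∈ s, a p ^ 2) * ∑ p ∈ s, ‖v p‖ ^ 2 := by
  have h1 : ‖∑ p ∈ s, a p • v p‖ ≤ ∑ p ∈ s, |a p| * ‖v p‖ := by
    refine (norm_sum_le _ _).trans_eq (Finset.sum_congr rfl fun p _ => ?_)
    rw [norm_smul, Real.norm_eq_abs]
  refine (pow_le_pow_left₀ (norm_nonneg _) h1 2).trans ?_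
  have := Finset.sum_mul_sq_le_sq_mul_sq s (fun p => |a p|) (fun p => ‖v p‖)
  simpa only [sq_abs] using this

/-- Contraction of the slot `k` of a tensor with a family of vectors. -/
def slice (w : ι → W) (k : κ) (c : (κ → ι) → ℝ) (i : κ → ι) : W :=
  ∑ p, c (Function.update i k p) • w p

/-- The square of the Sobolev norm of a tensor; the tuple `o` is only used for choosing
representatives of the tuples without the slot `k`. -/
def nsq (w : ι → W) (o : κ → ι) (c : (κ → ι) → ℝ) : ℝ :=
  ∑ i, c i ^ 2 + ∑ k, ∑ i with i k = o k, ‖slice w k c i‖ ^ 2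

theorem sum_eq_sum_update {A : Type} [AddCommMonoid A] (o : κ → ι) (k : κ) (F : (κ → ι) → A) :
    ∑ i, F i = ∑ i with i k = o k, ∑ p, F (Function.update i k p) := by
  rw [← Finset.sum_product']
  refine Finset.sum_nbij' (fun i => (Function.update i k (o k), i k))
    (fun x => Function.update x.1 k x.2) ?_ ?_ ?_ ?_ ?_
  · simp
  · simp
  · simp
  · rintro ⟨i, p⟩ h
    simp only [Finset.mem_product, Finset.mem_filter, Finset.mem_univ, true_and, and_true] at h
    simp [← h]
  · simp

theorem sum_eq_sum_merge {A : Type} [AddCommMonoid A] (o : κ → ι) (S : Finset κ)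
    (F : (κ → ι) → (κ → ι) → (κ → ι) → A) :
    ∑ i, F (S.piecewise i o) (S.piecewise o i) i =
      ∑ j with ∀ a ∈ S, j a = o a, ∑ l with ∀ a, a ∉ S → l a = o a, F l j (S.piecewise l j) := by
  rw [← Finset.sum_product']
  refine Finset.sum_nbij' (fun i => (S.piecewise o i, S.piecewise i o))
    (fun x => S.piecewise x.2 x.1) ?_ ?_ ?_ ?_ ?_
  · intro i _
    simp +contextual
  · simp
  · intro i _
    funext a
    by_cases ha : a ∈ S <;> simp [ha]
  · rintro ⟨j, l⟩ h
    simp only [Finset.mem_product, Finset.mem_filter, Finset.mem_univ, true_and] at h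
    refine Prod.ext ?_ ?_ <;> funext a <;> by_cases ha : a ∈ S <;> simp [ha]
    · exact (h.1 a ha).symm
    · exact (h.2 a ha).symm
  · intro i _
    congr 1
    funext a
    by_cases ha : a ∈ S <;> simp [ha]

/-- For fixed `k` the Gram form splits into blocks, one for each tuple without the slot `k`, and
each block is the squared norm of one slice. Together with `inner_tensJet` this identifies `nsq`
with the Sobolev norm. -/
theorem nsq_eq_gram (w : ι → W) (o : κ → ι) (c : (κ → ι) → ℝ) :
    ∑ i, ∑ j, c i * c j * ((if i = j then 1 else 0) +
      ∑ k, if ∀ l, l ≠ k → i l = j l then inner ℝ (w (i k)) (w (j k)) else 0) = nsq w o c := by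
  simp only [mul_add, Finset.sum_add_distrib, nsq]
  congr 1
  · refine Finset.sum_congr rfl fun i _ => ?_
    rw [Finset.sum_eq_single i]
    · simp [sq]
    · intro j _ hj
      simp [hj.symm]
    · simp
  · simp only [Finset.mul_sum]
    rw [Finset.sum_congr rfl fun i _ => Finset.sum_comm, Finset.sum_comm]
    refine Finset.sum_congr rfl fun k _ => ?_
    rw [sum_eq_sum_update o k]
    refine Finset.sum_congr rfl fun i hi => ?_
    rw [← real_inner_self_eq_norm_sq, slice, sum_inner]
    refine Finset.sum_congr rfl fun p _ => ?_
    rw [sum_eq_sum_update o k, Finset.sum_eq_single i, inner_sum]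
    · refine Finset.sum_congr rfl fun q _ => ?_
      rw [if_pos (fun l hl => by simp [hl]), inner_smul_left, inner_smul_right]
      simp [mul_assoc]
    · intro j hj hji
      refine Finset.sum_eq_zero fun q _ => ?_
      rw [if_neg, mul_zero]
      intro h
      apply hji
      funext l
      rcases eq_or_ne l k with rfl | hl
      · rw [(Finset.mem_filter.1 hi).2, (Finset.mem_filter.1 hj).2]
      · simpa [hl] using (h l hl).symm
    · intro h
      exact absurd hi h

theorem nsq_slice_nonneg (w : ι → W) (o : κ → ι) (c : (κ → ι) → ℝ) (k : κ) :
    0 ≤ ∑ i with i k = o k, ‖slice w k c i‖ ^ 2 := Finset.sum_nonneg fun _ _ => by positivity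

theorem sum_sq_nonneg {ι' : Type} (s : Finset ι') (c : ι' → ℝ) : 0 ≤ ∑ i ∈ s, c i ^ 2 :=
  Finset.sum_nonneg fun _ _ => by positivity

theorem sum_sq_le_nsq (w : ι → W) (o : κ → ι) (c : (κ → ι) → ℝ) : ∑ i, c i ^ 2 ≤ nsq w o c :=
  le_add_of_nonneg_right (Finset.sum_nonneg fun k _ => nsq_slice_nonneg w o c k)

theorem nsq_nonneg (w : ι → W) (o : κ → ι) (c : (κ → ι) → ℝ) : 0 ≤ nsq w o c :=
  (sum_sq_nonneg _ c).trans (sum_sq_le_nsq w o c)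

/-- The sum of squares and the slices in slots other than `s` are only scaled by numbers of modulus
at most one. In slot `s` the weight is split as `r + (u - r)`: the constant part contracts the
slice, and Cauchy–Schwarz bounds the remainder by `D` times the sum of squares. The factor 2 comes
from `(a + b)² ≤ 2a² + 2b²`. -/
theorem nsq_mul_slot_le (w : ι → W) (o : κ → ι) (c : (κ → ι) → ℝ) (s : κ) {u : ι → ℝ} {r D : ℝ}
    (hu : ∀ p, |u p| ≤ 1) (hr : |r| ≤ 1) (hD : ∑ p, (u p - r) ^ 2 * ‖w p‖ ^ 2 ≤ D) :
    nsq w o (fun i => u (i s) * c i) ≤ (2 + 2 * D) * nsq w o c := by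
  have hD0 : 0 ≤ D := (Finset.sum_nonneg fun p _ => by positivity).trans hD
  have husq : ∀ p, u p ^ 2 ≤ 1 := fun p => (sq_le_one_iff_abs_le_one _).2 (hu p)
  have hrsq : r ^ 2 ≤ 1 := (sq_le_one_iff_abs_le_one _).2 hr
  have h1 : ∑ i, (u (i s) * c i) ^ 2 ≤ ∑ i, c i ^ 2 := by
    refine Finset.sum_le_sum fun i _ => ?_
    rw [mul_pow]
    exact mul_le_of_le_one_left (sq_nonneg _) (husq _)
  have h2 : ∀ k, k ≠ s → ∑ i with i k = o k, ‖slice w k (fun i => u (i s) * c i) i‖ ^ 2 ≤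
      2 * ∑ i with i k = o k, ‖slice w k c i‖ ^ 2 := by
    intro k hk
    refine le_trans ?_ (le_mul_of_one_le_left (nsq_slice_nonneg w o c k) one_le_two)
    refine Finset.sum_le_sum fun i _ => ?_
    have : slice w k (fun i => u (i s) * c i) i = u (i s) • slice w k c i := by
      simp only [slice, Finset.smul_sum, smul_smul, Function.update_of_ne hk.symm]
    rw [this, norm_smul, mul_pow, Real.norm_eq_abs, sq_abs]
    exact mul_le_of_le_one_left (sq_nonneg _) (husq _)
  have h3 : ∑ i with i s = o s, ‖slice w s (fun i => u (i s) * c i) i‖ ^ 2 ≤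
      2 * ∑ i with i s = o s, ‖slice w s c i‖ ^ 2 + 2 * D * ∑ i, c i ^ 2 := by
    rw [sum_eq_sum_update o s (fun i => c i ^ 2), Finset.mul_sum, Finset.mul_sum,
      ← Finset.sum_add_distrib]
    refine Finset.sum_le_sum fun i _ => ?_
    have e : slice w s (fun i => u (i s) * c i) i = r • slice w s c i +
        ∑ p, c (Function.update i s p) • ((u p - r) • w p) := by
      simp only [slice, Finset.smul_sum, smul_smul, ← Finset.sum_add_distrib, ← add_smul,
        Function.update_self]
      refine Finset.sum_congr rfl fun p _ => ?_
      congr 1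
      ring
    have e1 : ‖r • slice w s c i‖ ^ 2 ≤ ‖slice w s c i‖ ^ 2 := by
      rw [norm_smul, mul_pow, Real.norm_eq_abs, sq_abs]
      exact mul_le_of_le_one_left (sq_nonneg _) hrsq
    have e2 : ‖∑ p, c (Function.update i s p) • ((u p - r) • w p)‖ ^ 2 ≤
        D * ∑ p, c (Function.update i s p) ^ 2 := by
      refine (norm_sum_smul_sq_le _ _ _).trans ?_
      rw [mul_comm]
      refine mul_le_mul_of_nonneg_right ?_ (sum_sq_nonneg _ _)
      refine le_trans (le_of_eq (Finset.sum_congr rfl fun p _ => ?_)) hD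
      rw [norm_smul, mul_pow, Real.norm_eq_abs, sq_abs]
    rw [e]
    have e3 := norm_add_le (r • slice w s c i)
      (∑ p, c (Function.update i s p) • ((u p - r) • w p))
    have e4 := pow_le_pow_left₀ (norm_nonneg _) e3 2
    have e5 := sq_nonneg (‖r • slice w s c i‖ -
      ‖∑ p, c (Function.update i s p) • ((u p - r) • w p)‖)
    nlinarith
  have h4 : ∑ k, ∑ i with i k = o k, ‖slice w k (fun i => u (i s) * c i) i‖ ^ 2 ≤
      2 * ∑ k, ∑ i with i k = o k, ‖slice w k c i‖ ^ 2 + 2 * D * ∑ i, c i ^ 2 := by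
    rw [← Finset.add_sum_erase _ _ (Finset.mem_univ s),
      ← Finset.add_sum_erase (a := s) _ (fun k => ∑ i with i k = o k, ‖slice w k c i‖ ^ 2)
        (Finset.mem_univ s), mul_add]
    have := Finset.sum_le_sum fun k (hk : k ∈ Finset.univ.erase s) =>
      h2 k (Finset.ne_of_mem_erase hk)
    rw [← Finset.mul_sum] at this
    linarith
  have h5 := sum_sq_nonneg Finset.univ c
  have h6 := Finset.sum_nonneg fun k (_ : k ∈ Finset.univ) => nsq_slice_nonneg w o c k
  have h7 := mul_nonneg hD0 h6
  simp only [nsq]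
  nlinarith

theorem nsq_mul_slots_le (w : ι → W) (o : κ → ι) (c : (κ → ι) → ℝ) (S : Finset κ)
    {u : κ → ι → ℝ} {r : κ → ℝ} {D : ℝ} (hu : ∀ s p, |u s p| ≤ 1) (hr : ∀ s, |r s| ≤ 1)
    (hD : ∀ s, ∑ p, (u s p - r s) ^ 2 * ‖w p‖ ^ 2 ≤ D) :
    nsq w o (fun i => (∏ s ∈ S, u s (i s)) * c i) ≤ (2 + 2 * D) ^ S.card * nsq w o c := by
  induction S using Finset.induction_on with
  | empty => simp
  | insert s S hs ih =>
    have hD0 : 0 ≤ D := (Finset.sum_nonneg fun p _ => by positivity).trans (hD s)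
    simp only [Finset.prod_insert hs, mul_assoc, Finset.card_insert_of_notMem hs]
    refine (nsq_mul_slot_le w o _ s (hu s) (hr s) (hD s)).trans ?_
    rw [pow_succ', mul_assoc]
    exact mul_le_mul_of_nonneg_left ih (by positivity)

theorem sum_merge_mul_le (o : κ → ι) (S : Finset κ) {F G : (κ → ι) → ℝ} (hF : ∀ i, 0 ≤ F i)
    (hG : ∀ i, 0 ≤ G i) :
    ∑ i, F (S.piecewise i o) * G (S.piecewise o i) ≤ (∑ i, F i) * ∑ i, G i := by
  rw [sum_eq_sum_merge o S (fun l j _ => F l * G j), Finset.sum_mul_sum, Finset.sum_comm]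
  refine (Finset.sum_le_univ_sum_of_nonneg fun l =>
    Finset.sum_nonneg fun j _ => mul_nonneg (hF l) (hG j)).trans ?_
  exact Finset.sum_le_sum fun l _ =>
    Finset.sum_le_univ_sum_of_nonneg fun j => mul_nonneg (hF l) (hG j)

/-- Replacing the slots in `S` of the tensor `g` by those of the tensor `f`. -/
theorem nsq_merge_le (w : ι → W) (o : κ → ι) (f g : (κ → ι) → ℝ) (S : Finset κ) :
    nsq w o (fun i => f (S.piecewise i o) * g (S.piecewise o i)) ≤
      2 * nsq w o f * nsq w o g := by
  have hf0 := sum_sq_nonneg Finset.univ f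
  have hg0 := sum_sq_nonneg Finset.univ g
  have h1 : ∑ i, (f (S.piecewise i o) * g (S.piecewise o i)) ^ 2 ≤
      (∑ i, f i ^ 2) * ∑ i, g i ^ 2 := by
    simp only [mul_pow]
    exact sum_merge_mul_le o S (F := fun i => f i ^ 2) (G := fun i => g i ^ 2)
      (fun i => sq_nonneg _) (fun i => sq_nonneg _)
  -- Each slot belongs to exactly one of the factors: the slice in slot `k` falls on `f` if `k ∈ S`
  -- and on `g` otherwise, and the other factor enters through its sum of squares only.
  have h2 : ∀ k, ∑ i with i k = o k,
      ‖slice w k (fun i => f (S.piecewise i o) * g (S.piecewise o i)) i‖ ^ 2 ≤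
      (∑ i with i k = o k, ‖slice w k f i‖ ^ 2) * ∑ i, g i ^ 2 +
      (∑ i, f i ^ 2) * ∑ i with i k = o k, ‖slice w k g i‖ ^ 2 := by
    intro k
    have hfk := mul_nonneg (nsq_slice_nonneg w o f k) hg0
    have hgk := mul_nonneg hf0 (nsq_slice_nonneg w o g k)
    by_cases hk : k ∈ S
    · refine le_trans ?_ (le_add_of_nonneg_right hgk)
      have e : ∀ i, slice w k (fun i => f (S.piecewise i o) * g (S.piecewise o i)) i =
          g (S.piecewise o i) • slice w k f (S.piecewise i o) := by
        intro i
        simp only [slice, Finset.smul_sum, smul_smul]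
        refine Finset.sum_congr rfl fun p _ => ?_
        have e1 : S.piecewise (Function.update i k p) o =
            Function.update (S.piecewise i o) k p := by
          funext a
          rcases eq_or_ne a k with rfl | ha
          · simp [hk]
          · by_cases haS : a ∈ S <;> simp [haS, ha]
        have e2 : S.piecewise o (Function.update i k p) = S.piecewise o i := by
          funext a
          by_cases haS : a ∈ S
          · simp [haS]
          · have : a ≠ k := fun h => haS (h ▸ hk)
            simp [haS, this]
        rw [e1, e2, mul_comm]
      rw [Finset.sum_filter, Finset.sum_filter]
      refine le_trans (le_of_eq (Finset.sum_congr rfl fun i _ => ?_)) (sum_merge_mul_le o S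
        (F := fun i => if i k = o k then ‖slice w k f i‖ ^ 2 else 0) (G := fun i => g i ^ 2)
        (fun i => by split_ifs <;> positivity) (fun i => sq_nonneg _))
      simp only [Finset.piecewise_eq_of_mem _ _ _ hk]
      split_ifs
      · rw [e, norm_smul, mul_pow, Real.norm_eq_abs, sq_abs, mul_comm]
      · simp
    · refine le_trans ?_ (le_add_of_nonneg_left hfk)
      have e : ∀ i, slice w k (fun i => f (S.piecewise i o) * g (S.piecewise o i)) i =
          f (S.piecewise i o) • slice w k g (S.piecewise o i) := by
        intro i
        simp only [slice, Finset.smul_sum, smul_smul]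
        refine Finset.sum_congr rfl fun p _ => ?_
        have e1 : S.piecewise o (Function.update i k p) =
            Function.update (S.piecewise o i) k p := by
          funext a
          rcases eq_or_ne a k with rfl | ha
          · simp [hk]
          · by_cases haS : a ∈ S <;> simp [haS, ha]
        have e2 : S.piecewise (Function.update i k p) o = S.piecewise i o := by
          funext a
          by_cases haS : a ∈ S
          · have : a ≠ k := fun h => hk (h ▸ haS)
            simp [haS, this]
          · simp [haS]
        rw [e1, e2]
      rw [Finset.sum_filter, Finset.sum_filter]
      refine le_trans (le_of_eq (Finset.sum_congr rfl fun i _ => ?_)) (sum_merge_mul_le o S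
        (F := fun i => f i ^ 2) (G := fun i => if i k = o k then ‖slice w k g i‖ ^ 2 else 0)
        (fun i => sq_nonneg _) (fun i => by split_ifs <;> positivity))
      simp only [Finset.piecewise_eq_of_notMem _ _ _ hk]
      split_ifs
      · rw [e, norm_smul, mul_pow, Real.norm_eq_abs, sq_abs]
      · simp
  have h3 := Finset.sum_le_sum fun k (_ : k ∈ Finset.univ) => h2 k
  rw [Finset.sum_add_distrib, ← Finset.sum_mul, ← Finset.mul_sum] at h3
  have h4 := Finset.sum_nonneg fun k (_ : k ∈ Finset.univ) => nsq_slice_nonneg w o f k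
  have h5 := Finset.sum_nonneg fun k (_ : k ∈ Finset.univ) => nsq_slice_nonneg w o g k
  simp only [nsq]
  nlinarith [mul_nonneg hf0 hg0, mul_nonneg hf0 h5, mul_nonneg h4 hg0, mul_nonneg h4 h5]

/-- The adjoint of `c ↦ (i ↦ f (S.piecewise i o) * c (S.piecewise o i))`: contraction of the slots
in `S` with `f`. -/
def contr (o : κ → ι) (S : Finset κ) (f g : (κ → ι) → ℝ) (j : κ → ι) : ℝ :=
  if ∀ a ∈ S, j a = o a then
    ∑ l with ∀ a, a ∉ S → l a = o a, f l * g (S.piecewise l j)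
  else 0

theorem sum_merge_mul_eq_contr (o : κ → ι) (S : Finset κ) (f c g : (κ → ι) → ℝ) :
    ∑ i, f (S.piecewise i o) * c (S.piecewise o i) * g i = ∑ j, c j * contr o S f g j := by
  rw [sum_eq_sum_merge o S (fun l j i => f l * c j * g i), Finset.sum_filter]
  refine Finset.sum_congr rfl fun j _ => ?_
  rw [contr]
  split_ifs
  · rw [Finset.mul_sum]
    exact Finset.sum_congr rfl fun l _ => by ring
  · simp

theorem sum_contr_sq_le (o : κ → ι) (S : Finset κ) (f g : (κ → ι) → ℝ) :
    ∑ j, contr o S f g j ^ 2 ≤ (∑ i, f i ^ 2) * ∑ i, g i ^ 2 := by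
  rw [sum_eq_sum_merge o S (fun _ _ i => g i ^ 2), Finset.mul_sum, Finset.sum_filter]
  refine Finset.sum_le_sum fun j _ => ?_
  rw [contr]
  split_ifs
  · refine (Finset.sum_mul_sq_le_sq_mul_sq _ f _).trans
      (mul_le_mul_of_nonneg_right ?_ (sum_sq_nonneg _ _))
    exact Finset.sum_le_univ_sum_of_nonneg fun l => sq_nonneg _
  · simp

/-- For `k ∉ S` slicing commutes with the contraction, and Cauchy–Schwarz in the contracted slots
applies. For `k ∈ S` the contraction is supported on tuples with entry `o k`, so the slice has one
term and costs `‖w (o k)‖²`; this is the origin of the constant. -/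
theorem nsq_contr_le (w : ι → W) (o : κ → ι) (f g : (κ → ι) → ℝ) (S : Finset κ) :
    nsq w o (contr o S f g) ≤ (1 + ∑ k, ‖w (o k)‖ ^ 2) * nsq w o f * nsq w o g := by
  have hf0 := sum_sq_nonneg Finset.univ f
  have hg0 := sum_sq_nonneg Finset.univ g
  have h1 := sum_contr_sq_le o S f g
  have h2 : ∀ k, ∑ i with i k = o k, ‖slice w k (contr o S f g) i‖ ^ 2 ≤
      (∑ i, f i ^ 2) * ∑ i with i k = o k, ‖slice w k g i‖ ^ 2 +
      ‖w (o k)‖ ^ 2 * ((∑ i, f i ^ 2) * ∑ i, g i ^ 2) := by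
    intro k
    have hgk := mul_nonneg hf0 (nsq_slice_nonneg w o g k)
    by_cases hk : k ∈ S
    · refine le_trans ?_ (le_add_of_nonneg_left hgk)
      have e : ∀ i ∈ Finset.univ.filter (fun i : κ → ι => i k = o k),
          ‖slice w k (contr o S f g) i‖ ^ 2 = ‖w (o k)‖ ^ 2 * contr o S f g i ^ 2 := by
        intro i hi
        have hi := (Finset.mem_filter.1 hi).2
        rw [slice, Finset.sum_eq_single (o k)]
        · rw [norm_smul, mul_pow, Real.norm_eq_abs, sq_abs, mul_comm, ← hi,
            Function.update_eq_self]
        · intro p _ hp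
          rw [contr, if_neg, zero_smul]
          intro h
          exact hp (by simpa using h k hk)
        · simp
      rw [Finset.sum_congr rfl e, ← Finset.mul_sum]
      refine mul_le_mul_of_nonneg_left (le_trans ?_ h1) (sq_nonneg _)
      exact Finset.sum_le_univ_sum_of_nonneg fun l => sq_nonneg _
    · refine le_trans ?_ (le_add_of_nonneg_right (by positivity))
      rw [Finset.sum_filter, Finset.sum_filter, sum_eq_sum_merge o S
        (fun _ j i => if i k = o k then ‖slice w k g i‖ ^ 2 else 0), Finset.mul_sum,
        Finset.sum_filter]
      refine Finset.sum_le_sum fun j _ => ?_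
      simp only [Finset.piecewise_eq_of_notMem _ _ _ hk]
      have hupd : ∀ p, (∀ a ∈ S, Function.update j k p a = o a) ↔ ∀ a ∈ S, j a = o a := by
        intro p
        refine forall₂_congr fun a ha => ?_
        have : a ≠ k := fun h => hk (h ▸ ha)
        simp [this]
      by_cases hj : ∀ a ∈ S, j a = o a
      · rw [if_pos hj]
        split_ifs
        · have e : slice w k (contr o S f g) j = ∑ l with ∀ a, a ∉ S → l a = o a,
              f l • slice w k g (S.piecewise l j) := by
            simp only [slice, contr, hupd, if_pos hj, Finset.sum_smul, Finset.smul_sum]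
            rw [Finset.sum_comm]
            refine Finset.sum_congr rfl fun l _ => Finset.sum_congr rfl fun p _ => ?_
            have e1 : S.piecewise l (Function.update j k p) =
                Function.update (S.piecewise l j) k p := by
              funext a
              rcases eq_or_ne a k with rfl | ha
              · simp [hk]
              · by_cases haS : a ∈ S <;> simp [haS, ha]
            rw [e1, smul_smul]
          rw [e]
          refine (norm_sum_smul_sq_le _ _ _).trans
            (mul_le_mul_of_nonneg_right ?_ (Finset.sum_nonneg fun _ _ => sq_nonneg _))
          exact Finset.sum_le_univ_sum_of_nonneg fun l => sq_nonneg _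
        · simp
      · rw [if_neg hj]
        have : slice w k (contr o S f g) j = 0 := by
          refine Finset.sum_eq_zero fun p _ => ?_
          rw [contr, if_neg (fun h => hj ((hupd p).1 h)), zero_smul]
        simp [this]
  have h3 := Finset.sum_le_sum fun k (_ : k ∈ Finset.univ) => h2 k
  rw [Finset.sum_add_distrib, ← Finset.sum_mul, ← Finset.mul_sum] at h3
  have h4 := Finset.sum_nonneg fun k (_ : k ∈ Finset.univ) => nsq_slice_nonneg w o f k
  have h5 := Finset.sum_nonneg fun k (_ : k ∈ Finset.univ) => nsq_slice_nonneg w o g k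
  have h6 : 0 ≤ ∑ k, ‖w (o k)‖ ^ 2 := Finset.sum_nonneg fun _ _ => sq_nonneg _
  have h7 : nsq w o (contr o S f g) ≤ (1 + ∑ k, ‖w (o k)‖ ^ 2) *
      ((∑ i, f i ^ 2) * nsq w o g) := by
    simp only [nsq] at *
    nlinarith [mul_nonneg h6 (mul_nonneg hf0 h5)]
  rw [mul_assoc]
  refine h7.trans (mul_le_mul_of_nonneg_left ?_ (by positivity))
  exact mul_le_mul_of_nonneg_right (sum_sq_le_nsq w o f) (nsq_nonneg w o g)

end Tensors

/-! ### Antisymmetrization -/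

section Signs

variable {A : Type} [LinearOrder A]

/-- The sign of the pair `(x, y)`, which is `1` for `x < y`. -/
def ord (x y : A) : ℝ := if x < y then 1 else if y < x then -1 else 0

theorem ord_swap (x y : A) : ord y x = -ord x y := by
  rcases lt_trichotomy x y with h | rfl | h
  · simp [ord, h, h.le.not_gt]
  · simp [ord]
  · simp [ord, h, h.le.not_gt]

theorem ord_mul_self {x y : A} (h : x ≠ y) : ord x y * ord x y = 1 := by
  rcases lt_or_gt_of_ne h with h | h
  · simp [ord, h]
  · simp [ord, h, h.le.not_gt]

theorem abs_ord_le (x y : A) : |ord x y| ≤ 1 := by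
  unfold ord
  split_ifs <;> simp

/-- The sign of the permutation sorting a tuple. -/
def tsgn (i : Fin N → A) : ℝ := ∏ a, ∏ b ∈ Finset.Ioi a, ord (i a) (i b)

theorem tsgn_strictMono_comp {e : Fin N → A} (he : StrictMono e) (σ : Equiv.Perm (Fin N)) :
    tsgn (e ∘ σ) = (Equiv.Perm.sign σ : ℝ) := by
  rw [Equiv.Perm.sign_eq_prod_prod_Ioi]
  push_cast
  refine Finset.prod_congr rfl fun a _ => Finset.prod_congr rfl fun b hb => ?_
  have hab : σ a ≠ σ b := σ.injective.ne (Finset.mem_Ioi.1 hb).ne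
  rcases lt_or_gt_of_ne hab with h | h
  · simp [ord, h, he.lt_iff_lt]
  · simp [ord, h, h.le.not_gt, he.lt_iff_lt]

theorem tsgn_strictMono {e : Fin N → A} (he : StrictMono e) : tsgn e = 1 := by
  simpa using tsgn_strictMono_comp he 1

/-- Only the pairs split by `S` survive. Each occurs once with `a < b`, and symmetry allows its
member in `S` to be written first. -/
theorem prod_Ioi_eq_prod_compl (S : Finset (Fin N)) {Q : Fin N → Fin N → ℝ}
    (hs : ∀ a b, Q a b = Q b a) (h1 : ∀ a b, a ≠ b → (a ∈ S ↔ b ∈ S) → Q a b = 1) :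
    ∏ a, ∏ b ∈ Finset.Ioi a, Q a b = ∏ a ∈ S, ∏ b ∈ Sᶜ, Q a b := by
  have e1 : ∏ a, ∏ b ∈ Finset.Ioi a, Q a b =
      (∏ a, ∏ b, if a < b ∧ a ∈ S ∧ b ∉ S then Q a b else 1) *
        ∏ a, ∏ b, if a < b ∧ b ∈ S ∧ a ∉ S then Q a b else 1 := by
    rw [← Finset.prod_mul_distrib]
    refine Finset.prod_congr rfl fun a _ => ?_
    rw [← Finset.prod_mul_distrib, ← Finset.filter_lt_eq_Ioi, Finset.prod_filter]
    refine Finset.prod_congr rfl fun b _ => ?_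
    by_cases hab : a < b
    · by_cases ha : a ∈ S <;> by_cases hb : b ∈ S <;> simp [hab, ha, hb]
      · exact h1 a b hab.ne (by simp [ha, hb])
      · exact h1 a b hab.ne (by simp [ha, hb])
    · simp [hab]
  rw [e1, Finset.prod_comm (f := fun a b => if a < b ∧ b ∈ S ∧ a ∉ S then Q a b else 1),
    ← Finset.prod_mul_distrib, ← Finset.prod_subset (Finset.subset_univ S)]
  · refine Finset.prod_congr rfl fun a ha => ?_
    rw [← Finset.prod_mul_distrib, ← Finset.prod_subset (Finset.subset_univ Sᶜ)]
    · refine Finset.prod_congr rfl fun b hb => ?_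
      have hb' : b ∉ S := Finset.mem_compl.1 hb
      have hab : a ≠ b := fun h => hb' (h ▸ ha)
      rcases lt_or_gt_of_ne hab with h | h
      · simp [h, ha, hb', h.le.not_gt]
      · simp [h, ha, hb', h.le.not_gt, hs]
    · intro b _ hb
      have hb' : b ∈ S := by simpa using hb
      simp [hb', ha]
  · intro a _ ha
    simp [ha]

/-- Pairs within `S` or within its complement contribute each sign twice and cancel. Among the signs
of split pairs only `ord (i a) (i b)` couples two free orbitals, so this coupling is expressed by
sorting signs of tuples and by weights of single slots. -/
theorem tsgn_merge (S : Finset (Fin N)) {i o : Fin N → A} (hi : Function.Injective i)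
    (ho : Function.Injective o) :
    tsgn (S.piecewise i o) * tsgn (S.piecewise o i) * tsgn i * tsgn o =
      ∏ a ∈ S, ∏ b ∈ Sᶜ,
        (ord (i a) (o b) * ord (o a) (i b) * ord (i a) (i b) * ord (o a) (o b)) := by
  simp only [tsgn, ← Finset.prod_mul_distrib]
  rw [prod_Ioi_eq_prod_compl S]
  · refine Finset.prod_congr rfl fun a ha => Finset.prod_congr rfl fun b hb => ?_
    have hb' : b ∉ S := Finset.mem_compl.1 hb
    simp [ha, hb']
  · intro a b
    rw [ord_swap (S.piecewise i o a), ord_swap (S.piecewise o i a), ord_swap (i a),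
      ord_swap (o a)]
    ring
  · intro a b hab h
    have h1 := ord_mul_self (hi.ne hab)
    have h2 := ord_mul_self (ho.ne hab)
    by_cases ha : a ∈ S
    · simp only [ha, h.1 ha, Finset.piecewise_eq_of_mem]
      linear_combination (ord (o a) (o b) * ord (o a) (o b)) * h1 + h2
    · have hb : b ∉ S := fun hb => ha (h.2 hb)
      simp only [ha, hb, not_false_eq_true, Finset.piecewise_eq_of_notMem]
      linear_combination (ord (o a) (o b) * ord (o a) (o b)) * h1 + h2

theorem exists_perm_of_image_eq {i j : Fin N → A} (hi : Function.Injective i)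
    (h : Finset.univ.image i = Finset.univ.image j) : ∃ σ : Equiv.Perm (Fin N), i = j ∘ σ := by
  have : ∀ a, ∃ b, j b = i a := fun a => by
    have : i a ∈ Finset.univ.image j := h ▸ Finset.mem_image_of_mem i (Finset.mem_univ a)
    simpa using this
  choose f hf using this
  have hinj : Function.Injective f := fun a b hab => hi (by rw [← hf a, ← hf b, hab])
  exact ⟨Equiv.ofBijective f (Finite.injective_iff_bijective.1 hinj),
    funext fun a => (hf a).symm⟩

end Signs

theorem sign_mul_self (σ : Equiv.Perm (Fin N)) :
    (Equiv.Perm.sign σ : ℝ) * (Equiv.Perm.sign σ : ℝ) = 1 := by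
  rcases Int.units_eq_one_or (Equiv.Perm.sign σ) with h | h <;> simp [h]

/-- The state of the entries of an injective tuple. -/
def tupleState (i : Fin N → Orb K) (h : Function.Injective i) : State N K :=
  ⟨Finset.univ.image i, by rw [Finset.card_image_of_injective _ h, Finset.card_univ,
    Fintype.card_fin]⟩

open Classical in
/-- The antisymmetrization of a tensor product of orbitals. -/
def altTens (B : OrbitalSet K) (i : Fin N → Orb K) : H1K B N :=
  if h : Function.Injective i then
    ((Real.sqrt (N.factorial : ℝ))⁻¹ * tsgn i) • det B (tupleState i h)
  else 0

theorem sqrt_fact_inv_mul_self (N : ℕ) :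
    (Real.sqrt (N.factorial : ℝ))⁻¹ * (Real.sqrt (N.factorial : ℝ))⁻¹ =
      (N.factorial : ℝ)⁻¹ := by
  rw [← mul_inv, Real.mul_self_sqrt (by positivity)]

/-- For an injective tuple, reindexing by the sorting permutation gives the determinant. If two
entries coincide, exchanging them shows that the signed sum is its own negative. -/
theorem toJet_altTens (B : OrbitalSet K) (i : Fin N → Orb K) :
    toJet B N (altTens B i) = (N.factorial : ℝ)⁻¹ • ∑ π : Equiv.Perm (Fin N),
      (Equiv.Perm.sign π : ℝ) • tensJet B (i ∘ π) := by
  by_cases h : Function.Injective i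
  · obtain ⟨ρ, hρ⟩ := exists_perm_of_image_eq (j := (tupleState i h).enum) h
      (State.image_enum (tupleState i h)).symm
    have ht : tsgn i = (Equiv.Perm.sign ρ : ℝ) := by
      conv_lhs => rw [hρ]
      exact tsgn_strictMono_comp (State.enum_strictMono _) ρ
    rw [altTens, dif_pos h, map_smul, toJet_det, ← Equiv.sum_comp (Equiv.mulLeft ρ),
      Finset.smul_sum, Finset.smul_sum]
    refine Finset.sum_congr rfl fun π _ => ?_
    have e : (fun j => (tupleState i h).1.orderEmbOfFin (tupleState i h).2
        ((Equiv.mulLeft ρ) π j)) = i ∘ π := by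
      conv_rhs => rw [hρ]
      rfl
    rw [e, smul_smul, smul_smul, ht, ← sqrt_fact_inv_mul_self]
    congr 1
    simp only [Equiv.coe_mulLeft, Equiv.Perm.sign_mul]
    push_cast
    linear_combination ((Real.sqrt (N.factorial : ℝ))⁻¹ * (Real.sqrt (N.factorial : ℝ))⁻¹ *
      (Equiv.Perm.sign π : ℝ)) * sign_mul_self ρ
  · rw [altTens, dif_neg h, map_zero]
    rw [Function.Injective] at h
    push Not at h
    obtain ⟨a, b, hab, hne⟩ := h
    have hsw : i ∘ Equiv.swap a b = i := by
      funext c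
      rcases eq_or_ne c a with rfl | hca
      · simp [hab]
      rcases eq_or_ne c b with rfl | hcb
      · simp [hab]
      · simp [Equiv.swap_apply_of_ne_of_ne hca hcb]
    have h0 : ∑ π : Equiv.Perm (Fin N), (Equiv.Perm.sign π : ℝ) • tensJet B (i ∘ π) =
        -∑ π : Equiv.Perm (Fin N), (Equiv.Perm.sign π : ℝ) • tensJet B (i ∘ π) := by
      conv_lhs => rw [← Equiv.sum_comp (Equiv.mulLeft (Equiv.swap a b))]
      rw [← Finset.sum_neg_distrib]
      refine Finset.sum_congr rfl fun π _ => ?_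
      have e : i ∘ ((Equiv.mulLeft (Equiv.swap a b)) π) = i ∘ π := by
        conv_rhs => rw [← hsw]
        rfl
      rw [e, Equiv.coe_mulLeft, Equiv.Perm.sign_mul, Equiv.Perm.sign_swap hne]
      simp
    have h1 : (2 : ℝ) • ∑ π : Equiv.Perm (Fin N), (Equiv.Perm.sign π : ℝ) • tensJet B (i ∘ π) =
        0 := by
      rw [two_smul]
      exact add_eq_zero_iff_eq_neg.2 h0
    rw [(smul_eq_zero.1 h1).resolve_left two_ne_zero, smul_zero]

theorem inner_tensJet_comp (B : OrbitalSet K) (i j : Fin N → Orb K) (π : Equiv.Perm (Fin N)) :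
    inner ℝ (tensJet B (i ∘ π)) (tensJet B (j ∘ π)) = inner ℝ (tensJet B i) (tensJet B j) := by
  rw [inner_tensJet, inner_tensJet]
  conv_rhs => rw [← Equiv.sum_comp π]
  have h1 : i ∘ π = j ∘ π ↔ i = j := π.surjective.injective_comp_right.eq_iff
  rw [if_congr h1 rfl rfl]
  congr 1
  refine Finset.sum_congr rfl fun k _ => if_congr ?_ rfl rfl
  constructor
  · intro h l hl
    have := h (π.symm l) (fun h' => hl (by rw [← h', Equiv.apply_symm_apply]))
    simpa using this
  · intro h l hl
    exact h _ (π.injective.ne hl)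

/-! ### Sobolev norms of determinant combinations as tensor norms -/

section Expansion

variable {ι : Type} [Fintype ι] {ν : ι → Orb K}

theorem norm_sum_tensJet_sq [DecidableEq ι] (B : OrbitalSet K) (hν : Function.Injective ν) (o : Fin N → ι)
    (c : (Fin N → ι) → ℝ) :
    ‖∑ i, c i • tensJet B (ν ∘ i)‖ ^ 2 = nsq (fun p => B.grad (ν p)) o c := by
  rw [← real_inner_self_eq_norm_sq, ← nsq_eq_gram, sum_inner]
  refine Finset.sum_congr rfl fun i _ => ?_
  rw [inner_sum]
  refine Finset.sum_congr rfl fun j _ => ?_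
  rw [inner_smul_left, inner_smul_right, inner_tensJet, ← mul_assoc]
  simp only [conj_trivial, Function.comp_apply, hν.eq_iff, hν.comp_left.eq_iff]
  congr!

/-- The antisymmetrizer is an average of `N!` signed slot permutations, each of which preserves the
Gram matrix of the tensor jets. -/
theorem norm_sum_altTens_le (B : OrbitalSet K) (c : (Fin N → ι) → ℝ) :
    ‖∑ i, c i • altTens B (ν ∘ i)‖ ≤ ‖∑ i, c i • tensJet B (ν ∘ i)‖ := by
  have hperm : ∀ π : Equiv.Perm (Fin N), ‖∑ i, c i • tensJet B ((ν ∘ i) ∘ π)‖ =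
      ‖∑ i, c i • tensJet B (ν ∘ i)‖ := by
    intro π
    rw [← sq_eq_sq₀ (norm_nonneg _) (norm_nonneg _), ← real_inner_self_eq_norm_sq,
      ← real_inner_self_eq_norm_sq]
    simp only [sum_inner, inner_sum, inner_smul_left, inner_smul_right, inner_tensJet_comp]
  have e : toJet B N (∑ i, c i • altTens B (ν ∘ i)) = (N.factorial : ℝ)⁻¹ •
      ∑ π : Equiv.Perm (Fin N), (Equiv.Perm.sign π : ℝ) •
        ∑ i, c i • tensJet B ((ν ∘ i) ∘ π) := by
    simp only [map_sum, map_smul, toJet_altTens, Finset.smul_sum]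
    rw [Finset.sum_comm]
    refine Finset.sum_congr rfl fun π _ => Finset.sum_congr rfl fun i _ => ?_
    simp only [smul_smul]
    congr 1
    ring
  have h0 : (0 : ℝ) < N.factorial := by exact_mod_cast N.factorial_pos
  rw [← norm_toJet, e, norm_smul, norm_inv, Real.norm_natCast, inv_mul_le_iff₀ h0]
  refine (norm_sum_le _ _).trans ?_
  have h1 : ∀ π : Equiv.Perm (Fin N), ‖(Equiv.Perm.sign π : ℝ) •
      ∑ i, c i • tensJet B ((ν ∘ i) ∘ π)‖ = ‖∑ i, c i • tensJet B (ν ∘ i)‖ := by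
    intro π
    rw [norm_smul, hperm]
    rcases Int.units_eq_one_or (Equiv.Perm.sign π) with h | h <;> simp [h]
  simp [h1, Fintype.card_perm]

theorem norm_sum_altTens_sq_le [DecidableEq ι] (B : OrbitalSet K) (hν : Function.Injective ν) (o : Fin N → ι)
    (c : (Fin N → ι) → ℝ) :
    ‖∑ i, c i • altTens B (ν ∘ i)‖ ^ 2 ≤ nsq (fun p => B.grad (ν p)) o c := by
  rw [← norm_sum_tensJet_sq B hν]
  exact pow_le_pow_left₀ (norm_nonneg _) (norm_sum_altTens_le B c) 2

/-- The linear span of the determinants built from the orbitals `ν`. -/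
def finSpan (B : OrbitalSet K) (N : ℕ) (ν : ι → Orb K) : Submodule ℝ (H1K B N) :=
  Submodule.span ℝ (det B '' {α : State N K | ∀ x ∈ α.1, x ∈ Set.range ν})

theorem toJet_eq_sum (B : OrbitalSet K) (hν : Function.Injective ν) {Ψ : H1K B N}
    (hΨ : Ψ ∈ finSpan B N ν) :
    toJet B N Ψ = ∑ i, coef B (ν ∘ i) Ψ • tensJet B (ν ∘ i) := by
  induction hΨ using Submodule.span_induction with
  | mem Φ hΦ =>
    obtain ⟨α, hα, rfl⟩ := hΦ
    have hex : ∀ j, ∃ p, ν p = α.enum j := fun j => by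
      have := hα (α.enum j) (by
        rw [← α.image_enum]; exact Finset.mem_image_of_mem _ (Finset.mem_univ j))
      simpa using this
    choose e he using hex
    rw [toJet_det]
    simp only [coef_det, Finset.sum_smul]
    rw [Finset.sum_comm]
    refine Finset.sum_congr rfl fun σ _ => ?_
    rw [Finset.sum_eq_single (e ∘ σ)]
    · have h1 : ν ∘ e ∘ σ = fun j => α.1.orderEmbOfFin α.2 (σ j) := funext fun j => he (σ j)
      rw [h1, if_pos rfl, mul_one]
    · intro i _ hi
      rw [if_neg, mul_zero, zero_smul]
      intro h
      apply hi
      funext j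
      apply hν
      rw [Function.comp_apply, he]
      exact congrFun h j
    · simp
  | zero => simp
  | add Φ Θ _ _ h1 h2 => simp only [map_add, add_smul, Finset.sum_add_distrib, h1, h2]
  | smul c Φ _ h1 => simp only [map_smul, smul_eq_mul, mul_smul, ← Finset.smul_sum, h1]

/-- This is the dictionary between wavefunctions and tensors: on `finSpan` the Sobolev norm is
exactly the tensor norm of the coefficients, whatever finite set of orbitals is used. -/
theorem nsq_coef [DecidableEq ι] (B : OrbitalSet K) (hν : Function.Injective ν) (o : Fin N → ι) {Ψ : H1K B N}
    (hΨ : Ψ ∈ finSpan B N ν) :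
    nsq (fun p => B.grad (ν p)) o (fun i => coef B (ν ∘ i) Ψ) = ‖Ψ‖ ^ 2 := by
  rw [← norm_sum_tensJet_sq B hν, ← toJet_eq_sum B hν hΨ, norm_toJet]

end Expansion

theorem clm_ext_det {B : OrbitalSet K} {F : Type} [AddCommGroup F] [Module ℝ F]
    [TopologicalSpace F] [T2Space F] {f g : H1K B N →L[ℝ] F}
    (h : ∀ α, f (det B α) = g (det B α)) : f = g := by
  refine ContinuousLinearMap.ext_on (dense_span_det B N) ?_
  rintro _ ⟨α, rfl⟩
  exact h α

/-- Pairing with an antisymmetric function does not see the antisymmetrizer, since all `N!` permuted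
terms give the same coefficient. It suffices to check this on determinants. -/
theorem ip_altTens (B : OrbitalSet K) (i : Fin N → Orb K) (Ψ : H1K B N) :
    ip (altTens B i) Ψ = coef B i Ψ := by
  refine DFunLike.congr_fun (clm_ext_det (f := gelfand B N (altTens B i)) fun α => ?_) Ψ
  have h1 : toL2 B N (altTens B i) = (N.factorial : ℝ)⁻¹ • ∑ π : Equiv.Perm (Fin N),
      (Equiv.Perm.sign π : ℝ) • tens (fun j => B.φ ((i ∘ π) j)) := by
    rw [← fn_toJet, toJet_altTens, map_smul, map_sum]
    simp only [map_smul, tensJet, Jet.fn_mk]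
  have h2 : ∀ π : Equiv.Perm (Fin N), inner ℝ (tens (fun j => B.φ ((i ∘ π) j)))
      (toL2 B N (det B α)) = (Equiv.Perm.sign π : ℝ) * coef B i (det B α) := fun π =>
    coef_comp_perm_det B i α π
  change ip (altTens B i) (det B α) = _
  rw [ip_eq_inner, h1, inner_smul_left, sum_inner]
  simp only [inner_smul_left, h2, conj_trivial, ← mul_assoc, sign_mul_self]
  simp [Fintype.card_perm, Nat.factorial_ne_zero]

theorem coef_det_of_image (B : OrbitalSet K) {i : Fin N → Orb K} {α : State N K}
    (hi : Function.Injective i) (h : Finset.univ.image i = α.1) :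
    coef B i (det B α) = (Real.sqrt (N.factorial : ℝ))⁻¹ * tsgn i := by
  have : tupleState i hi = α := Subtype.ext h
  rw [← ip_altTens, altTens, dif_pos hi, ip_smul_left, this, ip_det, if_pos rfl, mul_one]

theorem image_of_coef_det_ne_zero (B : OrbitalSet K) {i : Fin N → Orb K} {α : State N K}
    (h : coef B i (det B α) ≠ 0) : Function.Injective i ∧ Finset.univ.image i = α.1 := by
  rw [← ip_altTens, altTens] at h
  split_ifs at h with hi
  · refine ⟨hi, ?_⟩
    by_contra hne
    apply h
    rw [ip_smul_left, ip_det, if_neg, mul_zero]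
    intro h'
    exact hne (congrArg Subtype.val h')
  · exact absurd (ip_zero_left _) h

/-! ### Excitation operators as slot operations -/

open Classical in
/-- The action of an excitation operator with respect to the reference `o`, without excluding
other references. -/
def fullExcite (B : OrbitalSet K) (o α β : State N K) : H1K B N :=
  if h : (occ o α ∪ occ o β).card = N ∧ virt o α ∩ virt o β = ∅ then
    excSign o α β • det B ⟨join o α β, card_join h.1 h.2⟩
  else 0

/-- The weight of the orbital `x` of the excitation; the slots in `Z` carry the holes of the
excited determinant. -/
def excWeight (o : State N K) (Z : Finset (Fin N)) (x : Orb K) : ℝ :=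
  if x ∈ o.1 then 0 else ∏ b ∈ Z, ord x (o.enum b)

/-- The weight of the orbital `x` in the slot `b` of the excited determinant; the slots in `S` carry
the holes of the excitation. -/
def detWeight (o : State N K) (S Z : Finset (Fin N)) (b : Fin N) (x : Orb K) : ℝ :=
  if b ∈ Z then (if x ∈ o.1 then 0 else ∏ a ∈ S, ord (o.enum a) x)
  else if x = o.enum b then 1 else 0

/-- The slots of the reference which carry the holes of `α`. -/
def holeSlots (o α : State N K) : Finset (Fin N) := Finset.univ.filter fun a => o.enum a ∉ α.1

/-- The permutations that preserve `S` and `Z` and fix all other points. -/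
def slotPerms (S Z : Finset (Fin N)) : Finset (Equiv.Perm (Fin N)) :=
  Finset.univ.filter fun π => ∀ a, (π a ∈ S ↔ a ∈ S) ∧ (π a ∈ Z ↔ a ∈ Z) ∧
    (a ∉ S → a ∉ Z → π a = a)

/-- The normalization of the contribution of the slot sets `S` and `Z`. -/
def slotConst (o : State N K) (S Z : Finset (Fin N)) : ℝ :=
  if Disjoint S Z then
    (Real.sqrt (N.factorial : ℝ)) ^ 3 * ((slotPerms S Z).card : ℝ)⁻¹ *
      ∏ a ∈ S, ∏ b ∈ Z, -ord (o.enum a) (o.enum b)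
  else 0

/-- The contribution of the tuple `i` and the slot sets `S` and `Z` to an excitation. -/
def slotTerm (B : OrbitalSet K) (o α β : State N K) (S Z : Finset (Fin N)) (i : Fin N → Orb K) :
    ℝ :=
  ((∏ s ∈ S, excWeight o Z (i s)) * coef B (S.piecewise i o.enum) (det B α)) *
    ((∏ b ∈ Sᶜ, detWeight o S Z b (i b)) * coef B (S.piecewise o.enum i) (det B β))

theorem State.enum_mem (o : State N K) (a : Fin N) : o.enum a ∈ o.1 := by
  rw [← o.image_enum]; exact Finset.mem_image_of_mem _ (Finset.mem_univ a)

theorem State.exists_enum {o : State N K} {x : Orb K} (h : x ∈ o.1) : ∃ a, o.enum a = x := by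
  rw [← o.image_enum] at h; simpa using h

theorem State.enum_injective (o : State N K) : Function.Injective o.enum :=
  o.enum_strictMono.injective

/-- The tuple `i` carries the excitation `α` in the slots `S`, the virtual orbitals of `β` in the
slots `Z`, and spectators in the other slots. -/
structure IsCarrier (o α β : State N K) (S Z : Finset (Fin N)) (i : Fin N → Orb K) : Prop where
  exc : S.image i = virt o α
  det : Z.image i = virt o β
  fix : ∀ b, b ∉ S → b ∉ Z → i b = o.enum b

/-- Nonzero determinant coefficients say that the merged tuples enumerate `α` and `β`. Nonzero
weights say that the entries in `S` and `Z` are virtual and that all others agree with the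
reference. Hence the slot sets can only be the hole slots of the two states, and a sum over all slot
sets has a single surviving term. -/
theorem slotTerm_ne_zero {B : OrbitalSet K} {o α β : State N K} {S Z : Finset (Fin N)}
    {i : Fin N → Orb K} (hd : Disjoint S Z) (h : slotTerm B o α β S Z i ≠ 0) :
    S = holeSlots o α ∧ Z = holeSlots o β ∧ IsCarrier o α β S Z i := by
  simp only [slotTerm, ne_eq, mul_eq_zero, not_or] at h
  obtain ⟨⟨h1, h2⟩, h3, h4⟩ := h
  obtain ⟨hl, hl'⟩ := image_of_coef_det_ne_zero B h2
  obtain ⟨hj, hj'⟩ := image_of_coef_det_ne_zero B h4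
  have hS : ∀ s ∈ S, i s ∉ o.1 := fun s hs hmem => by
    apply Finset.prod_ne_zero_iff.1 h1 s hs
    rw [excWeight, if_pos hmem]
  have hZ : ∀ b ∈ Z, i b ∉ o.1 := fun b hb hmem => by
    apply Finset.prod_ne_zero_iff.1 h3 b
      (Finset.mem_compl.2 (Finset.disjoint_right.1 hd hb))
    rw [detWeight, if_pos hb, if_pos hmem]
  have hR : ∀ b, b ∉ S → b ∉ Z → i b = o.enum b := fun b hb hb' => by
    by_contra hne
    apply Finset.prod_ne_zero_iff.1 h3 b (Finset.mem_compl.2 hb)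
    rw [detWeight, if_neg hb', if_neg hne]
  have hα : ∀ x, x ∈ α.1 ↔ ∃ a, S.piecewise i o.enum a = x := fun x => by rw [← hl']; simp
  have hβ : ∀ x, x ∈ β.1 ↔ ∃ a, S.piecewise o.enum i a = x := fun x => by rw [← hj']; simp
  refine ⟨?_, ?_, ?_, ?_, hR⟩
  · ext a
    simp only [holeSlots, Finset.mem_filter, Finset.mem_univ, true_and]
    constructor
    · intro ha hmem
      obtain ⟨c, hc⟩ := (hα _).1 hmem
      by_cases hcS : c ∈ S
      · rw [Finset.piecewise_eq_of_mem _ _ _ hcS] at hc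
        exact hS c hcS (hc ▸ o.enum_mem a)
      · rw [Finset.piecewise_eq_of_notMem _ _ _ hcS] at hc
        exact hcS (o.enum_injective hc ▸ ha)
    · intro ha
      by_contra haS
      exact ha ((hα _).2 ⟨a, Finset.piecewise_eq_of_notMem _ _ _ haS⟩)
  · ext b
    simp only [holeSlots, Finset.mem_filter, Finset.mem_univ, true_and]
    constructor
    · intro hb hmem
      have hbS := Finset.disjoint_right.1 hd hb
      obtain ⟨c, hc⟩ := (hβ _).1 hmem
      by_cases hcS : c ∈ S
      · rw [Finset.piecewise_eq_of_mem _ _ _ hcS] at hc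
        exact hbS (o.enum_injective hc ▸ hcS)
      · rw [Finset.piecewise_eq_of_notMem _ _ _ hcS] at hc
        by_cases hcZ : c ∈ Z
        · exact hZ c hcZ (hc ▸ o.enum_mem b)
        · rw [hR c hcS hcZ] at hc
          exact hcZ (o.enum_injective hc ▸ hb)
    · intro hb
      by_contra hbZ
      by_cases hbS : b ∈ S
      · exact hb ((hβ _).2 ⟨b, Finset.piecewise_eq_of_mem _ _ _ hbS⟩)
      · exact hb ((hβ _).2 ⟨b, by rw [Finset.piecewise_eq_of_notMem _ _ _ hbS, hR b hbS hbZ]⟩)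
  · ext x
    simp only [virt, Finset.mem_image, Finset.mem_sdiff]
    constructor
    · rintro ⟨s, hs, rfl⟩
      exact ⟨(hα _).2 ⟨s, Finset.piecewise_eq_of_mem _ _ _ hs⟩, hS s hs⟩
    · rintro ⟨hx, hxo⟩
      obtain ⟨c, hc⟩ := (hα _).1 hx
      by_cases hcS : c ∈ S
      · rw [Finset.piecewise_eq_of_mem _ _ _ hcS] at hc
        exact ⟨c, hcS, hc⟩
      · rw [Finset.piecewise_eq_of_notMem _ _ _ hcS] at hc
        exact absurd (hc ▸ o.enum_mem c) hxo
  · ext x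
    simp only [virt, Finset.mem_image, Finset.mem_sdiff]
    constructor
    · rintro ⟨s, hs, rfl⟩
      exact ⟨(hβ _).2 ⟨s, Finset.piecewise_eq_of_notMem _ _ _ (Finset.disjoint_right.1 hd hs)⟩,
        hZ s hs⟩
    · rintro ⟨hx, hxo⟩
      obtain ⟨c, hc⟩ := (hβ _).1 hx
      by_cases hcS : c ∈ S
      · rw [Finset.piecewise_eq_of_mem _ _ _ hcS] at hc
        exact absurd (hc ▸ o.enum_mem c) hxo
      · rw [Finset.piecewise_eq_of_notMem _ _ _ hcS] at hc
        by_cases hcZ : c ∈ Z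
        · exact ⟨c, hcZ, hc⟩
        · rw [hR c hcS hcZ] at hc
          exact absurd (hc ▸ o.enum_mem c) hxo

/-- Both sides express that no reference orbital is missing from both `α` and `β`, that is, the
occupied parts cover the reference. -/
theorem disjoint_holeSlots_iff {o α β : State N K} :
    Disjoint (holeSlots o α) (holeSlots o β) ↔ (occ o α ∪ occ o β).card = N := by
  have h1 : occ o α ∪ occ o β ⊆ o.1 := by
    intro x
    simp only [occ, Finset.mem_union, Finset.mem_inter]
    tauto
  constructor
  · intro h
    suffices occ o α ∪ occ o β = o.1 by rw [this, o.2]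
    refine h1.antisymm fun x hx => ?_
    obtain ⟨a, rfl⟩ := State.exists_enum hx
    have := Finset.disjoint_left.1 h
    specialize @this a
    simp only [holeSlots, Finset.mem_filter, Finset.mem_univ, true_and] at this
    simp only [occ, Finset.mem_union, Finset.mem_inter, hx, and_true]
    tauto
  · intro h
    have h2 := Finset.eq_of_subset_of_card_le h1 (by rw [h, o.2])
    rw [Finset.disjoint_left]
    intro a
    have := o.enum_mem a
    rw [← h2] at this
    simp only [occ, Finset.mem_union, Finset.mem_inter] at this
    simp only [holeSlots, Finset.mem_filter, Finset.mem_univ, true_and]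
    tauto

/-! ### Carriers of an excitation and their signs -/

section Carrier

variable {o α β : State N K} {i : Fin N → Orb K}

theorem IsCarrier.virt_inter {S Z : Finset (Fin N)} (h : IsCarrier o α β S Z i)
    (hd : Disjoint S Z) (hi : Function.Injective i) : virt o α ∩ virt o β = ∅ := by
  rw [← h.exc, ← h.det, ← Finset.image_inter _ _ hi, Finset.disjoint_iff_inter_eq_empty.1 hd,
    Finset.image_empty]

theorem IsCarrier.image_left (h : IsCarrier o α β (holeSlots o α) (holeSlots o β) i) :
    Finset.univ.image ((holeSlots o α).piecewise i o.enum) = α.1 := by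
  ext x
  simp only [Finset.mem_image, Finset.mem_univ, true_and]
  constructor
  · rintro ⟨a, rfl⟩
    by_cases ha : a ∈ holeSlots o α
    · rw [Finset.piecewise_eq_of_mem _ _ _ ha]
      have := Finset.mem_image_of_mem i ha
      rw [h.exc, virt, Finset.mem_sdiff] at this
      exact this.1
    · rw [Finset.piecewise_eq_of_notMem _ _ _ ha]
      simpa [holeSlots] using ha
  · intro hx
    by_cases hxo : x ∈ o.1
    · obtain ⟨a, rfl⟩ := State.exists_enum hxo
      exact ⟨a, Finset.piecewise_eq_of_notMem _ _ _ (by simp [holeSlots, hx])⟩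
    · have : x ∈ virt o α := Finset.mem_sdiff.2 ⟨hx, hxo⟩
      rw [← h.exc] at this
      obtain ⟨a, ha, rfl⟩ := Finset.mem_image.1 this
      exact ⟨a, Finset.piecewise_eq_of_mem _ _ _ ha⟩

theorem IsCarrier.image_right (h : IsCarrier o α β (holeSlots o α) (holeSlots o β) i)
    (hd : Disjoint (holeSlots o α) (holeSlots o β)) :
    Finset.univ.image ((holeSlots o α).piecewise o.enum i) = β.1 := by
  ext x
  simp only [Finset.mem_image, Finset.mem_univ, true_and]
  constructor
  · rintro ⟨a, rfl⟩
    by_cases ha : a ∈ holeSlots o β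
    · rw [Finset.piecewise_eq_of_notMem _ _ _ (Finset.disjoint_right.1 hd ha)]
      have := Finset.mem_image_of_mem i ha
      rw [h.det, virt, Finset.mem_sdiff] at this
      exact this.1
    · have h1 : (holeSlots o α).piecewise o.enum i a = o.enum a := by
        by_cases haS : a ∈ holeSlots o α
        · exact Finset.piecewise_eq_of_mem _ _ _ haS
        · rw [Finset.piecewise_eq_of_notMem _ _ _ haS, h.fix a haS ha]
      rw [h1]
      simpa [holeSlots] using ha
  · intro hx
    by_cases hxo : x ∈ o.1
    · obtain ⟨a, rfl⟩ := State.exists_enum hxo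
      refine ⟨a, ?_⟩
      by_cases haS : a ∈ holeSlots o α
      · exact Finset.piecewise_eq_of_mem _ _ _ haS
      · rw [Finset.piecewise_eq_of_notMem _ _ _ haS, h.fix a haS (by simp [holeSlots, hx])]
    · have : x ∈ virt o β := Finset.mem_sdiff.2 ⟨hx, hxo⟩
      rw [← h.det] at this
      obtain ⟨a, ha, rfl⟩ := Finset.mem_image.1 this
      exact ⟨a, Finset.piecewise_eq_of_notMem _ _ _ (Finset.disjoint_right.1 hd ha)⟩

theorem IsCarrier.image (h : IsCarrier o α β (holeSlots o α) (holeSlots o β) i) :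
    Finset.univ.image i = join o α β := by
  ext x
  simp only [Finset.mem_image, Finset.mem_univ, true_and, join, Finset.mem_union]
  rw [← h.exc, ← h.det]
  constructor
  · rintro ⟨a, rfl⟩
    by_cases haS : a ∈ holeSlots o α
    · exact Or.inr (Or.inl (Finset.mem_image_of_mem _ haS))
    by_cases haZ : a ∈ holeSlots o β
    · exact Or.inr (Or.inr (Finset.mem_image_of_mem _ haZ))
    · left
      rw [h.fix a haS haZ]
      have h1 : o.enum a ∈ α.1 := by simpa [holeSlots] using haS
      have h2 : o.enum a ∈ β.1 := by simpa [holeSlots] using haZ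
      simp [occ, h1, h2, o.enum_mem a]
  · rintro (hx | hx | hx)
    · simp only [occ, Finset.mem_inter] at hx
      obtain ⟨a, rfl⟩ := State.exists_enum hx.1.2
      exact ⟨a, h.fix a (by simp [holeSlots, hx.1.1]) (by simp [holeSlots, hx.2.1])⟩
    · obtain ⟨a, _, rfl⟩ := Finset.mem_image.1 hx
      exact ⟨a, rfl⟩
    · obtain ⟨a, _, rfl⟩ := Finset.mem_image.1 hx
      exact ⟨a, rfl⟩

theorem IsCarrier.excSign_eq {S Z : Finset (Fin N)} (h : IsCarrier o α β S Z i)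
    (hi : Function.Injective i) (hd : Disjoint S Z) :
    excSign o α β = ∏ a ∈ S, ∏ b ∈ Z, -ord (i a) (i b) := by
  have h1 : excSign o α β = ∏ p ∈ virt o β ×ˢ virt o α, if p.2 < p.1 then (-1 : ℝ) else 1 := by
    rw [Finset.prod_ite, Finset.prod_const, Finset.prod_const_one, mul_one]
    rfl
  rw [h1, Finset.prod_product, Finset.prod_comm, ← h.exc, ← h.det,
    Finset.prod_image fun x _ y _ hxy => hi hxy]
  refine Finset.prod_congr rfl fun a ha => ?_
  rw [Finset.prod_image fun x _ y _ hxy => hi hxy]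
  refine Finset.prod_congr rfl fun b hb => ?_
  have hab : i a ≠ i b := hi.ne fun h' => Finset.disjoint_left.1 hd ha (h' ▸ hb)
  rcases lt_or_gt_of_ne hab with h' | h'
  · simp [ord, h']
  · simp [ord, h', h'.le.not_gt]

/-- The contribution is independent of the carrier. By `tsgn_merge` the sorting signs leave four
signs for each pair in `S × Z`: the weights cancel the two mixed ones, `ord (i a) (i b)` builds the
excitation sign, and `ord (o a) (o b)` builds the fixed prefactor. Spectator slots give squares. The
cubed normalization stems from the two coefficients and the antisymmetrized tensor. -/
theorem IsCarrier.slotTerm_smul (B : OrbitalSet K)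
    (h : IsCarrier o α β (holeSlots o α) (holeSlots o β) i)
    (hi : Function.Injective i) (hc : (occ o α ∪ occ o β).card = N)
    (hv : virt o α ∩ virt o β = ∅) :
    slotTerm B o α β (holeSlots o α) (holeSlots o β) i • altTens B i =
      (((Real.sqrt (N.factorial : ℝ))⁻¹) ^ 3 *
        ∏ a ∈ holeSlots o α, ∏ b ∈ holeSlots o β, -ord (o.enum a) (o.enum b)) •
        fullExcite B o α β := by
  have hd := disjoint_holeSlots_iff.2 hc
  set S := holeSlots o α with hS
  set Z := holeSlots o β with hZ
  have hoS : ∀ s ∈ S, i s ∉ o.1 := fun s hs => by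
    have := Finset.mem_image_of_mem i hs
    rw [h.exc, virt, Finset.mem_sdiff] at this
    exact this.2
  have hoZ : ∀ s ∈ Z, i s ∉ o.1 := fun s hs => by
    have := Finset.mem_image_of_mem i hs
    rw [h.det, virt, Finset.mem_sdiff] at this
    exact this.2
  have hZS : Z ⊆ Sᶜ := fun b hb => Finset.mem_compl.2 (Finset.disjoint_right.1 hd hb)
  have hl : Function.Injective (S.piecewise i o.enum) := by
    rw [← Set.injOn_univ, ← Finset.coe_univ, ← Finset.card_image_iff, h.image_left, α.2]
    simp
  have hj : Function.Injective (S.piecewise o.enum i) := by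
    rw [← Set.injOn_univ, ← Finset.coe_univ, ← Finset.card_image_iff, h.image_right hd, β.2]
    simp
  have hst : tupleState i hi = ⟨join o α β, card_join hc hv⟩ := Subtype.ext h.image
  rw [altTens, dif_pos hi, fullExcite, dif_pos ⟨hc, hv⟩, hst, smul_smul, smul_smul]
  congr 1
  rw [slotTerm, coef_det_of_image B hl h.image_left, coef_det_of_image B hj (h.image_right hd),
    h.excSign_eq hi hd]
  have e1 : ∏ s ∈ S, excWeight o Z (i s) = ∏ a ∈ S, ∏ b ∈ Z, ord (i a) (o.enum b) :=
    Finset.prod_congr rfl fun s hs => by rw [excWeight, if_neg (hoS s hs)]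
  have e2 : ∏ b ∈ Sᶜ, detWeight o S Z b (i b) = ∏ a ∈ S, ∏ b ∈ Z, ord (o.enum a) (i b) := by
    rw [Finset.prod_comm, ← Finset.prod_subset hZS]
    · exact Finset.prod_congr rfl fun b hb => by
        rw [detWeight, if_pos hb, if_neg (hoZ b hb)]
    · intro b hb hb'
      rw [detWeight, if_neg hb', if_pos (h.fix b (Finset.mem_compl.1 hb) hb')]
  have e3 := tsgn_merge S hi o.enum_injective
  rw [tsgn_strictMono o.enum_strictMono, mul_one] at e3
  have e4 : ∏ a ∈ S, ∏ b ∈ Sᶜ, (ord (i a) (o.enum b) * ord (o.enum a) (i b) *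
      ord (i a) (i b) * ord (o.enum a) (o.enum b)) =
      ∏ a ∈ S, ∏ b ∈ Z, (ord (i a) (o.enum b) * ord (o.enum a) (i b) *
      ord (i a) (i b) * ord (o.enum a) (o.enum b)) := by
    refine Finset.prod_congr rfl fun a ha => (Finset.prod_subset hZS fun b hb hb' => ?_).symm
    have hbS := Finset.mem_compl.1 hb
    have hab : a ≠ b := fun h' => hbS (h' ▸ ha)
    have hib := h.fix b hbS hb'
    have h1 := ord_mul_self (hi.ne hab)
    have h2 := ord_mul_self (o.enum_injective.ne hab)
    rw [hib] at h1 ⊢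
    linear_combination (ord (o.enum a) (o.enum b) * ord (o.enum a) (o.enum b)) * h1 + h2
  rw [e1, e2]
  have e5 : (∏ a ∈ S, ∏ b ∈ Z, ord (i a) (o.enum b)) * (∏ a ∈ S, ∏ b ∈ Z, ord (o.enum a) (i b)) *
      (tsgn (S.piecewise i o.enum) * tsgn (S.piecewise o.enum i) * tsgn i) =
      (∏ a ∈ S, ∏ b ∈ Z, -ord (o.enum a) (o.enum b)) * ∏ a ∈ S, ∏ b ∈ Z, -ord (i a) (i b) := by
    rw [e3, e4]
    simp only [← Finset.prod_mul_distrib]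
    refine Finset.prod_congr rfl fun a ha => Finset.prod_congr rfl fun b hb => ?_
    have h1 : ord (i a) (o.enum b) * ord (i a) (o.enum b) = 1 :=
      ord_mul_self fun h' => hoS a ha (h' ▸ o.enum_mem b)
    have h2 : ord (o.enum a) (i b) * ord (o.enum a) (i b) = 1 :=
      ord_mul_self fun h' => hoZ b hb (h' ▸ o.enum_mem a)
    linear_combination (ord (o.enum a) (i b) * ord (o.enum a) (i b) * ord (i a) (i b) *
      ord (o.enum a) (o.enum b)) * h1 + (ord (i a) (i b) * ord (o.enum a) (o.enum b)) * h2
  linear_combination ((Real.sqrt (N.factorial : ℝ))⁻¹ ^ 3) * e5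

end Carrier

/-! ### Counting carriers and the slot formula -/

section Sums

variable {ι : Type} [Fintype ι] {ν : ι → Orb K}

theorem exists_carrier {o α β : State N K} (hc : (occ o α ∪ occ o β).card = N)
    (hv : virt o α ∩ virt o β = ∅) :
    ∃ i : Fin N → Orb K, Function.Injective i ∧
      IsCarrier o α β (holeSlots o α) (holeSlots o β) i := by
  have hd := disjoint_holeSlots_iff.2 hc
  -- States and reference have equal size, so there are as many holes as virtual orbitals, and these
  -- can be matched bijectively.
  have hcard : ∀ γ : State N K, (holeSlots o γ).card = (virt o γ).card := by
    intro γ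
    have h1 : (holeSlots o γ).image o.enum = o.1 \ γ.1 := by
      ext x
      simp only [holeSlots, Finset.mem_image, Finset.mem_filter, Finset.mem_univ, true_and,
        Finset.mem_sdiff]
      constructor
      · rintro ⟨a, ha, rfl⟩
        exact ⟨o.enum_mem a, ha⟩
      · rintro ⟨hx, hx'⟩
        obtain ⟨a, rfl⟩ := State.exists_enum hx
        exact ⟨a, hx', rfl⟩
    rw [← Finset.card_image_of_injective _ o.enum_injective, h1, virt]
    have h2 := Finset.card_sdiff_add_card_inter o.1 γ.1
    have h3 := Finset.card_sdiff_add_card_inter γ.1 o.1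
    rw [Finset.inter_comm] at h3
    have h4 := o.2
    have h5 := γ.2
    omega
  have hex : ∀ γ : State N K, ∃ e : Fin N → Orb K, (holeSlots o γ).image e = virt o γ ∧
      Set.InjOn e (holeSlots o γ) := by
    intro γ
    let e := Finset.equivOfCardEq (hcard γ)
    refine ⟨fun a => if h : a ∈ holeSlots o γ then e ⟨a, h⟩ else o.enum a, ?_, ?_⟩
    · ext x
      simp only [Finset.mem_image]
      constructor
      · rintro ⟨a, ha, rfl⟩
        rw [dif_pos ha]
        exact (e ⟨a, ha⟩).2
      · intro hx
        refine ⟨(e.symm ⟨x, hx⟩).1, (e.symm ⟨x, hx⟩).2, ?_⟩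
        rw [dif_pos (e.symm ⟨x, hx⟩).2]
        simp
    · intro a ha b hb hab
      have ha' : a ∈ holeSlots o γ := ha
      have hb' : b ∈ holeSlots o γ := hb
      simp only [dif_pos ha', dif_pos hb'] at hab
      have := e.injective (Subtype.ext hab)
      exact congrArg Subtype.val this
  obtain ⟨e1, h1, h1'⟩ := hex α
  obtain ⟨e2, h2, h2'⟩ := hex β
  set i := (holeSlots o α).piecewise e1 ((holeSlots o β).piecewise e2 o.enum)
  have hcar : IsCarrier o α β (holeSlots o α) (holeSlots o β) i := by
    refine ⟨?_, ?_, ?_⟩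
    · rw [← h1]
      exact Finset.image_congr fun a ha => Finset.piecewise_eq_of_mem _ _ _ ha
    · rw [← h2]
      refine Finset.image_congr fun a ha => ?_
      simp only [i]
      rw [Finset.piecewise_eq_of_notMem _ _ _ (Finset.disjoint_right.1 hd ha)]
      exact Finset.piecewise_eq_of_mem _ _ _ ha
    · intro b hb hb'
      simp only [i]
      rw [Finset.piecewise_eq_of_notMem _ _ _ hb, Finset.piecewise_eq_of_notMem _ _ _ hb']
  refine ⟨i, ?_, hcar⟩
  rw [← Set.injOn_univ, ← Finset.coe_univ, ← Finset.card_image_iff, hcar.image,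
    card_join hc hv]
  simp

open Classical in
-- Two carriers of the same pair enumerate the same join, so they differ by a unique permutation; it
-- preserves `S` and `Z` and fixes the spectators. Carriers thus form one free orbit of these
-- permutations.
theorem card_carriers (hν : Function.Injective ν) {o α β : State N K}
    (hE : ∀ γ ∈ [o, α, β], ∀ x ∈ γ.1, x ∈ Set.range ν)
    (hc : (occ o α ∪ occ o β).card = N) (hv : virt o α ∩ virt o β = ∅) :
    (Finset.univ.filter fun i : Fin N → ι => Function.Injective (ν ∘ i) ∧
      IsCarrier o α β (holeSlots o α) (holeSlots o β) (ν ∘ i)).card =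
      (slotPerms (holeSlots o α) (holeSlots o β)).card := by
  obtain ⟨i₀, hi₀, hcar⟩ := exists_carrier hc hv
  have hr : ∀ a, ∃ p, ν p = i₀ a := by
    intro a
    have h1 : i₀ a ∈ join o α β := hcar.image ▸ Finset.mem_image_of_mem _ (Finset.mem_univ a)
    simp only [join, occ, virt, Finset.mem_union, Finset.mem_inter, Finset.mem_sdiff] at h1
    rcases h1 with h1 | h1 | h1
    · exact hE o (by simp) _ h1.1.2
    · exact hE α (by simp) _ h1.1
    · exact hE β (by simp) _ h1.1
  choose j₀ hj₀ using hr
  have hj₀' : ν ∘ j₀ = i₀ := funext hj₀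
  have himg : ∀ (T : Finset (Fin N)) (π : Equiv.Perm (Fin N)), (∀ a, π a ∈ T ↔ a ∈ T) →
      T.image (i₀ ∘ π) = T.image i₀ := by
    intro T π h
    ext x
    simp only [Finset.mem_image, Function.comp_apply]
    constructor
    · rintro ⟨a, ha, rfl⟩
      exact ⟨π a, (h a).2 ha, rfl⟩
    · rintro ⟨a, ha, rfl⟩
      exact ⟨π.symm a, (h _).1 (by simpa using ha), by simp⟩
  have hmem : ∀ (T : Finset (Fin N)) (π : Equiv.Perm (Fin N)),
      T.image (i₀ ∘ π) = T.image i₀ → ∀ a, π a ∈ T ↔ a ∈ T := by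
    intro T π h a
    constructor
    · intro ha
      have h1 := Finset.mem_image_of_mem i₀ ha
      rw [← h] at h1
      obtain ⟨b, hb, hb'⟩ := Finset.mem_image.1 h1
      exact π.injective (hi₀ hb') ▸ hb
    · intro ha
      have h1 := Finset.mem_image_of_mem (i₀ ∘ π) ha
      rw [h] at h1
      obtain ⟨b, hb, hb'⟩ := Finset.mem_image.1 h1
      exact hi₀ hb' ▸ hb
  symm
  refine Finset.card_bij (fun π _ => j₀ ∘ π) ?_ ?_ ?_
  · intro π hπ
    simp only [slotPerms, Finset.mem_filter, Finset.mem_univ, true_and] at hπ ⊢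
    rw [← Function.comp_assoc, hj₀']
    refine ⟨hi₀.comp π.injective, ?_, ?_, ?_⟩
    · rw [himg _ π fun a => (hπ a).1, hcar.exc]
    · rw [himg _ π fun a => (hπ a).2.1, hcar.det]
    · intro b hb hb'
      rw [Function.comp_apply, (hπ b).2.2 hb hb', hcar.fix b hb hb']
  · intro π _ π' _ h
    ext a
    have h1 := congrArg ν (congrFun h a)
    simp only [Function.comp_apply, hj₀] at h1
    exact congrArg _ (hi₀ h1)
  · intro i hi
    simp only [Finset.mem_filter, Finset.mem_univ, true_and] at hi
    obtain ⟨σ, hσ⟩ := exists_perm_of_image_eq hi.1 (hi.2.image.trans hcar.image.symm)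
    have hcar' := hi.2
    rw [hσ] at hcar'
    refine ⟨σ, ?_, ?_⟩
    · simp only [slotPerms, Finset.mem_filter, Finset.mem_univ, true_and]
      refine fun a => ⟨hmem _ σ (hcar'.exc.trans hcar.exc.symm) a,
        hmem _ σ (hcar'.det.trans hcar.det.symm) a, fun h1 h2 => ?_⟩
      apply hi₀
      rw [hcar.fix a h1 h2, ← hcar'.fix a h1 h2, Function.comp_apply]
    · funext a
      apply hν
      have := congrFun hσ a
      simp only [Function.comp_apply] at this ⊢
      rw [this, hj₀]

theorem slotPerms_card_pos (S Z : Finset (Fin N)) : 0 < (slotPerms S Z).card :=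
  Finset.card_pos.2 ⟨1, by simp [slotPerms]⟩

/-- All carriers contribute equally, so `slotConst` has to divide by their number, undo three
normalizations, and repeat the reference sign, whose square is one. If `S` and `Z` overlap, the
constant vanishes, and so does the excitation when they are the hole slots. -/
theorem sum_slotTerm (B : OrbitalSet K) (hν : Function.Injective ν) {o α β : State N K}
    (hE : ∀ γ ∈ [o, α, β], ∀ x ∈ γ.1, x ∈ Set.range ν) (S Z : Finset (Fin N)) :
    slotConst o S Z • ∑ i : Fin N → ι, slotTerm B o α β S Z (ν ∘ i) • altTens B (ν ∘ i) =
      if S = holeSlots o α ∧ Z = holeSlots o β then fullExcite B o α β else 0 := by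
  classical
  by_cases hd : Disjoint S Z
  swap
  · rw [slotConst, if_neg hd, zero_smul]
    split_ifs with h
    · rw [fullExcite, dif_neg]
      rintro ⟨hc, _⟩
      exact hd (h.1 ▸ h.2 ▸ disjoint_holeSlots_iff.2 hc)
    · rfl
  have hzero : ∀ i : Fin N → ι, ¬ (Function.Injective (ν ∘ i) ∧ IsCarrier o α β S Z (ν ∘ i)) →
      slotTerm B o α β S Z (ν ∘ i) • altTens B (ν ∘ i) = 0 := by
    intro i hi
    by_cases h1 : Function.Injective (ν ∘ i)
    · by_cases h2 : slotTerm B o α β S Z (ν ∘ i) = 0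
      · rw [h2, zero_smul]
      · exact absurd ⟨h1, (slotTerm_ne_zero hd h2).2.2⟩ hi
    · rw [altTens, dif_neg h1, smul_zero]
  split_ifs with h
  · obtain ⟨rfl, rfl⟩ := h
    have hc := disjoint_holeSlots_iff.1 hd
    by_cases hv : virt o α ∩ virt o β = ∅
    · rw [← Finset.sum_filter_add_sum_filter_not _ (fun i : Fin N → ι =>
          Function.Injective (ν ∘ i) ∧
            IsCarrier o α β (holeSlots o α) (holeSlots o β) (ν ∘ i)),
        Finset.sum_eq_zero (s := Finset.univ.filter fun i : Fin N → ι => ¬ _)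
          fun i hi => hzero i (Finset.mem_filter.1 hi).2, add_zero,
        Finset.sum_congr rfl fun i hi => (Finset.mem_filter.1 hi).2.2.slotTerm_smul B
          (Finset.mem_filter.1 hi).2.1 hc hv, Finset.sum_const, card_carriers hν hE hc hv,
        slotConst, if_pos hd, ← Nat.cast_smul_eq_nsmul ℝ, smul_smul, smul_smul]
      have h1 : ((slotPerms (holeSlots o α) (holeSlots o β)).card : ℝ) ≠ 0 := by
        exact_mod_cast (slotPerms_card_pos _ _).ne'
      have h2 : Real.sqrt (N.factorial : ℝ) ≠ 0 :=
        (Real.sqrt_pos.2 (by exact_mod_cast N.factorial_pos)).ne'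
      set P := ∏ a ∈ holeSlots o α, ∏ b ∈ holeSlots o β, -ord (o.enum a) (o.enum b)
      have h3 : P * P = 1 := by
        simp only [P, ← Finset.prod_mul_distrib]
        refine Finset.prod_eq_one fun a ha => Finset.prod_eq_one fun b hb => ?_
        rw [neg_mul_neg]
        exact ord_mul_self (o.enum_injective.ne fun h' =>
          Finset.disjoint_left.1 hd ha (h' ▸ hb))
      have h4 : ∀ c x : ℝ, c ≠ 0 → x ≠ 0 →
          x ^ 3 * c⁻¹ * P * c * (x⁻¹ ^ 3 * P) = 1 := by
        intro c x hc hx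
        field_simp
        rw [sq, h3]
      rw [h4 _ _ h1 h2, one_smul]
    · rw [fullExcite, dif_neg fun h => hv h.2, Finset.sum_eq_zero, smul_zero]
      exact fun i _ => hzero i fun h => hv (h.2.virt_inter hd h.1)
  · rw [Finset.sum_eq_zero, smul_zero]
    intro i _
    by_cases h2 : slotTerm B o α β S Z (ν ∘ i) = 0
    · rw [h2, zero_smul]
    · obtain ⟨h3, h4, _⟩ := slotTerm_ne_zero hd h2
      exact absurd ⟨h3, h4⟩ h

/-- Slot sets and weights no longer depend on `α` and `β`, which enter only through their
coefficients. The formula therefore extends bilinearly to combinations of determinants. -/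
theorem fullExcite_eq_sum (B : OrbitalSet K) (hν : Function.Injective ν) {o α β : State N K}
    (hE : ∀ γ ∈ [o, α, β], ∀ x ∈ γ.1, x ∈ Set.range ν) :
    fullExcite B o α β = ∑ S, ∑ Z, slotConst o S Z •
      ∑ i : Fin N → ι, slotTerm B o α β S Z (ν ∘ i) • altTens B (ν ∘ i) := by
  classical
  simp only [sum_slotTerm B hν hE]
  rw [Finset.sum_eq_single (holeSlots o α) (fun S _ h => by simp [h]) (by simp),
    Finset.sum_eq_single (holeSlots o β) (fun S _ h => by simp [h]) (by simp)]
  simp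

end Sums

/-! ### Boundedness of cluster operators -/

theorem abs_prod_ord_le {A κ : Type} [LinearOrder A] (S : Finset κ) (x y : κ → A) :
    |∏ a ∈ S, ord (x a) (y a)| ≤ 1 := by
  rw [Finset.abs_prod]
  exact Finset.prod_le_one (fun _ _ => abs_nonneg _) fun _ _ => abs_ord_le _ _

/-- The labels are natural numbers, so only finitely many are dominated by an orbital of `o`. All
others have constant order signs relative to `o`. -/
theorem finite_below (o : State N K) : {x : Orb K | ∃ y ∈ o.1, x ≤ y}.Finite := by
  have : {x : Orb K | ∃ y ∈ o.1, x ≤ y} ⊆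
      ⋃ y ∈ o.1, Subtype.val ⁻¹' Set.Iic (y : ℕ) := by
    rintro x ⟨y, hy, hxy⟩
    simp only [Set.mem_iUnion]
    exact ⟨y, hy, hxy⟩
  refine Set.Finite.subset ?_ this
  exact Set.Finite.biUnion (Finset.finite_toSet _) fun y _ =>
    (Set.finite_Iic _).preimage Subtype.val_injective.injOn

/-- The orbitals below the largest orbital of `o`. -/
def below (o : State N K) : Finset (Orb K) := (finite_below o).toFinset

theorem lt_of_notMem_below {o : State N K} {x : Orb K} (hx : x ∉ below o) {y : Orb K}
    (hy : y ∈ o.1) : y < x := by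
  by_contra h
  exact hx ((finite_below o).mem_toFinset.2 ⟨y, hy, not_lt.1 h⟩)

theorem abs_excWeight_le (o : State N K) (Z : Finset (Fin N)) (x : Orb K) :
    |excWeight o Z x| ≤ 1 := by
  unfold excWeight
  split_ifs
  · simp
  · exact abs_prod_ord_le Z _ _

theorem abs_detWeight_le (o : State N K) (S Z : Finset (Fin N)) (b : Fin N) (x : Orb K) :
    |detWeight o S Z b x| ≤ 1 := by
  unfold detWeight
  split_ifs
  · simp
  · exact abs_prod_ord_le S _ _
  · simp
  · simp

theorem excWeight_eq {o : State N K} (Z : Finset (Fin N)) {x : Orb K} (hx : x ∉ below o) :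
    excWeight o Z x = (-1) ^ Z.card := by
  rw [excWeight, if_neg fun h => lt_irrefl _ (lt_of_notMem_below hx h), ← Finset.prod_const]
  refine Finset.prod_congr rfl fun b _ => ?_
  have := lt_of_notMem_below hx (o.enum_mem b)
  simp [ord, this, this.le.not_gt]

theorem detWeight_eq {o : State N K} (S Z : Finset (Fin N)) (b : Fin N) {x : Orb K}
    (hx : x ∉ below o) : detWeight o S Z b x = if b ∈ Z then 1 else 0 := by
  unfold detWeight
  split_ifs with h1 h2 h2
  · exact absurd (lt_of_notMem_below hx h2) (lt_irrefl _)
  · refine Finset.prod_eq_one fun a _ => ?_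
    have := lt_of_notMem_below hx (o.enum_mem a)
    simp [ord, this]
  · exact absurd (lt_of_notMem_below hx (h2 ▸ o.enum_mem b)) (lt_irrefl _)
  · rfl

/-- A bound for the change of the gradient norm by the weights. -/
def weightBound (B : OrbitalSet K) (o : State N K) : ℝ :=
  ∑ x ∈ below o, 4 * ‖B.grad x‖ ^ 2

theorem weightBound_nonneg (B : OrbitalSet K) (o : State N K) : 0 ≤ weightBound B o :=
  Finset.sum_nonneg fun _ _ => by positivity

/-- Only orbitals in `below o` deviate from `r`, by at most 2, which explains the factor 4. The
bound is uniform in the family `ν` although the gradient norms need not be bounded. -/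
theorem sum_weight_le {ι : Type} [Fintype ι] {ν : ι → Orb K} (hν : Function.Injective ν)
    (B : OrbitalSet K) (o : State N K) {u : Orb K → ℝ} {r : ℝ} (hu : ∀ x, |u x| ≤ 1)
    (hr : |r| ≤ 1) (h : ∀ x, x ∉ below o → u x = r) :
    ∑ p, (u (ν p) - r) ^ 2 * ‖B.grad (ν p)‖ ^ 2 ≤ weightBound B o := by
  classical
  have h1 : ∑ p, (u (ν p) - r) ^ 2 * ‖B.grad (ν p)‖ ^ 2 =
      ∑ x ∈ Finset.univ.image ν, (u x - r) ^ 2 * ‖B.grad x‖ ^ 2 :=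
    (Finset.sum_image (f := fun x => (u x - r) ^ 2 * ‖B.grad x‖ ^ 2)
      fun a _ b _ hab => hν hab).symm
  have h2 : ∑ x ∈ Finset.univ.image ν, (u x - r) ^ 2 * ‖B.grad x‖ ^ 2 =
      ∑ x ∈ (Finset.univ.image ν).filter (· ∈ below o), (u x - r) ^ 2 * ‖B.grad x‖ ^ 2 := by
    refine (Finset.sum_filter_of_ne fun x _ hx => ?_).symm
    by_contra hxb
    exact hx (by rw [h x hxb]; simp)
  rw [h1, h2, weightBound]
  refine (Finset.sum_le_sum_of_subset_of_nonneg (t := below o) (fun x hx =>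
    (Finset.mem_filter.1 hx).2) fun _ _ _ => by positivity).trans ?_
  refine Finset.sum_le_sum fun x _ => mul_le_mul_of_nonneg_right ?_ (sq_nonneg _)
  have h3 : |u x - r| ≤ 2 := (abs_sub _ _).trans (by linarith [hu x])
  have h4 := pow_le_pow_left₀ (abs_nonneg _) h3 2
  rw [sq_abs] at h4
  linarith

/-! ### Bounds for weighted merging and its transpose -/

section Slots

variable {ι : Type} {ν : ι → Orb K}

/-- The weighted coefficients of the excitations. -/
def excTensor (B : OrbitalSet K) (o : State N K) (ν : ι → Orb K) (S Z : Finset (Fin N))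
    (Θ : H1K B N) (l : Fin N → ι) : ℝ :=
  (∏ s ∈ S, excWeight o Z (ν (l s))) * coef B (ν ∘ l) Θ

/-- The weights of the excited determinants. -/
def detTensorWeight (o : State N K) (ν : ι → Orb K) (S Z : Finset (Fin N)) (j : Fin N → ι) : ℝ :=
  ∏ b ∈ Sᶜ, detWeight o S Z b (ν (j b))

/-- The action of the cluster operator for the slot sets `S` and `Z` on coefficients. -/
def slotTensor (B : OrbitalSet K) (o : State N K) (ν : ι → Orb K) (oI : Fin N → ι)
    (S Z : Finset (Fin N)) (Θ Ψ : H1K B N) (i : Fin N → ι) : ℝ :=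
  excTensor B o ν S Z Θ (S.piecewise i oI) *
    (detTensorWeight o ν S Z (S.piecewise oI i) * coef B (ν ∘ S.piecewise oI i) Ψ)

theorem excTensor_add (B : OrbitalSet K) (o : State N K) (S Z : Finset (Fin N))
    (Θ Θ' : H1K B N) (l : Fin N → ι) :
    excTensor B o ν S Z (Θ + Θ') l = excTensor B o ν S Z Θ l + excTensor B o ν S Z Θ' l := by
  simp only [excTensor, map_add, mul_add]

theorem excTensor_smul (B : OrbitalSet K) (o : State N K) (S Z : Finset (Fin N))
    (c : ℝ) (Θ : H1K B N) (l : Fin N → ι) :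
    excTensor B o ν S Z (c • Θ) l = c * excTensor B o ν S Z Θ l := by
  simp only [excTensor, map_smul, smul_eq_mul]; ring

theorem comp_piecewise {o : State N K} {oI : Fin N → ι} (hoI : ν ∘ oI = o.enum)
    (S : Finset (Fin N)) (i : Fin N → ι) :
    ν ∘ S.piecewise i oI = S.piecewise (ν ∘ i) o.enum ∧
      ν ∘ S.piecewise oI i = S.piecewise o.enum (ν ∘ i) := by
  rw [← hoI]
  constructor <;>
  · funext a
    by_cases ha : a ∈ S <;> simp [ha]

variable [Fintype ι]

/-- The full excitation graph's cluster operator on finite linear combinations of determinants. -/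
def slotExcite (B : OrbitalSet K) (o : State N K) (ν : ι → Orb K) (oI : Fin N → ι) :
    H1K B N →ₗ[ℝ] H1K B N →ₗ[ℝ] H1K B N :=
  LinearMap.mk₂ ℝ (fun Θ Ψ => ∑ S, ∑ Z, slotConst o S Z •
      ∑ i : Fin N → ι, slotTensor B o ν oI S Z Θ Ψ i • altTens B (ν ∘ i))
    (fun Θ Θ' Ψ => by
      simp only [slotTensor, excTensor_add, add_mul, add_smul, Finset.sum_add_distrib, smul_add])
    (fun c Θ Ψ => by
      simp only [slotTensor, excTensor_smul, mul_assoc, mul_smul c, ← Finset.smul_sum,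
        smul_comm _ c])
    (fun Θ Ψ Ψ' => by
      simp only [slotTensor, map_add, mul_add, add_smul, Finset.sum_add_distrib, smul_add])
    (fun c Θ Ψ => by
      simp only [slotTensor, map_smul, smul_eq_mul, mul_left_comm _ c, mul_smul c,
        ← Finset.smul_sum, smul_comm _ c])

theorem slotExcite_apply (B : OrbitalSet K) (o : State N K) (ν : ι → Orb K) (oI : Fin N → ι)
    (Θ Ψ : H1K B N) : slotExcite B o ν oI Θ Ψ = ∑ S, ∑ Z, slotConst o S Z •
      ∑ i : Fin N → ι, slotTensor B o ν oI S Z Θ Ψ i • altTens B (ν ∘ i) := rfl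

theorem slotExcite_det (B : OrbitalSet K) (hν : Function.Injective ν) {o α β : State N K}
    {oI : Fin N → ι} (hoI : ν ∘ oI = o.enum)
    (hE : ∀ γ ∈ [o, α, β], ∀ x ∈ γ.1, x ∈ Set.range ν) :
    slotExcite B o ν oI (det B α) (det B β) = fullExcite B o α β := by
  rw [fullExcite_eq_sum B hν hE, slotExcite_apply]
  refine Finset.sum_congr rfl fun S _ => Finset.sum_congr rfl fun Z _ => ?_
  congr 1
  refine Finset.sum_congr rfl fun i _ => ?_
  congr 1
  obtain ⟨h1, h2⟩ := comp_piecewise hoI S i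
  rw [slotTensor, excTensor, h1, h2, slotTerm, detTensorWeight]
  congr 2
  · exact Finset.prod_congr rfl fun s hs => by rw [Finset.piecewise_eq_of_mem _ _ _ hs]; rfl
  · exact Finset.prod_congr rfl fun s hs => by
      rw [Finset.piecewise_eq_of_notMem _ _ _ (Finset.mem_compl.1 hs)]; rfl

theorem nsq_weights_le [DecidableEq ι] (B : OrbitalSet K) (hν : Function.Injective ν)
    (o : State N K) (oI : Fin N → ι) (S : Finset (Fin N)) (c : (Fin N → ι) → ℝ)
    {u : Fin N → Orb K → ℝ} {r : Fin N → ℝ} (hu : ∀ s x, |u s x| ≤ 1) (hr : ∀ s, |r s| ≤ 1)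
    (h : ∀ s x, x ∉ below o → u s x = r s) :
    nsq (fun p => B.grad (ν p)) oI (fun i => (∏ s ∈ S, u s (ν (i s))) * c i) ≤
      (2 + 2 * weightBound B o) ^ N * nsq (fun p => B.grad (ν p)) oI c := by
  refine (nsq_mul_slots_le (u := fun s p => u s (ν p)) (r := r) _ oI c S (fun s p => hu s _) hr
    fun s => sum_weight_le hν B o (hu s) (hr s) (h s)).trans ?_
  refine mul_le_mul_of_nonneg_right (pow_le_pow_right₀ ?_ ?_) (nsq_nonneg _ _ _)
  · linarith [weightBound_nonneg B o]
  · exact (Finset.card_le_univ S).trans_eq (Fintype.card_fin N)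

theorem nsq_excTensor_le [DecidableEq ι] (B : OrbitalSet K) (hν : Function.Injective ν)
    (o : State N K) (oI : Fin N → ι) (S Z : Finset (Fin N)) {Θ : H1K B N}
    (hΘ : Θ ∈ finSpan B N ν) :
    nsq (fun p => B.grad (ν p)) oI (excTensor B o ν S Z Θ) ≤
      (2 + 2 * weightBound B o) ^ N * ‖Θ‖ ^ 2 := by
  rw [← nsq_coef B hν oI hΘ]
  exact nsq_weights_le B hν o oI S _ (u := fun _ => excWeight o Z)
    (r := fun _ => (-1) ^ Z.card) (fun _ => abs_excWeight_le o Z) (fun _ => by simp)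
    fun _ x hx => excWeight_eq Z hx

theorem nsq_detTensor_le [DecidableEq ι] (B : OrbitalSet K) (hν : Function.Injective ν)
    (o : State N K) (oI : Fin N → ι) (S Z : Finset (Fin N)) (c : (Fin N → ι) → ℝ) :
    nsq (fun p => B.grad (ν p)) oI (fun j => detTensorWeight o ν S Z j * c j) ≤
      (2 + 2 * weightBound B o) ^ N * nsq (fun p => B.grad (ν p)) oI c :=
  nsq_weights_le B hν o oI Sᶜ _ (u := detWeight o S Z)
    (r := fun b => if b ∈ Z then 1 else 0) (abs_detWeight_le o S Z)
    (fun _ => by split_ifs <;> simp) fun b x hx => detWeight_eq S Z b hx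

/-- The bound for the cluster operators. -/
def excBound (B : OrbitalSet K) (o : State N K) : ℝ :=
  (∑ S, ∑ Z, |slotConst o S Z|) *
    (Real.sqrt (2 + ∑ k, ‖B.grad (o.enum k)‖ ^ 2) * (2 + 2 * weightBound B o) ^ N)

/-- For each pair of slot sets, weighting costs a fixed power of the weight bound for either factor,
merging is bounded by the product of tensor norms, and antisymmetrization is a contraction. -/
theorem norm_slotExcite_le (B : OrbitalSet K) (hν : Function.Injective ν) (o : State N K)
    (oI : Fin N → ι) {Θ Ψ : H1K B N} (hΘ : Θ ∈ finSpan B N ν) (hΨ : Ψ ∈ finSpan B N ν) :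
    ‖slotExcite B o ν oI Θ Ψ‖ ≤ excBound B o * ‖Θ‖ * ‖Ψ‖ := by
  classical
  set A := (2 + 2 * weightBound B o) ^ N with hA
  have hA0 : 0 ≤ A := pow_nonneg (by linarith [weightBound_nonneg B o]) _
  set Q := ∑ k, ‖B.grad (o.enum k)‖ ^ 2
  have hQ : 0 ≤ Q := Finset.sum_nonneg fun _ _ => sq_nonneg _
  -- The constant 2 would do here; `2 + Q` also dominates the `1 + Q` of the transposed estimate, so
  -- that one bound serves both.
  have key : ∀ S Z, ‖∑ i : Fin N → ι, slotTensor B o ν oI S Z Θ Ψ i • altTens B (ν ∘ i)‖ ≤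
      Real.sqrt (2 + Q) * A * ‖Θ‖ * ‖Ψ‖ := by
    intro S Z
    refine abs_le_of_sq_le_sq' ?_ (by positivity) |>.2
    refine (norm_sum_altTens_sq_le B hν oI _).trans ?_
    refine (nsq_merge_le _ oI (excTensor B o ν S Z Θ)
      (fun j => detTensorWeight o ν S Z j * coef B (ν ∘ j) Ψ) S).trans ?_
    have h1 := nsq_excTensor_le B hν o oI S Z hΘ
    have h2 := nsq_detTensor_le B hν o oI S Z fun j => coef B (ν ∘ j) Ψ
    rw [nsq_coef B hν oI hΨ] at h2
    rw [mul_pow, mul_pow, mul_pow, Real.sq_sqrt (by positivity)]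
    calc _ ≤ 2 * (A * ‖Θ‖ ^ 2) * (A * ‖Ψ‖ ^ 2) := by
          gcongr
          exact nsq_nonneg _ _ _
      _ = 2 * (A ^ 2 * ‖Θ‖ ^ 2 * ‖Ψ‖ ^ 2) := by ring
      _ ≤ (2 + Q) * (A ^ 2 * ‖Θ‖ ^ 2 * ‖Ψ‖ ^ 2) := by
          gcongr
          linarith
      _ = _ := by ring
  rw [slotExcite_apply, excBound, Finset.sum_mul, Finset.sum_mul, Finset.sum_mul]
  refine (norm_sum_le _ _).trans (Finset.sum_le_sum fun S _ => ?_)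
  rw [Finset.sum_mul, Finset.sum_mul, Finset.sum_mul]
  refine (norm_sum_le _ _).trans (Finset.sum_le_sum fun Z _ => ?_)
  rw [norm_smul, Real.norm_eq_abs, mul_assoc, mul_assoc, ← mul_assoc _ ‖Θ‖]
  exact mul_le_mul_of_nonneg_left (key S Z) (abs_nonneg _)

/-- Moving the operator to `Φ` turns merging with the tensor of `Θ` into contraction with it. Then
`Ψ` is merely paired with a vector of controlled Sobolev norm, so it enters through its dual norm.
This estimate is what produces the `L²`-adjoint. -/
theorem abs_ip_slotExcite_le (B : OrbitalSet K) (hν : Function.Injective ν) (o : State N K)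
    {oI : Fin N → ι} (hoI : ν ∘ oI = o.enum) {Θ Φ : H1K B N} (hΘ : Θ ∈ finSpan B N ν)
    (Ψ : H1K B N) (hΦ : Φ ∈ finSpan B N ν) :
    |ip (slotExcite B o ν oI Θ Ψ) Φ| ≤ excBound B o * ‖Θ‖ * ‖gelfand B N Ψ‖ * ‖Φ‖ := by
  classical
  set A := (2 + 2 * weightBound B o) ^ N with hA
  have hA0 : 0 ≤ A := pow_nonneg (by linarith [weightBound_nonneg B o]) _
  set Q := ∑ k, ‖B.grad (o.enum k)‖ ^ 2 with hQ
  have hQ0 : 0 ≤ Q := Finset.sum_nonneg fun _ _ => sq_nonneg _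
  have key : ∀ S Z, |ip (∑ i : Fin N → ι, slotTensor B o ν oI S Z Θ Ψ i • altTens B (ν ∘ i)) Φ| ≤
      Real.sqrt (2 + Q) * A * ‖Θ‖ * ‖gelfand B N Ψ‖ * ‖Φ‖ := by
    intro S Z
    set h : (Fin N → ι) → ℝ := fun j => detTensorWeight o ν S Z j *
      contr oI S (excTensor B o ν S Z Θ) (fun i => coef B (ν ∘ i) Φ) j
    have e : ip (∑ i : Fin N → ι, slotTensor B o ν oI S Z Θ Ψ i • altTens B (ν ∘ i)) Φ =
        gelfand B N Ψ (∑ j, h j • altTens B (ν ∘ j)) := by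
      rw [ip_sum_left, map_sum]
      simp only [ip_smul_left, ip_altTens, slotTensor, map_smul, smul_eq_mul]
      rw [sum_merge_mul_eq_contr oI S (excTensor B o ν S Z Θ)
        (fun j => detTensorWeight o ν S Z j * coef B (ν ∘ j) Ψ) fun i => coef B (ν ∘ i) Φ]
      refine Finset.sum_congr rfl fun j _ => ?_
      rw [← ip_altTens, ip_comm]
      simp only [h]
      ring
    have h1 : ‖∑ j, h j • altTens B (ν ∘ j)‖ ≤ Real.sqrt (2 + Q) * A * ‖Θ‖ * ‖Φ‖ := by
      refine abs_le_of_sq_le_sq' ?_ (by positivity) |>.2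
      refine (norm_sum_altTens_sq_le B hν oI _).trans ?_
      refine (nsq_detTensor_le B hν o oI S Z _).trans ?_
      have h1 := nsq_excTensor_le B hν o oI S Z hΘ
      have h2 := nsq_contr_le (fun p => B.grad (ν p)) oI (excTensor B o ν S Z Θ)
        (fun i => coef B (ν ∘ i) Φ) S
      have h3 : ∑ k, ‖B.grad (ν (oI k))‖ ^ 2 = Q := by
        simp only [hQ, ← hoI, Function.comp_apply]
      rw [nsq_coef B hν oI hΦ, h3] at h2
      rw [mul_pow, mul_pow, mul_pow, Real.sq_sqrt (by positivity)]
      calc _ ≤ A * ((1 + Q) * (A * ‖Θ‖ ^ 2) * ‖Φ‖ ^ 2) := by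
            refine mul_le_mul_of_nonneg_left (h2.trans ?_) hA0
            gcongr
        _ = (1 + Q) * (A ^ 2 * ‖Θ‖ ^ 2 * ‖Φ‖ ^ 2) := by ring
        _ ≤ (2 + Q) * (A ^ 2 * ‖Θ‖ ^ 2 * ‖Φ‖ ^ 2) := by
            gcongr
            norm_num
        _ = _ := by ring
    rw [e]
    refine ((gelfand B N Ψ).le_opNorm _).trans ?_
    calc _ ≤ ‖gelfand B N Ψ‖ * (Real.sqrt (2 + Q) * A * ‖Θ‖ * ‖Φ‖) := by gcongr
      _ = _ := by ring
  rw [slotExcite_apply, excBound, Finset.sum_mul, Finset.sum_mul, Finset.sum_mul,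
    Finset.sum_mul, ip_sum_left]
  refine (Finset.abs_sum_le_sum_abs _ _).trans (Finset.sum_le_sum fun S _ => ?_)
  rw [Finset.sum_mul, Finset.sum_mul, Finset.sum_mul, Finset.sum_mul, ip_sum_left]
  refine (Finset.abs_sum_le_sum_abs _ _).trans (Finset.sum_le_sum fun Z _ => ?_)
  rw [ip_smul_left, abs_mul]
  exact (mul_le_mul_of_nonneg_left (key S Z) (abs_nonneg _)).trans_eq (by ring)

end Slots

theorem excBound_nonneg (B : OrbitalSet K) (o : State N K) : 0 ≤ excBound B o := by
  have := weightBound_nonneg B o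
  unfold excBound
  positivity

/-! ### Extension to all of `ℌ¹_K` by density -/

/-- Finite linear combinations of determinants. -/
abbrev detComb (B : OrbitalSet K) (N : ℕ) : (State N K →₀ ℝ) →ₗ[ℝ] H1K B N :=
  Finsupp.linearCombination ℝ fun α : State N K => det B α

/-- The cluster operator with finitely many amplitudes on finite linear combinations. -/
def finExcite (B : OrbitalSet K) (o : State N K) :
    (State N K →₀ ℝ) →ₗ[ℝ] (State N K →₀ ℝ) →ₗ[ℝ] H1K B N :=
  Finsupp.linearCombination ℝ fun α => Finsupp.linearCombination ℝ fun β => fullExcite B o α β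

theorem finExcite_apply (B : OrbitalSet K) (o : State N K) (x y : State N K →₀ ℝ) :
    finExcite B o x y = x.sum fun α a => y.sum fun β b => a • b • fullExcite B o α β := by
  simp only [finExcite, Finsupp.linearCombination_apply, Finsupp.sum, LinearMap.sum_apply,
    LinearMap.smul_apply, Finset.smul_sum]

theorem detComb_mem_finSpan {B : OrbitalSet K} {ι : Type} {ν : ι → Orb K}
    {x : State N K →₀ ℝ} (h : ∀ α ∈ x.support, ∀ p ∈ α.1, p ∈ Set.range ν) :
    detComb B N x ∈ finSpan B N ν := by
  rw [detComb, Finsupp.linearCombination_apply]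
  exact Submodule.sum_mem _ fun α hα => Submodule.smul_mem _ _
    (Submodule.subset_span ⟨α, h α hα, rfl⟩)

theorem finExcite_eq_slotExcite (B : OrbitalSet K) {o : State N K} {ι : Type} [Fintype ι]
    {ν : ι → Orb K} (hν : Function.Injective ν) {oI : Fin N → ι} (hoI : ν ∘ oI = o.enum)
    {x y : State N K →₀ ℝ} (hx : ∀ α ∈ x.support, ∀ p ∈ α.1, p ∈ Set.range ν)
    (hy : ∀ α ∈ y.support, ∀ p ∈ α.1, p ∈ Set.range ν) :
    finExcite B o x y = slotExcite B o ν oI (detComb B N x) (detComb B N y) := by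
  have ho : ∀ p ∈ o.1, p ∈ Set.range ν := by
    intro p hp
    obtain ⟨a, rfl⟩ := State.exists_enum hp
    exact ⟨oI a, congrFun hoI a⟩
  rw [finExcite_apply, detComb, Finsupp.linearCombination_apply, Finsupp.linearCombination_apply]
  simp only [Finsupp.sum, map_sum, LinearMap.sum_apply, map_smul, LinearMap.smul_apply]
  rw [Finset.sum_comm]
  refine Finset.sum_congr rfl fun β hβ => ?_
  rw [Finset.smul_sum]
  refine Finset.sum_congr rfl fun α hα => ?_
  rw [slotExcite_det B hν hoI, smul_comm]
  simp only [List.mem_cons, List.not_mem_nil, or_false, forall_eq_or_imp, forall_eq]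
  exact ⟨ho, hx α hα, hy β hβ⟩

theorem finExcite_bounds (B : OrbitalSet K) (o : State N K) (x y z : State N K →₀ ℝ) :
    ‖finExcite B o x y‖ ≤ excBound B o * ‖detComb B N x‖ * ‖detComb B N y‖ ∧
    |ip (finExcite B o x y) (detComb B N z)| ≤ excBound B o * ‖detComb B N x‖ *
      ‖gelfand B N (detComb B N y)‖ * ‖detComb B N z‖ := by
  classical
  -- Finitely many determinants involve a finite set of orbitals, and the bounds do not depend on
  -- it. The reference is included so that its enumeration lifts to `E`.
  set E : Finset (Orb K) := o.1 ∪ (x.support ∪ y.support ∪ z.support).biUnion fun α => α.1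
  have hE : ∀ α ∈ x.support ∪ y.support ∪ z.support, ∀ p ∈ α.1,
      p ∈ Set.range (Subtype.val : E → Orb K) := by
    intro α hα p hp
    rw [Subtype.range_coe]
    exact Finset.mem_union_right _ (Finset.mem_biUnion.2 ⟨α, hα, hp⟩)
  have hx : ∀ α ∈ x.support, ∀ p ∈ α.1, p ∈ Set.range (Subtype.val : E → Orb K) :=
    fun α hα => hE α (by simp only [Finset.mem_union]; tauto)
  have hy : ∀ α ∈ y.support, ∀ p ∈ α.1, p ∈ Set.range (Subtype.val : E → Orb K) :=
    fun α hα => hE α (by simp only [Finset.mem_union]; tauto)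
  have hz : ∀ α ∈ z.support, ∀ p ∈ α.1, p ∈ Set.range (Subtype.val : E → Orb K) :=
    fun α hα => hE α (by simp only [Finset.mem_union]; tauto)
  let oI : Fin N → E := fun a => ⟨o.enum a, Finset.mem_union_left _ (o.enum_mem a)⟩
  have hoI : Subtype.val ∘ oI = o.enum := rfl
  rw [finExcite_eq_slotExcite B Subtype.val_injective hoI hx hy]
  exact ⟨norm_slotExcite_le B Subtype.val_injective o oI (detComb_mem_finSpan hx)
      (detComb_mem_finSpan hy),
    abs_ip_slotExcite_le B Subtype.val_injective o hoI (detComb_mem_finSpan hx) _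
      (detComb_mem_finSpan hz)⟩

/-- The bilinear map on finite combinations is extended first in the argument and then in the
amplitudes. The dual-norm bound survives because it is a closed condition in each variable. -/
theorem exists_fullCluster (B : OrbitalSet K) (o : State N K) :
    ∃ T : H1K B N →L[ℝ] Op B N, (∀ α β, T (det B α) (det B β) = fullExcite B o α β) ∧
      ∀ Θ Ψ Φ, |ip (T Θ Ψ) Φ| ≤ excBound B o * ‖Θ‖ * ‖gelfand B N Ψ‖ * ‖Φ‖ := by
  have hd := denseRange_linearCombination_det B N
  have hC := excBound_nonneg B o
  have hb1 : ∀ x y, ‖finExcite B o x y‖ ≤ (excBound B o * ‖detComb B N x‖) * ‖detComb B N y‖ :=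
    fun x y => (finExcite_bounds B o x y 0).1
  let T1 : (State N K →₀ ℝ) → Op B N := fun x => (finExcite B o x).extendOfNorm (detComb B N)
  have hT1 : ∀ x y, T1 x (detComb B N y) = finExcite B o x y := fun x y =>
    LinearMap.extendOfNorm_eq hd ⟨_, hb1 x⟩ y
  have hext : ∀ f g : Op B N, (∀ y, f (detComb B N y) = g (detComb B N y)) → f = g :=
    fun f g h => clm_ext_det fun α => by
      simpa [detComb] using h (Finsupp.single α 1)
  let T2 : (State N K →₀ ℝ) →ₗ[ℝ] Op B N :=
    { toFun := T1
      map_add' := fun x x' => hext _ _ fun y => by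
        simp only [add_apply, hT1, map_add, LinearMap.add_apply]
      map_smul' := fun c x => hext _ _ fun y => by
        simp only [smul_apply, hT1, map_smul, LinearMap.smul_apply,
          RingHom.id_apply] }
  have hb2 : ∀ x, ‖T2 x‖ ≤ excBound B o * ‖detComb B N x‖ := fun x =>
    LinearMap.opNorm_extendOfNorm_le hd (by positivity) (hb1 x)
  let T : H1K B N →L[ℝ] Op B N := T2.extendOfNorm (detComb B N)
  have hT : ∀ x, T (detComb B N x) = T1 x := fun x => LinearMap.extendOfNorm_eq hd ⟨_, hb2⟩ x
  refine ⟨T, fun α β => ?_, fun Θ Ψ Φ => ?_⟩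
  · have h1 : detComb B N (Finsupp.single α 1) = det B α := by simp [detComb]
    have h2 : detComb B N (Finsupp.single β 1) = det B β := by simp [detComb]
    rw [← h1, ← h2, hT, hT1]
    simp [finExcite]
  · refine hd.induction_on (p := fun Θ => |ip (T Θ Ψ) Φ| ≤ _ * ‖Θ‖ * _ * _) Θ ?_ fun x => ?_
    · refine isClosed_le (Continuous.abs ?_) (by fun_prop)
      simp only [ip]
      fun_prop
    refine hd.induction_on (p := fun Ψ => |ip (T (detComb B N x) Ψ) Φ| ≤ _ * _ * ‖gelfand B N Ψ‖ * _)
      Ψ ?_ fun y => ?_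
    · refine isClosed_le (Continuous.abs ?_) (by fun_prop)
      simp only [ip]
      fun_prop
    refine hd.induction_on (p := fun Φ => |ip (T (detComb B N x) (detComb B N y)) Φ| ≤ _ * _ * _ * ‖Φ‖)
      Φ ?_ fun z => ?_
    · refine isClosed_le (Continuous.abs ?_) (by fun_prop)
      fun_prop
    rw [hT, hT1]
    exact (finExcite_bounds B o x y z).2

/-! ### `L²`-adjoints -/

/-- `T'` is the `L²`-adjoint of `T` on `ℌ¹_K`. -/
def IsAdj {B : OrbitalSet K} (T T' : Op B N) : Prop := ∀ Ψ Φ, ip (T Ψ) Φ = ip Ψ (T' Φ)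

/-- Let `G` be the Riesz representative of the Gelfand embedding, so that `⟨Ψ, Φ⟩ = (GΨ, Φ)`. The
bound says that `GΨ ↦ GTΨ` extends to a bounded `S`, and the Hilbert space adjoint of `S` works:
`⟨TΨ, Φ⟩ = (SGΨ, Φ) = (GΨ, S*Φ) = ⟨Ψ, S*Φ⟩`. -/
theorem exists_isAdj {B : OrbitalSet K} (T : Op B N) {C : ℝ}
    (hC : ∀ Ψ Φ, |ip (T Ψ) Φ| ≤ C * ‖gelfand B N Ψ‖ * ‖Φ‖) (hC0 : 0 ≤ C) :
    ∃ T' : Op B N, IsAdj T T' := by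
  let J := (InnerProductSpace.toDual ℝ (H1K B N)).symm
  let G : H1K B N →L[ℝ] H1K B N :=
    J.toContinuousLinearEquiv.toContinuousLinearMap.comp (gelfand B N)
  have hG : ∀ Ψ Φ, inner ℝ (G Ψ) Φ = ip Ψ Φ := fun Ψ Φ => InnerProductSpace.toDual_symm_apply
  have hnorm : ∀ Ψ, ‖G Ψ‖ = ‖gelfand B N Ψ‖ := fun Ψ => J.norm_map _
  have hd : DenseRange G := J.surjective.denseRange.comp (gelfand_denseRange B N) J.continuous
  have hb : ∀ Ψ, ‖(G.comp T).toLinearMap Ψ‖ ≤ C * ‖G.toLinearMap Ψ‖ := by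
    intro Ψ
    change ‖G (T Ψ)‖ ≤ C * ‖G Ψ‖
    rw [hnorm, hnorm]
    exact ContinuousLinearMap.opNorm_le_bound _ (by positivity) fun Φ => hC Ψ Φ
  let S : Op B N := (G.comp T).toLinearMap.extendOfNorm G.toLinearMap
  have hS : ∀ Ψ, S (G Ψ) = G (T Ψ) := fun Ψ => LinearMap.extendOfNorm_eq hd ⟨C, hb⟩ Ψ
  refine ⟨ContinuousLinearMap.adjoint S, fun Ψ Φ => ?_⟩
  rw [← hG, ← hS, ← hG, ContinuousLinearMap.adjoint_inner_right]

/-! ### Cluster operators -/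

/-- The `L²`-orthogonal projection that removes the determinants in `s`. -/
def removeDets (B : OrbitalSet K) (s : Finset (State N K)) : Op B N :=
  1 - ∑ γ ∈ s, (gelfand B N (det B γ)).smulRight (det B γ)

theorem removeDets_apply (B : OrbitalSet K) (s : Finset (State N K)) (Ψ : H1K B N) :
    removeDets B s Ψ = Ψ - ∑ γ ∈ s, ip (det B γ) Ψ • det B γ := by
  simp [removeDets]

theorem ip_sub_left {B : OrbitalSet K} (Ψ Θ Φ : H1K B N) :
    ip (Ψ - Θ) Φ = ip Ψ Φ - ip Θ Φ := by simp [ip]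

theorem ip_zero_right {B : OrbitalSet K} (Ψ : H1K B N) : ip Ψ 0 = 0 := by simp [ip]

theorem ip_add_right {B : OrbitalSet K} (Ψ Θ Φ : H1K B N) :
    ip Ψ (Θ + Φ) = ip Ψ Θ + ip Ψ Φ := by simp [ip]

theorem ip_sub_right {B : OrbitalSet K} (Ψ Θ Φ : H1K B N) :
    ip Ψ (Θ - Φ) = ip Ψ Θ - ip Ψ Φ := by simp [ip]

theorem ip_neg_right {B : OrbitalSet K} (Ψ Φ : H1K B N) : ip Ψ (-Φ) = -ip Ψ Φ := by simp [ip]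

theorem ip_smul_right {B : OrbitalSet K} (c : ℝ) (Ψ Φ : H1K B N) :
    ip Ψ (c • Φ) = c * ip Ψ Φ := by simp [ip]

theorem ip_sum_right {B : OrbitalSet K} {ι : Type} (s : Finset ι) (Φ : H1K B N)
    (Ψ : ι → H1K B N) : ip Φ (∑ j ∈ s, Ψ j) = ∑ j ∈ s, ip Φ (Ψ j) := by
  simp [ip]

theorem removeDets_isAdj (B : OrbitalSet K) (s : Finset (State N K)) :
    IsAdj (removeDets B s) (removeDets B s) := by
  intro Ψ Φ
  rw [removeDets_apply, removeDets_apply, ip_sub_right, ip_sum_right, ip_sub_left, ip_sum_left]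
  congr 1
  refine Finset.sum_congr rfl fun γ _ => ?_
  rw [ip_smul_left, ip_smul_right, mul_comm, ip_comm Ψ]

theorem removeDets_det [DecidableEq (State N K)] (B : OrbitalSet K) (s : Finset (State N K))
    (β : State N K) : removeDets B s (det B β) = if β ∈ s then 0 else det B β := by
  rw [removeDets_apply]
  simp only [ip_det, ite_smul, one_smul, zero_smul, Finset.sum_ite_eq']
  split_ifs <;> simp

theorem IsAdj.comp {B : OrbitalSet K} {S S' T T' : Op B N} (hS : IsAdj S S') (hT : IsAdj T T') :
    IsAdj (S.comp T) (T'.comp S') := by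
  intro Ψ Φ
  simp only [ContinuousLinearMap.comp_apply]
  rw [hS, hT]

/-- The graph of the `m`-th reference arises from the full action by projections: all references are
removed as excitations, and those other than `0_m` as sources and targets. The projections are
`L²`-self-adjoint, so adjoints persist. -/
theorem exists_cluster (B : OrbitalSet K) (ref : Fin M → State N K) (m : Fin M) :
    ∃ T : H1K B N →L[ℝ] Op B N, (∀ α β, T (det B α) (det B β) = excite B ref m α β) ∧
      ∀ Θ, ∃ T', IsAdj (T Θ) T' := by
  classical
  obtain ⟨T, hT, hb⟩ := exists_fullCluster B (ref m)
  set s := (Finset.univ.erase m).image ref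
  have hs : ∀ β, β ∉ s ↔ IsVertex ref m β := by
    intro β
    simp only [s, Finset.mem_image, Finset.mem_erase, Finset.mem_univ, and_true, not_exists,
      not_and, IsVertex]
    exact forall₂_congr fun n _ => by rw [eq_comm]
  set s' := Finset.univ.image ref
  have hs' : ∀ α, α ∉ s' ↔ IsVertex ref m α ∧ α ≠ ref m := by
    intro α
    simp only [s', Finset.mem_image, Finset.mem_univ, true_and, not_exists, IsVertex]
    constructor
    · exact fun h => ⟨fun n _ h' => h n h'.symm, fun h' => h m h'.symm⟩
    · intro h n hn
      rcases eq_or_ne n m with rfl | hnm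
      · exact h.2 hn.symm
      · exact h.1 n hnm hn.symm
  let Q := removeDets B s
  refine ⟨(ContinuousLinearMap.compL ℝ _ _ _ Q).comp
    (((ContinuousLinearMap.compL ℝ _ _ _).flip Q).comp (T.comp (removeDets B s'))), ?_, ?_⟩
  · intro α β
    change Q (T (removeDets B s' (det B α)) (Q (det B β))) = _
    simp only [Q, removeDets_det]
    by_cases h : IsEdge ref m α β
    · rw [if_neg ((hs' α).2 ⟨h.left, h.ne⟩), if_neg ((hs β).2 h.right), hT, fullExcite,
        dif_pos ⟨h.occ_union, h.virt_inter⟩, map_smul, removeDets_det,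
        if_neg ((hs _).2 h.target), excite, dif_pos h]
    · rw [excite, dif_neg h]
      by_cases h1 : α ∈ s'
      · simp [h1]
      by_cases h2 : β ∈ s
      · simp [h2]
      rw [if_neg h1, if_neg h2, hT, fullExcite]
      split_ifs with h3
      · rw [map_smul, removeDets_det]
        split_ifs with h4
        · simp
        · exact absurd ⟨((hs' α).1 h1).1, (hs β).1 h2, ((hs' α).1 h1).2, h3.1, h3.2,
            (hs _).1 h4⟩ h
      · simp
  · intro Θ
    obtain ⟨A, hA⟩ := exists_isAdj (T (removeDets B s' Θ)) (hb _)
      (mul_nonneg (excBound_nonneg B _) (norm_nonneg _))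
    exact ⟨_, (removeDets_isAdj B s).comp (hA.comp (removeDets_isAdj B s))⟩

/-- The label of an edge can be recovered from its source and target. Hence distinct excitations
send one determinant to distinct determinants, and the series defining a cluster operator is an
orthogonal one. -/
theorem IsEdge.mem_iff {ref : Fin M → State N K} {m : Fin M} {α β : State N K}
    (h : IsEdge ref m α β) (x : Orb K) : x ∈ α.1 ↔
      (x ∈ (ref m).1 ∧ (x ∈ join (ref m) α β ∨ x ∉ β.1)) ∨
      (x ∉ (ref m).1 ∧ x ∈ join (ref m) α β ∧ x ∉ β.1) := by
  have h1 : occ (ref m) α ∪ occ (ref m) β = (ref m).1 := by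
    refine Finset.eq_of_subset_of_card_le ?_ (by rw [h.occ_union, (ref m).2])
    intro y
    simp only [occ, Finset.mem_union, Finset.mem_inter]
    tauto
  have h2 : x ∈ (ref m).1 → x ∈ α.1 ∨ x ∈ β.1 := by
    intro hx
    rw [← h1] at hx
    simp only [occ, Finset.mem_union, Finset.mem_inter] at hx
    tauto
  have h3 : ¬ (x ∈ virt (ref m) α ∩ virt (ref m) β) := by simp [h.virt_inter]
  simp only [virt, Finset.mem_inter, Finset.mem_sdiff] at h3
  simp only [join, occ, virt, Finset.mem_union, Finset.mem_inter, Finset.mem_sdiff]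
  tauto

theorem IsEdge.eq_of_join_eq {ref : Fin M → State N K} {m : Fin M} {α α' β : State N K}
    (h : IsEdge ref m α β) (h' : IsEdge ref m α' β)
    (hj : join (ref m) α β = join (ref m) α' β) : α = α' := by
  refine Subtype.ext (Finset.ext fun x => ?_)
  rw [h.mem_iff, h'.mem_iff, hj]

theorem excite_of_isEdge (B : OrbitalSet K) {ref : Fin M → State N K} {m : Fin M}
    {α β : State N K} (h : IsEdge ref m α β) : excite B ref m α β =
      excSign (ref m) α β • det B ⟨join (ref m) α β, card_join h.occ_union h.virt_inter⟩ := by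
  rw [excite, dif_pos h]

theorem coeff_of_hasSum {B : OrbitalSet K} {ref : Fin M → State N K} {m : Fin M}
    {t : lp (fun _ : Exc ref m => ℝ) 2} {Θ : H1K B N}
    (h : HasSum (fun α : Exc ref m => t α • toL2 B N (det B α.1)) (toL2 B N Θ))
    (α : Exc ref m) : ip (det B α.1) Θ = t α := by
  have h1 := h.mapL (innerSL ℝ (toL2 B N (det B α.1)))
  simp only [map_smul, innerSL_apply_apply, ← ip_eq_inner, ip_det, smul_eq_mul] at h1
  refine h1.unique ?_
  convert hasSum_single α ?_ using 1
  · simp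
  · intro α' hα'
    rw [if_neg fun h' => hα' (Subtype.ext h'.symm), mul_zero]

/-- The vector `T Θ Φ_β` lies in `ℌ¹_K` and hence has an `L²`-convergent determinant expansion. Its
coefficients are continuous in `Θ`, so determinants decide them: zero at states that no edge from
`β` reaches, and `± t_α` at the target of the edge `α`. Reindexing along the injective map from
edges to targets gives the required series. -/
theorem isClusterOp_of_hasSum {B : OrbitalSet K} {ref : Fin M → State N K} {m : Fin M}
    {T : H1K B N →L[ℝ] Op B N} (hT : ∀ α β, T (det B α) (det B β) = excite B ref m α β)
    {t : lp (fun _ : Exc ref m => ℝ) 2} {Θ : H1K B N}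
    (h : HasSum (fun α : Exc ref m => t α • toL2 B N (det B α.1)) (toL2 B N Θ)) :
    IsClusterOp B ref m t (T Θ) := by
  classical
  intro β
  let F : State N K → H1K B N →L[ℝ] ℝ := fun δ =>
    (gelfand B N (det B δ)).comp (T.flip (det B β))
  have hF : ∀ δ Ξ, F δ Ξ = ip (det B δ) (T Ξ (det B β)) := fun _ _ => rfl
  have hFdet : ∀ δ α, F δ (det B α) = ip (det B δ) (excite B ref m α β) := fun δ α => by
    rw [hF, hT]
  let g : {α : Exc ref m // IsEdge ref m α.1 β} → State N K := fun α =>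
    ⟨join (ref m) α.1.1 β, card_join α.2.occ_union α.2.virt_inter⟩
  have hg : Function.Injective g := fun α α' h => Subtype.ext (Subtype.ext
    (α.2.eq_of_join_eq α'.2 (congrArg Subtype.val h)))
  have hF1 : ∀ α : {α : Exc ref m // IsEdge ref m α.1 β},
      F (g α) = excSign (ref m) α.1.1 β • gelfand B N (det B α.1.1) := by
    intro α
    refine clm_ext_det fun α' => ?_
    rw [hFdet, smul_apply]
    change _ = _ • ip (det B α.1.1) (det B α')
    rw [ip_det, smul_eq_mul]
    by_cases hα' : IsEdge ref m α' β
    · rw [excite_of_isEdge B hα', ip_smul_right, ip_det]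
      by_cases he : α.1.1 = α'
      · subst he
        rw [if_pos rfl, if_pos rfl]
      · rw [if_neg he, if_neg fun h' => he (α.2.eq_of_join_eq hα' (congrArg Subtype.val h'))]
        simp
    · rw [excite, dif_neg hα', ip_zero_right, if_neg, mul_zero]
      rintro rfl
      exact hα' α.2
  have hF0 : ∀ δ, δ ∉ Set.range g → F δ = 0 := by
    intro δ hδ
    refine clm_ext_det fun α' => ?_
    rw [hFdet, zero_apply]
    by_cases hα' : IsEdge ref m α' β
    · rw [excite_of_isEdge B hα', ip_smul_right, ip_det, if_neg, mul_zero]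
      intro h'
      exact hδ ⟨⟨⟨α', hα'.left, hα'.ne⟩, hα'⟩, h'.symm⟩
    · rw [excite, dif_neg hα', ip_zero_right]
  have h1 := hasSum_det B (T Θ (det B β))
  simp only [← hF] at h1
  rw [← hg.hasSum_iff fun δ hδ => by rw [hF0 δ hδ, zero_apply, zero_smul]] at h1
  refine (Function.Injective.hasSum_iff (g := fun α : {α : Exc ref m // IsEdge ref m α.1 β} => α.1)
    Subtype.val_injective fun α hα => ?_).1 ?_
  · have : ¬ IsEdge ref m α.1 β := fun h' => hα ⟨⟨α, h'⟩, rfl⟩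
    rw [excite, dif_neg this, map_zero, smul_zero]
  · convert h1 using 1
    funext α
    rw [Function.comp_apply, Function.comp_apply, hF1, smul_apply]
    change _ = (_ • ip (det B α.1.1) Θ) • _
    rw [coeff_of_hasSum h α.1, excite_of_isEdge B α.2, map_smul, smul_smul, smul_eq_mul, mul_comm]

theorem IsClusterOp.unique {B : OrbitalSet K} {ref : Fin M → State N K} {m : Fin M}
    {t : lp (fun _ : Exc ref m => ℝ) 2} {T T' : Op B N} (h : IsClusterOp B ref m t T)
    (h' : IsClusterOp B ref m t T') : T = T' :=
  clm_ext_det fun β => toL2_injective B ((h β).unique (h' β))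

theorem exists_isClusterOp {B : OrbitalSet K} {ref : Fin M → State N K} {m : Fin M}
    {t : lp (fun _ : Exc ref m => ℝ) 2} (ht : t ∈ ampSpace B ref m) :
    ∃ T, IsClusterOp B ref m t T := by
  obtain ⟨T, hT, _⟩ := exists_cluster B ref m
  obtain ⟨Θ, hΘ⟩ := ht
  exact ⟨T Θ, isClusterOp_of_hasSum hT hΘ⟩

theorem clusterOp_spec {B : OrbitalSet K} {ref : Fin M → State N K} {m : Fin M}
    {t : lp (fun _ : Exc ref m => ℝ) 2} (ht : t ∈ ampSpace B ref m) :
    IsClusterOp B ref m t (clusterOp B ref m t) := by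
  rw [clusterOp, dif_pos (exists_isClusterOp ht)]
  exact (exists_isClusterOp ht).choose_spec

theorem exists_isAdj_clusterOp {B : OrbitalSet K} {ref : Fin M → State N K} {m : Fin M}
    {t : lp (fun _ : Exc ref m => ℝ) 2} (ht : t ∈ ampSpace B ref m) :
    ∃ T', IsAdj (clusterOp B ref m t) T' := by
  obtain ⟨T, hT, hA⟩ := exists_cluster B ref m
  obtain ⟨Θ, hΘ⟩ := id ht
  rw [(clusterOp_spec ht).unique (isClusterOp_of_hasSum hT hΘ)]
  exact hA Θ

/-! ### Exponentials and extensions to the dual -/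

theorem IsAdj.neg {B : OrbitalSet K} {T T' : Op B N} (h : IsAdj T T') : IsAdj (-T) (-T') := by
  intro Ψ Φ
  have := h Ψ Φ
  simp only [ip, neg_apply, map_neg] at this ⊢
  rw [this]

theorem IsAdj.pow {B : OrbitalSet K} {T T' : Op B N} (h : IsAdj T T') (n : ℕ) :
    IsAdj (T ^ n) (T' ^ n) := by
  induction n with
  | zero => intro Ψ Φ; rfl
  | succ n ih =>
    rw [pow_succ, pow_succ']
    exact ih.comp h

theorem hasSum_exp_apply {B : OrbitalSet K} (T : Op B N) (Ψ : H1K B N) :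
    HasSum (fun n : ℕ => (n.factorial : ℝ)⁻¹ • (T ^ n) Ψ) (NormedSpace.exp T Ψ) := by
  have := (NormedSpace.exp_series_hasSum_exp' (𝕂 := ℝ) T).mapL (ContinuousLinearMap.apply ℝ _ Ψ)
  exact this

theorem IsAdj.exp {B : OrbitalSet K} {T T' : Op B N} (h : IsAdj T T') :
    IsAdj (NormedSpace.exp T) (NormedSpace.exp T') := by
  intro Ψ Φ
  have h1 := (hasSum_exp_apply T Ψ).mapL (gelfand B N Φ)
  have h2 := (hasSum_exp_apply T' Φ).mapL (gelfand B N Ψ)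
  rw [ip_comm]
  refine h1.unique ?_
  convert h2 using 1
  funext n
  rw [map_smul, map_smul]
  congr 1
  exact (ip_comm _ _).trans (h.pow n Ψ Φ)

theorem IsDualExt.unique {B : OrbitalSet K} {A : Op B N} {E E' : Dual B N →L[ℝ] Dual B N}
    (h : IsDualExt A E) (h' : IsDualExt A E') : E = E' := by
  have : (E : Dual B N → Dual B N) = E' := (gelfand_denseRange B N).equalizer E.continuous
    E'.continuous (funext fun Ψ => (h Ψ).trans (h' Ψ).symm)
  exact DFunLike.coe_injective this

/-- The extension is the transpose of the adjoint, `l ↦ l ∘ A'`. -/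
theorem IsAdj.isDualExt {B : OrbitalSet K} {A A' : Op B N} (h : IsAdj A A') :
    IsDualExt A ((ContinuousLinearMap.compL ℝ _ _ _).flip A') := by
  intro Ψ
  ext Φ
  exact (h Ψ Φ).symm

theorem dualExt_spec {B : OrbitalSet K} {A A' : Op B N} (h : IsAdj A A') :
    IsDualExt A (dualExt A) := by
  have : ∃ E, IsDualExt A E := ⟨_, h.isDualExt⟩
  rw [dualExt, dif_pos this]
  exact this.choose_spec

theorem dualExt_apply {B : OrbitalSet K} {A A' : Op B N} (h : IsAdj A A') (l : Dual B N)
    (Φ : H1K B N) : dualExt A l Φ = l (A' Φ) := by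
  rw [(dualExt_spec h).unique h.isDualExt]
  rfl

/-! ### Matrix elements of cluster operators -/

theorem IsClusterOp.hasSum_coeff {B : OrbitalSet K} {ref : Fin M → State N K} {m : Fin M}
    {t : lp (fun _ : Exc ref m => ℝ) 2} {T : Op B N} (h : IsClusterOp B ref m t T)
    (β δ : State N K) :
    HasSum (fun α : Exc ref m => t α * ip (det B δ) (excite B ref m α.1 β))
      (ip (det B δ) (T (det B β))) := by
  have h1 := (h β).mapL (innerSL ℝ (toL2 B N (det B δ)))
  simpa only [map_smul, innerSL_apply_apply, ← ip_eq_inner, smul_eq_mul] using h1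

theorem isEdge_ref {ref : Fin M → State N K} (href : Function.Injective ref) {m : Fin M}
    (α : Exc ref m) : IsEdge ref m α.1 (ref m) ∧ join (ref m) α.1 (ref m) = α.1.1 := by
  have hj : join (ref m) α.1 (ref m) = α.1.1 := by
    ext x
    simp only [join, occ, virt, Finset.mem_union, Finset.mem_inter, Finset.mem_sdiff]
    tauto
  have h1 : (occ (ref m) α.1 ∪ occ (ref m) (ref m)).card = N := by
    rw [occ, occ, Finset.inter_self, Finset.union_eq_right.2 Finset.inter_subset_right, (ref m).2]
  have h2 : virt (ref m) α.1 ∩ virt (ref m) (ref m) = ∅ := by simp [virt]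
  refine ⟨⟨α.2.1, fun n hn h => hn (href h).symm, α.2.2, h1, h2, ?_⟩, hj⟩
  have : (⟨join (ref m) α.1 (ref m), card_join h1 h2⟩ : State N K) = α.1 := Subtype.ext hj
  rw [this]
  exact α.2.1

theorem excite_ref (B : OrbitalSet K) {ref : Fin M → State N K}
    (href : Function.Injective ref) {m : Fin M} (α : Exc ref m) :
    excite B ref m α.1 (ref m) = det B α.1 := by
  obtain ⟨h1, h2⟩ := isEdge_ref href α
  rw [excite_of_isEdge B h1]
  have : (⟨join (ref m) α.1 (ref m), card_join h1.occ_union h1.virt_inter⟩ : State N K) = α.1 :=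
    Subtype.ext h2
  rw [this, excSign]
  simp [virt]

theorem IsClusterOp.hasSum_ref {B : OrbitalSet K} {ref : Fin M → State N K}
    (href : Function.Injective ref) {m : Fin M} {t : lp (fun _ : Exc ref m => ℝ) 2} {T : Op B N}
    (h : IsClusterOp B ref m t T) :
    HasSum (fun α : Exc ref m => t α • toL2 B N (det B α.1)) (toL2 B N (T (det B (ref m)))) := by
  simpa only [excite_ref B href] using h (ref m)

/-! ### Excitation rank and the range of cluster operators -/

/-- The excitation rank of a state with respect to the reference `o`. -/
def rank (o α : State N K) : ℕ := (virt o α).card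

theorem rank_le (o α : State N K) : rank o α ≤ N :=
  (Finset.card_le_card Finset.sdiff_subset).trans α.2.le

theorem eq_of_rank_eq_zero {o α : State N K} (h : rank o α = 0) : α = o := by
  rw [rank, Finset.card_eq_zero, virt, Finset.sdiff_eq_empty_iff_subset] at h
  exact Subtype.ext (Finset.eq_of_subset_of_card_le h (by rw [α.2, o.2]))

theorem rank_self (o : State N K) : rank o o = 0 := by simp [rank, virt]

/-- The virtual parts of excitation and source are disjoint, and the join keeps both. -/
theorem IsEdge.rank_join {ref : Fin M → State N K} {m : Fin M} {α β : State N K}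
    (h : IsEdge ref m α β) :
    rank (ref m) ⟨join (ref m) α β, card_join h.occ_union h.virt_inter⟩ =
      rank (ref m) α + rank (ref m) β := by
  rw [rank, rank, rank,
    ← Finset.card_union_of_disjoint (Finset.disjoint_iff_inter_eq_empty.2 h.virt_inter)]
  congr 1
  ext x
  simp only [join, occ, virt, Finset.mem_union, Finset.mem_inter, Finset.mem_sdiff]
  tauto

theorem IsClusterOp.coeff_eq_zero {B : OrbitalSet K} {ref : Fin M → State N K} {m : Fin M}
    {t : lp (fun _ : Exc ref m => ℝ) 2} {T : Op B N} (h : IsClusterOp B ref m t T) {k : ℕ}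
    (ht : ∀ α : Exc ref m, rank (ref m) α.1 < k → t α = 0) {β δ : State N K}
    (hδ : rank (ref m) δ < rank (ref m) β + k) : ip (det B δ) (T (det B β)) = 0 := by
  refine (h.hasSum_coeff β δ).unique ?_
  convert hasSum_zero with α
  by_cases hα : rank (ref m) α.1 < k
  · rw [ht α hα, zero_mul]
  · by_cases he : IsEdge ref m α.1 β
    · rw [excite_of_isEdge B he, ip_smul_right, ip_det, if_neg, mul_zero, mul_zero]
      rintro rfl
      rw [he.rank_join] at hδ
      omega
    · rw [excite, dif_neg he, ip_zero_right, mul_zero]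

/-- The target of an edge is no reference: the others are excluded from the vertices, and `0_m` has
rank zero while the rank of the target is at least that of the nontrivial excitation. -/
theorem IsClusterOp.ip_ref {B : OrbitalSet K} {ref : Fin M → State N K} {m : Fin M}
    {t : lp (fun _ : Exc ref m => ℝ) 2} {T : Op B N} (h : IsClusterOp B ref m t T) (n : Fin M)
    (Ψ : H1K B N) : ip (det B (ref n)) (T Ψ) = 0 := by
  have : (gelfand B N (det B (ref n))).comp T = 0 := by
    refine clm_ext_det fun β => (h.hasSum_coeff β (ref n)).unique ?_
    rw [zero_apply]
    convert hasSum_zero with α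
    by_cases he : IsEdge ref m α.1 β
    · rw [excite_of_isEdge B he, ip_smul_right, ip_det, if_neg, mul_zero, mul_zero]
      intro hn
      rcases eq_or_ne n m with rfl | hnm
      · have h1 := he.rank_join
        rw [← hn, rank_self] at h1
        exact α.2.2 (eq_of_rank_eq_zero (by omega))
      · exact he.target n hnm hn.symm
    · rw [excite, dif_neg he, ip_zero_right, mul_zero]
  exact DFunLike.congr_fun this Ψ

/-- For every `m` the excitations are precisely the states that are no reference. The determinant
expansion of a vector orthogonal to all references is thus already of the form `∑ t_α Φ_α`, with
square summable coefficients by Parseval. -/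
theorem exists_amp {B : OrbitalSet K} {ref : Fin M → State N K} (m : Fin M) {Θ : H1K B N}
    (hΘ : ∀ n, ip (det B (ref n)) Θ = 0) : ∃ t ∈ ampSpace B ref m,
      HasSum (fun α : Exc ref m => t α • toL2 B N (det B α.1)) (toL2 B N Θ) := by
  have hz : ∀ α : State N K, α ∉ Set.range (Subtype.val : Exc ref m → State N K) →
      ip (det B α) Θ = 0 := by
    intro α hα
    by_contra h0
    have h1 : ∀ n, α ≠ ref n := by
      rintro n rfl
      exact h0 (hΘ n)
    exact hα ⟨⟨α, fun n _ => h1 n, h1 m⟩, rfl⟩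
  have h1 : Summable fun α : Exc ref m => ip (det B α.1) Θ * ip (det B α.1) Θ :=
    (hasSum_ip B Θ Θ).summable.comp_injective Subtype.val_injective
  have h2 : Memℓp (fun α : Exc ref m => ip (det B α.1) Θ) 2 := by
    refine memℓp_gen ?_
    simpa [← sq] using h1
  have h3 : HasSum (fun α : Exc ref m => ip (det B α.1) Θ • toL2 B N (det B α.1))
      (toL2 B N Θ) := by
    refine (Function.Injective.hasSum_iff (g := fun α : Exc ref m => α.1)
      (f := fun α => ip (det B α) Θ • toL2 B N (det B α)) Subtype.val_injective ?_).2
      (hasSum_det B Θ)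
    intro α hα
    rw [hz α hα, zero_smul]
  obtain ⟨t, ht⟩ : ∃ t : lp (fun _ : Exc ref m => ℝ) 2, ∀ α, t α = ip (det B α.1) Θ :=
    ⟨⟨_, h2⟩, fun _ => rfl⟩
  simp only [← ht] at h3
  exact ⟨t, ⟨Θ, h3⟩, h3⟩

theorem clusterOp_ref {B : OrbitalSet K} {ref : Fin M → State N K}
    (href : Function.Injective ref) {m : Fin M} {t : lp (fun _ : Exc ref m => ℝ) 2}
    {Θ : H1K B N} (ht : t ∈ ampSpace B ref m)
    (h : HasSum (fun α : Exc ref m => t α • toL2 B N (det B α.1)) (toL2 B N Θ)) :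
    clusterOp B ref m t (det B (ref m)) = Θ :=
  toL2_injective B (((clusterOp_spec ht).hasSum_ref href).unique h)

theorem forall_clusterOp_ref {B : OrbitalSet K} {ref : Fin M → State N K}
    (href : Function.Injective ref) (m : Fin M) {P : H1K B N → Prop} :
    (∀ s ∈ ampSpace B ref m, P (clusterOp B ref m s (det B (ref m)))) ↔
      ∀ Φ, (∀ n, ip (det B (ref n)) Φ = 0) → P Φ := by
  constructor
  · intro h Φ hΦ
    obtain ⟨t, ht, hs⟩ := exists_amp m hΦ
    rw [← clusterOp_ref href ht hs]
    exact h t ht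
  · exact fun h s hs => h _ fun n => (clusterOp_spec hs).ip_ref n _

/-! ### Operators that raise the excitation rank -/

/-- `Ψ` has no component of excitation rank less than `k`. -/
def RankGE {B : OrbitalSet K} (o : State N K) (k : ℕ) (Ψ : H1K B N) : Prop :=
  ∀ α, rank o α < k → ip (det B α) Ψ = 0

/-- `T` raises the excitation rank by at least `k`. -/
def Raises {B : OrbitalSet K} (o : State N K) (k : ℕ) (T : Op B N) : Prop :=
  ∀ j Ψ, RankGE o j Ψ → RankGE o (j + k) (T Ψ)

theorem Raises.add {B : OrbitalSet K} {o : State N K} {k : ℕ} {S T : Op B N}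
    (hS : Raises o k S) (hT : Raises o k T) : Raises o k (S + T) := fun j Ψ h α hα => by
  rw [add_apply, ip_add_right, hS j Ψ h α hα, hT j Ψ h α hα, add_zero]

theorem Raises.mul {B : OrbitalSet K} {o : State N K} {k l : ℕ} {S T : Op B N}
    (hS : Raises o k S) (hT : Raises o l T) : Raises o (k + l) (S * T) := fun j Ψ h => by
  have := hS _ _ (hT j Ψ h)
  rwa [show j + (k + l) = j + l + k by ring]

theorem Raises.pow {B : OrbitalSet K} {o : State N K} {T : Op B N} (hT : Raises o 1 T) (n : ℕ) :
    Raises o n (T ^ n) := by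
  induction n with
  | zero => exact fun j Ψ h => h
  | succ n ih => rw [pow_succ]; exact ih.mul hT

/-- Every word in the expansion of the difference contains some `S`, which raises by `k`, and `n`
further factors raising by one each. The induction peels off the leftmost factor. -/
theorem Raises.pow_sub_pow {B : OrbitalSet K} {o : State N K} {k : ℕ} {S T : Op B N}
    (hS : Raises o k S) (hT : Raises o 1 T) (hTS : Raises o 1 (T + S)) (n : ℕ) :
    Raises o (k + n) ((T + S) ^ (n + 1) - T ^ (n + 1)) := by
  induction n with
  | zero => simpa using hS
  | succ n ih =>
    have e : (T + S) ^ (n + 1 + 1) - T ^ (n + 1 + 1) =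
        (T + S) * ((T + S) ^ (n + 1) - T ^ (n + 1)) + S * T ^ (n + 1) := by
      rw [pow_succ' (T + S) (n + 1), pow_succ' T (n + 1)]
      noncomm_ring
    rw [e]
    refine Raises.add ?_ (hS.mul (hT.pow (n + 1)))
    have := hTS.mul ih
    rwa [show k + (n + 1) = 1 + (k + n) by ring]

/-- Matrix elements between determinants are controlled by ranks; the adjoint and Parseval's
identity carry this over to arbitrary `Ψ`. -/
theorem raises_clusterOp {B : OrbitalSet K} {ref : Fin M → State N K} {m : Fin M}
    {t : lp (fun _ : Exc ref m => ℝ) 2} (ht : t ∈ ampSpace B ref m) {k : ℕ}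
    (hk : ∀ α : Exc ref m, rank (ref m) α.1 < k → t α = 0) :
    Raises (ref m) k (clusterOp B ref m t) := by
  intro j Ψ hΨ δ hδ
  obtain ⟨T', hT'⟩ := exists_isAdj_clusterOp ht
  rw [ip_comm, hT']
  refine (hasSum_ip B Ψ (T' (det B δ))).unique ?_
  convert hasSum_zero with β
  by_cases hβ : rank (ref m) β < j
  · rw [hΨ β hβ, zero_mul]
  · rw [← hT', ip_comm _ (det B δ), (clusterOp_spec ht).coeff_eq_zero hk (by omega), mul_zero]

theorem raises_clusterOp_one {B : OrbitalSet K} {ref : Fin M → State N K} {m : Fin M}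
    {t : lp (fun _ : Exc ref m => ℝ) 2} (ht : t ∈ ampSpace B ref m) :
    Raises (ref m) 1 (clusterOp B ref m t) :=
  raises_clusterOp ht fun α hα => absurd (eq_of_rank_eq_zero (by omega)) α.2.2

theorem ampSpace_add {B : OrbitalSet K} {ref : Fin M → State N K} {m : Fin M}
    {t s : lp (fun _ : Exc ref m => ℝ) 2} (ht : t ∈ ampSpace B ref m)
    (hs : s ∈ ampSpace B ref m) : t + s ∈ ampSpace B ref m := by
  obtain ⟨Θ, hΘ⟩ := ht
  obtain ⟨Ξ, hΞ⟩ := hs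
  refine ⟨Θ + Ξ, ?_⟩
  simpa only [lp.coeFn_add, Pi.add_apply, add_smul, map_add] using hΘ.add hΞ

theorem clusterOp_add {B : OrbitalSet K} {ref : Fin M → State N K} {m : Fin M}
    {t s : lp (fun _ : Exc ref m => ℝ) 2} (ht : t ∈ ampSpace B ref m)
    (hs : s ∈ ampSpace B ref m) :
    clusterOp B ref m (t + s) = clusterOp B ref m t + clusterOp B ref m s := by
  refine (clusterOp_spec (ampSpace_add ht hs)).unique fun β => ?_
  simpa only [lp.coeFn_add, Pi.add_apply, add_smul, map_add, add_apply] using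
    (clusterOp_spec ht β).add (clusterOp_spec hs β)

/-! ### The exponential parametrization -/

theorem exp_apply_eq_of_annihilates {B : OrbitalSet K} {T : Op B N} {l : Dual B N}
    (h : ∀ Ψ, l (T Ψ) = 0) (Ψ : H1K B N) : l (NormedSpace.exp T Ψ) = l Ψ := by
  refine ((hasSum_exp_apply T Ψ).mapL l).unique ?_
  convert hasSum_single 0 fun n hn => ?_ using 1
  · simp
  · obtain ⟨n, rfl⟩ := Nat.exists_eq_succ_of_ne_zero hn
    rw [pow_succ', map_smul]
    change _ • l (T _) = 0
    rw [h, smul_zero]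

theorem ip_ref_exp {B : OrbitalSet K} {ref : Fin M → State N K} {m : Fin M}
    {t : lp (fun _ : Exc ref m => ℝ) 2} (ht : t ∈ ampSpace B ref m) (n : Fin M) (Ψ : H1K B N) :
    ip (det B (ref n)) (NormedSpace.exp (clusterOp B ref m t) Ψ) = ip (det B (ref n)) Ψ :=
  exp_apply_eq_of_annihilates (l := gelfand B N (det B (ref n)))
    ((clusterOp_spec ht).ip_ref n) Ψ

theorem ip_ref_exp_neg {B : OrbitalSet K} {ref : Fin M → State N K} {m : Fin M}
    {t : lp (fun _ : Exc ref m => ℝ) 2} (ht : t ∈ ampSpace B ref m) (n : Fin M) (Ψ : H1K B N) :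
    ip (det B (ref n)) (NormedSpace.exp (-clusterOp B ref m t) Ψ) = ip (det B (ref n)) Ψ := by
  refine exp_apply_eq_of_annihilates (l := gelfand B N (det B (ref n))) (fun Φ => ?_) Ψ
  change ip _ (-(clusterOp B ref m t Φ)) = 0
  rw [ip_neg_right, (clusterOp_spec ht).ip_ref n, neg_zero]

/-- The error `Ξ` is orthogonal to all references, so `Ξ = SΦ_{0_m}` for some amplitudes, and it has
rank at least `k + 1`. Passing from `T` to `T + S` changes the exponential by `Ξ` from the linear
term and by terms of rank at least `k + 2` from the higher powers. Hence the error loses its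
component of rank `k + 1`. -/
theorem exists_exp_clusterOp_approx {B : OrbitalSet K} {ref : Fin M → State N K}
    (href : Function.Injective ref) (m : Fin M) {Ω : H1K B N}
    (hΩ : ∀ n, ip (det B (ref n)) Ω = ip (det B (ref n)) (det B (ref m))) (k : ℕ) :
    ∃ t ∈ ampSpace B ref m, RankGE (ref m) (k + 1)
      (Ω - NormedSpace.exp (clusterOp B ref m t) (det B (ref m))) := by
  induction k with
  | zero =>
    -- The only state of rank zero is the reference itself, where the overlaps agree by assumption.
    refine ⟨0, ⟨0, by simp⟩, fun α hα => ?_⟩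
    have h0 : (0 : lp (fun _ : Exc ref m => ℝ) 2) ∈ ampSpace B ref m := ⟨0, by simp⟩
    rw [eq_of_rank_eq_zero (show rank (ref m) α = 0 by omega), ip_sub_right, ip_ref_exp h0, hΩ,
      sub_self]
  | succ k ih =>
    obtain ⟨t, ht, hk⟩ := ih
    set T := clusterOp B ref m t
    set Φ := det B (ref m)
    set Ξ := Ω - NormedSpace.exp T Φ
    obtain ⟨s, hs, hsum⟩ := exists_amp (ref := ref) m (Θ := Ξ) fun n => by
      rw [ip_sub_right, ip_ref_exp ht, hΩ, sub_self]
    have hS := clusterOp_ref href hs hsum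
    set S := clusterOp B ref m s
    have hadd : clusterOp B ref m (t + s) = T + S := clusterOp_add ht hs
    have hraise : Raises (ref m) (k + 1) S := raises_clusterOp hs fun α hα => by
      rw [← coeff_of_hasSum hsum]
      exact hk α.1 hα
    have hTS : Raises (ref m) 1 (T + S) := hadd ▸ raises_clusterOp_one (ampSpace_add ht hs)
    refine ⟨t + s, ampSpace_add ht hs, fun α hα => ?_⟩
    rw [hadd]
    have h1 := ((hasSum_exp_apply (T + S) Φ).sub (hasSum_exp_apply T Φ)).mapL
      (gelfand B N (det B α))
    have h2 : ip (det B α) (NormedSpace.exp (T + S) Φ - NormedSpace.exp T Φ) =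
        ip (det B α) Ξ := by
      refine h1.unique ?_
      convert hasSum_single 1 fun n hn => ?_ using 1
      · simp only [Nat.factorial_one, Nat.cast_one, inv_one, one_smul, pow_one, add_apply,
          add_sub_cancel_left]
        exact congrArg _ hS.symm
      · rw [← smul_sub, map_smul]
        match n, hn with
        | 0, _ => simp
        | n + 2, _ =>
          have h3 := hraise.pow_sub_pow (raises_clusterOp_one ht) hTS (n + 1) 0 Φ
            (fun _ h => absurd h (Nat.not_lt_zero _)) α (by omega)
          rw [sub_apply] at h3
          exact (congrArg _ h3).trans (smul_zero _)
    rw [show Ω - NormedSpace.exp (T + S) Φ =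
      Ξ - (NormedSpace.exp (T + S) Φ - NormedSpace.exp T Φ) by simp [Ξ], ip_sub_right, h2,
      sub_self]

theorem exists_exp_clusterOp_eq {B : OrbitalSet K} {ref : Fin M → State N K}
    (href : Function.Injective ref) (m : Fin M) {Ω : H1K B N}
    (hΩ : ∀ n, ip (det B (ref n)) Ω = ip (det B (ref n)) (det B (ref m))) :
    ∃ t ∈ ampSpace B ref m, NormedSpace.exp (clusterOp B ref m t) (det B (ref m)) = Ω := by
  -- No state has rank above `N`, so an error of rank at least `N + 1` has no components.
  obtain ⟨t, ht, h⟩ := exists_exp_clusterOp_approx href m hΩ N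
  refine ⟨t, ht, ext_ip fun α => ?_⟩
  have := h α (Nat.lt_succ_of_le (rank_le _ _))
  rw [ip_sub_right, sub_eq_zero] at this
  exact this.symm

/-! ### Families in intermediate normalization -/

/-- The family `Ω` is biorthogonal to the reference determinants. -/
def IsNormalized (B : OrbitalSet K) (ref : Fin M → State N K) (Ω : Fin M → H1K B N) : Prop :=
  ∀ m n, ip (det B (ref n)) (Ω m) = if m = n then 1 else 0

theorem ip_ref_ref (B : OrbitalSet K) {ref : Fin M → State N K} (href : Function.Injective ref)
    (m n : Fin M) : ip (det B (ref n)) (det B (ref m)) = if m = n then 1 else 0 := by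
  rw [ip_det]
  simp only [href.eq_iff, eq_comm]

theorem mem_l2Perp_modelSpace {B : OrbitalSet K} {ref : Fin M → State N K} {Φ : H1K B N} :
    Φ ∈ l2Perp (modelSpace B ref) ↔ ∀ n, ip (det B (ref n)) Φ = 0 := by
  constructor
  · exact fun h n => h _ (Submodule.subset_span ⟨n, rfl⟩)
  · intro h Θ hΘ
    obtain ⟨a, rfl⟩ := (Submodule.mem_span_range_iff_exists_fun ℝ).1 hΘ
    rw [ip_sum_left]
    exact Finset.sum_eq_zero fun n _ => by rw [ip_smul_left, h n, mul_zero]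

theorem IsNormalized.ip_sum {B : OrbitalSet K} {ref : Fin M → State N K} {Ω : Fin M → H1K B N}
    (h : IsNormalized B ref Ω) (a : Fin M → ℝ) (n : Fin M) :
    ip (det B (ref n)) (∑ m, a m • Ω m) = a n := by
  rw [ip_sum_right]
  simp only [ip_smul_right, h _ n, mul_ite, mul_one, mul_zero, Finset.sum_ite_eq',
    Finset.mem_univ, if_true]

/-- The map `Φ ↦ ∑ ⟨Φ_{0_n}, Φ⟩ Ω_n` is the projection onto the span along `𝔑^⊥`. -/
theorem IsNormalized.isCompl {B : OrbitalSet K} {ref : Fin M → State N K} {Ω : Fin M → H1K B N}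
    (h : IsNormalized B ref Ω) :
    IsCompl (Submodule.span ℝ (Set.range Ω)) (l2Perp (modelSpace B ref)) := by
  constructor
  · rw [Submodule.disjoint_def]
    intro x hx hx'
    obtain ⟨a, rfl⟩ := (Submodule.mem_span_range_iff_exists_fun ℝ).1 hx
    rw [mem_l2Perp_modelSpace] at hx'
    refine Finset.sum_eq_zero fun n _ => ?_
    rw [← h.ip_sum a n, hx' n, zero_smul]
  · rw [codisjoint_iff, Submodule.eq_top_iff']
    intro Φ
    refine Submodule.mem_sup.2 ⟨∑ n, ip (det B (ref n)) Φ • Ω n,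
      (Submodule.mem_span_range_iff_exists_fun ℝ).2 ⟨_, rfl⟩,
      Φ - ∑ n, ip (det B (ref n)) Φ • Ω n, ?_, add_sub_cancel _ _⟩
    exact mem_l2Perp_modelSpace.2 fun n => by rw [ip_sub_right, h.ip_sum, sub_self]

/-- Take for `Ω_m` the component of `Φ_{0_m}` in `𝔐` along `𝔑^⊥`; it has the same overlaps with the
references. An element of `𝔐` minus its expansion in the `Ω_n` lies in both complements and
vanishes. -/
theorem exists_isNormalized {B : OrbitalSet K} {ref : Fin M → State N K}
    (href : Function.Injective ref) {𝔐 : Submodule ℝ (H1K B N)}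
    (h : IsCompl 𝔐 (l2Perp (modelSpace B ref))) :
    ∃ Ω : Fin M → H1K B N, IsNormalized B ref Ω ∧ 𝔐 = Submodule.span ℝ (Set.range Ω) := by
  have h1 : ∀ m, ∃ x ∈ 𝔐, ∃ y ∈ l2Perp (modelSpace B ref), x + y = det B (ref m) := fun m =>
    Submodule.mem_sup.1 ((codisjoint_iff.1 h.codisjoint).symm ▸ Submodule.mem_top)
  choose Ω hΩ y hy hsum using h1
  have hn : IsNormalized B ref Ω := fun m n => by
    rw [← ip_ref_ref B href, ← hsum m, ip_add_right, mem_l2Perp_modelSpace.1 (hy m) n, add_zero]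
  have hle : Submodule.span ℝ (Set.range Ω) ≤ 𝔐 :=
    Submodule.span_le.2 (by rintro _ ⟨m, rfl⟩; exact hΩ m)
  refine ⟨Ω, hn, le_antisymm (fun x hx => ?_) hle⟩
  have hmem : ∑ n, ip (det B (ref n)) x • Ω n ∈ Submodule.span ℝ (Set.range Ω) :=
    (Submodule.mem_span_range_iff_exists_fun ℝ).2 ⟨_, rfl⟩
  have h0 := (Submodule.disjoint_def.1 h.disjoint) _ (𝔐.sub_mem hx (hle hmem))
    (mem_l2Perp_modelSpace.2 fun n => by rw [ip_sub_right, hn.ip_sum, sub_self])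
  rw [sub_eq_zero.1 h0]
  exact hmem

theorem ciState_isNormalized {B : OrbitalSet K} {ref : Fin M → State N K}
    (href : Function.Injective ref) {c : Amps ref} (hc : ∀ m, c m ∈ ampSpace B ref m) :
    IsNormalized B ref (ciState B ref c) := fun m n => by
  rw [ciState, add_apply, ip_add_right, (clusterOp_spec (hc m)).ip_ref, add_zero]
  exact ip_ref_ref B href m n

theorem ccState_isNormalized {B : OrbitalSet K} {ref : Fin M → State N K}
    (href : Function.Injective ref) {t : Amps ref} (ht : ∀ m, t m ∈ ampSpace B ref m) :
    IsNormalized B ref (ccState B ref t) := fun m n => by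
  rw [ccState, ip_ref_exp (ht m), ip_ref_ref B href]

theorem IsNormalized.exists_ciState {B : OrbitalSet K} {ref : Fin M → State N K}
    (href : Function.Injective ref) {Ω : Fin M → H1K B N} (h : IsNormalized B ref Ω) :
    ∃ c : Amps ref, (∀ m, c m ∈ ampSpace B ref m) ∧ ciState B ref c = Ω := by
  have h1 : ∀ m, ∃ c ∈ ampSpace B ref m,
      HasSum (fun α : Exc ref m => c α • toL2 B N (det B α.1))
        (toL2 B N (Ω m - det B (ref m))) := fun m =>
    exists_amp m fun n => by rw [ip_sub_right, h m n, ip_ref_ref B href, sub_self]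
  choose c hc hs using h1
  refine ⟨c, hc, funext fun m => ?_⟩
  rw [ciState, add_apply, clusterOp_ref href (hc m) (hs m)]
  exact add_sub_cancel _ _

theorem IsNormalized.exists_ccState {B : OrbitalSet K} {ref : Fin M → State N K}
    (href : Function.Injective ref) {Ω : Fin M → H1K B N} (h : IsNormalized B ref Ω) :
    ∃ t : Amps ref, (∀ m, t m ∈ ampSpace B ref m) ∧ ccState B ref t = Ω := by
  have h1 : ∀ m, ∃ t ∈ ampSpace B ref m,
      NormedSpace.exp (clusterOp B ref m t) (det B (ref m)) = Ω m := fun m =>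
    exists_exp_clusterOp_eq href m fun n => by rw [h m n, ip_ref_ref B href]
  choose t ht he using h1
  exact ⟨t, ht, funext he⟩

/-! ### Weak invariance in matrix form -/

/-- `H` maps the span of the `Ω_m` into itself, with matrix `A`. -/
def Represents {B : OrbitalSet K} (H : H1K B N →L[ℝ] Dual B N) (Ω : Fin M → H1K B N)
    (A : Matrix (Fin M) (Fin M) ℝ) : Prop :=
  ∀ m Φ, H (Ω m) Φ = ∑ n, A m n * ip (Ω n) Φ

theorem weaklyInvariant_iff {B : OrbitalSet K} {H : H1K B N →L[ℝ] Dual B N}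
    {Ψ : Fin M → H1K B N} :
    WeaklyInvariant H Ψ ↔ ∀ x ∈ targetSpan Ψ, ∃ Θ ∈ targetSpan Ψ, ∀ Φ, H x Φ = ip Θ Φ := by
  constructor
  · intro h x hx
    choose Θ hΘ hH using h
    obtain ⟨a, rfl⟩ := (Submodule.mem_span_range_iff_exists_fun ℝ).1 hx
    refine ⟨∑ n, a n • Θ n, Submodule.sum_mem _ fun n _ => Submodule.smul_mem _ _ (hΘ n),
      fun Φ => ?_⟩
    rw [ip_sum_left, map_sum, _root_.sum_apply]
    exact Finset.sum_congr rfl fun n _ => by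
      rw [map_smul, smul_apply, hH, ip_smul_left, smul_eq_mul]
  · exact fun h m => h _ (Submodule.subset_span ⟨m, rfl⟩)

theorem weaklyInvariant_iff_represents {B : OrbitalSet K} {H : H1K B N →L[ℝ] Dual B N}
    {Ψ Ω : Fin M → H1K B N} (h : targetSpan Ψ = Submodule.span ℝ (Set.range Ω)) :
    WeaklyInvariant H Ψ ↔ ∃ A, Represents H Ω A := by
  have e : WeaklyInvariant H Ψ ↔ WeaklyInvariant H Ω := by
    rw [weaklyInvariant_iff, weaklyInvariant_iff, h]
  have hip : ∀ (a : Fin M → ℝ) Φ, ip (∑ n, a n • Ω n) Φ = ∑ n, a n * ip (Ω n) Φ :=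
    fun a Φ => by simp only [ip_sum_left, ip_smul_left]
  rw [e]
  constructor
  · intro hw
    choose Θ hΘ hH using hw
    choose A hA using fun m => (Submodule.mem_span_range_iff_exists_fun ℝ).1 (hΘ m)
    exact ⟨A, fun m Φ => by rw [hH, ← hA, hip]⟩
  · rintro ⟨A, hA⟩ m
    exact ⟨∑ n, A m n • Ω n, (Submodule.mem_span_range_iff_exists_fun ℝ).2 ⟨_, rfl⟩,
      fun Φ => by rw [hA, hip]⟩

/-- On the references both sides agree automatically because `Ω` is normalized. Subtracting from `Φ`
its projection to `𝔑` reduces any test vector to one in `𝔑^⊥`, so the projected equations are as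
strong as the full one. -/
theorem eqOn_perp_iff {B : OrbitalSet K} {ref : Fin M → State N K}
    (href : Function.Injective ref) {Ω : Fin M → H1K B N} (h : IsNormalized B ref Ω)
    (l : Dual B N) :
    (∀ Φ, (∀ n, ip (det B (ref n)) Φ = 0) → l Φ = ∑ n, l (det B (ref n)) * ip (Ω n) Φ) ↔
      ∀ Φ, l Φ = ∑ n, l (det B (ref n)) * ip (Ω n) Φ := by
  refine ⟨fun hl Φ => ?_, fun hl Φ _ => hl Φ⟩
  have hδ : ∀ k, ∑ n, l (det B (ref n)) * ip (Ω n) (det B (ref k)) = l (det B (ref k)) := by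
    intro k
    simp only [ip_comm _ (det B (ref k)), h _ k, mul_ite, mul_one, mul_zero, Finset.sum_ite_eq',
      Finset.mem_univ, if_true]
  let g : Dual B N := l - ∑ n, l (det B (ref n)) • gelfand B N (Ω n)
  have hg : ∀ Φ, g Φ = l Φ - ∑ n, l (det B (ref n)) * ip (Ω n) Φ := fun Φ => by
    simp only [g, sub_apply, _root_.sum_apply, smul_apply, smul_eq_mul, ip]
  have hn : IsNormalized B ref fun m => det B (ref m) := ip_ref_ref B href
  have h0 : g (∑ n, ip (det B (ref n)) Φ • det B (ref n)) = 0 := by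
    rw [map_sum]
    refine Finset.sum_eq_zero fun k _ => ?_
    rw [map_smul, hg, hδ, sub_self, smul_zero]
  have h1 : g (Φ - ∑ n, ip (det B (ref n)) Φ • det B (ref n)) = 0 := by
    rw [hg, hl _ fun n => by rw [ip_sub_right, hn.ip_sum, sub_self], sub_self]
  rw [map_sub, h0, sub_zero, hg, sub_eq_zero] at h1
  exact h1

/-! ### The MRCI and JM-MRCC equations -/

theorem fullMRCI_iff {B : OrbitalSet K} {ref : Fin M → State N K}
    (href : Function.Injective ref) {H : H1K B N →L[ℝ] Dual B N} {𝔐 : Submodule ℝ (H1K B N)}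
    {c : Amps ref} : FullMRCI B ref H 𝔐 c ↔ (∀ m, c m ∈ ampSpace B ref m) ∧
      𝔐 = Submodule.span ℝ (Set.range (ciState B ref c)) ∧
      Represents H (ciState B ref c) (ciHeff B ref H c) := by
  have key : (∀ m, c m ∈ ampSpace B ref m) → ∀ m, ((∀ s ∈ ampSpace B ref m,
      H (ciState B ref c m) (clusterOp B ref m s (det B (ref m))) =
        ∑ n, ciHeff B ref H c m n *
          ip (ciState B ref c n) (clusterOp B ref m s (det B (ref m)))) ↔
      ∀ Φ, H (ciState B ref c m) Φ = ∑ n, ciHeff B ref H c m n * ip (ciState B ref c n) Φ) :=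
    fun hc m => (forall_clusterOp_ref href m (P := fun Φ => H (ciState B ref c m) Φ =
      ∑ n, ciHeff B ref H c m n * ip (ciState B ref c n) Φ)).trans
      (eqOn_perp_iff href (ciState_isNormalized href hc) _)
  constructor
  · exact fun h => ⟨h.mem, h.span_eq, fun m => (key h.mem m).1 (h.eqn m)⟩
  · exact fun h => ⟨h.1, h.2.1, fun m => (key h.1 m).2 (h.2.2 m)⟩

/-- The adjoint of `e^{-T}` is `e^{-T'}`, which is onto because `e^{T'}` is a right inverse. -/
theorem exists_adj_exp_neg {B : OrbitalSet K} {ref : Fin M → State N K} {m : Fin M}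
    {t : lp (fun _ : Exc ref m => ℝ) 2} (ht : t ∈ ampSpace B ref m) :
    ∃ A' : Op B N, IsAdj (NormedSpace.exp (-clusterOp B ref m t)) A' ∧
      Function.Surjective A' := by
  obtain ⟨T', hT'⟩ := exists_isAdj_clusterOp ht
  refine ⟨_, hT'.neg.exp, fun Φ => ⟨NormedSpace.exp T' Φ, ?_⟩⟩
  let : NormedAlgebra ℚ (Op B N) := NormedAlgebra.restrictScalars ℚ ℝ (Op B N)
  have : NormedSpace.exp (-T') * NormedSpace.exp T' = 1 := by
    rw [← NormedSpace.exp_add_of_commute (Commute.refl T').neg_left, neg_add_cancel,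
      NormedSpace.exp_zero]
  exact DFunLike.congr_fun this Φ

/-- Since `e^{-T^{(m)}}` does not change overlaps with the references, the family `e^{-T^{(m)}}
e^{T^{(n)}} Φ_{0_n}` is normalized and `eqOn_perp_iff` applies. Transferring `e^{-T^{(m)}}` to the
test vectors on both sides then removes it, as its adjoint is onto. -/
theorem fullJMMRCC_iff {B : OrbitalSet K} {ref : Fin M → State N K}
    (href : Function.Injective ref) {H : H1K B N →L[ℝ] Dual B N} {𝔐 : Submodule ℝ (H1K B N)}
    {t : Amps ref} : FullJMMRCC B ref H 𝔐 t ↔ (∀ m, t m ∈ ampSpace B ref m) ∧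
      𝔐 = Submodule.span ℝ (Set.range (ccState B ref t)) ∧
      Represents H (ccState B ref t) (ccHeff B ref H t) := by
  have key : (∀ m, t m ∈ ampSpace B ref m) → ∀ m, ((∀ s ∈ ampSpace B ref m,
      ccFunctional B ref H t m (clusterOp B ref m s (det B (ref m))) =
        ∑ n, ccHeff B ref H t m n *
          ip (NormedSpace.exp (-clusterOp B ref m (t m)) (ccState B ref t n))
            (clusterOp B ref m s (det B (ref m)))) ↔
      ∀ Φ, H (ccState B ref t m) Φ = ∑ n, ccHeff B ref H t m n * ip (ccState B ref t n) Φ) := by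
    intro ht m
    have hn : IsNormalized B ref fun n =>
        NormedSpace.exp (-clusterOp B ref m (t m)) (ccState B ref t n) := fun n k => by
      rw [ip_ref_exp_neg (ht m)]
      exact ccState_isNormalized href ht n k
    refine ((forall_clusterOp_ref href m (P := fun Φ => ccFunctional B ref H t m Φ =
      ∑ n, ccHeff B ref H t m n *
        ip (NormedSpace.exp (-clusterOp B ref m (t m)) (ccState B ref t n)) Φ)).trans
      (eqOn_perp_iff href hn _)).trans ?_
    obtain ⟨A', hA, hsurj⟩ := exists_adj_exp_neg (ht m)
    refine Iff.trans ?_ hsurj.forall.symm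
    refine forall_congr' fun Φ => ?_
    rw [ccFunctional, dualExt_apply hA]
    simp only [hA _ Φ]
    rfl
  constructor
  · exact fun h => ⟨h.mem, h.span_eq, fun m => (key h.mem m).1 (h.eqn m)⟩
  · exact fun h => ⟨h.1, h.2.1, fun m => (key h.1 m).2 (h.2.2 m)⟩

theorem Represents.apply_ref {B : OrbitalSet K} {ref : Fin M → State N K}
    {H : H1K B N →L[ℝ] Dual B N} {Ω : Fin M → H1K B N} (h : IsNormalized B ref Ω)
    {A : Matrix (Fin M) (Fin M) ℝ} (hA : Represents H Ω A) (m n : Fin M) :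
    H (Ω m) (det B (ref n)) = A m n := by
  rw [hA]
  simp only [ip_comm _ (det B (ref n)), h _ n, mul_ite, mul_one, mul_zero, Finset.sum_ite_eq',
    Finset.mem_univ, if_true]

theorem Represents.ciHeff_eq {B : OrbitalSet K} {ref : Fin M → State N K}
    (href : Function.Injective ref) {H : H1K B N →L[ℝ] Dual B N} {c : Amps ref}
    (hc : ∀ m, c m ∈ ampSpace B ref m) {A : Matrix (Fin M) (Fin M) ℝ}
    (hA : Represents H (ciState B ref c) A) : ciHeff B ref H c = A := by
  ext m n
  exact hA.apply_ref (ciState_isNormalized href hc) m n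

theorem Represents.ccHeff_eq {B : OrbitalSet K} {ref : Fin M → State N K}
    (href : Function.Injective ref) {H : H1K B N →L[ℝ] Dual B N} {t : Amps ref}
    (ht : ∀ m, t m ∈ ampSpace B ref m) {A : Matrix (Fin M) (Fin M) ℝ}
    (hA : Represents H (ccState B ref t) A) : ccHeff B ref H t = A := by
  ext m n
  obtain ⟨A', hA', -⟩ := exists_adj_exp_neg (ht m)
  change dualExt _ _ _ = _
  rw [dualExt_apply hA', hA]
  simp only [← hA' _ (det B (ref n)), ip_comm _ (det B (ref n)), ip_ref_exp_neg (ht m),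
    ccState_isNormalized href ht _ n, mul_ite, mul_one, mul_zero, Finset.sum_ite_eq',
    Finset.mem_univ, if_true]

/-- Biorthogonality reads off the coefficients as `a_n = ⟨Φ_{0_n}, Ψ⟩`, hence uniqueness. Testing
against `Φ_{0_m}` gives `∑ A_{nm} a_n` on the left, since `⟨H Ω_n, Φ_{0_m}⟩ = A_{nm}`. -/
theorem IsNormalized.eigen {B : OrbitalSet K} {ref : Fin M → State N K}
    {H : H1K B N →L[ℝ] Dual B N} {Ω : Fin M → H1K B N} (h : IsNormalized B ref Ω)
    {A : Matrix (Fin M) (Fin M) ℝ} (hA : Represents H Ω A) {Ψ : H1K B N} (h0 : Ψ ≠ 0)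
    (hΨ : Ψ ∈ Submodule.span ℝ (Set.range Ω)) {ε : ℝ} (hε : ∀ Φ, H Ψ Φ = ε * ip Ψ Φ) :
    ∃ a : Fin M → ℝ, a ≠ 0 ∧ Ψ = ∑ n, a n • Ω n ∧
      (∀ b : Fin M → ℝ, Ψ = ∑ n, b n • Ω n → b = a) ∧ ∀ m, ∑ n, A n m * a n = ε * a m := by
  obtain ⟨a, rfl⟩ := (Submodule.mem_span_range_iff_exists_fun ℝ).1 hΨ
  refine ⟨a, ?_, rfl, fun b hb => funext fun n => ?_, fun m => ?_⟩
  · rintro rfl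
    exact h0 (by simp)
  · rw [← h.ip_sum a n, hb, h.ip_sum b n]
  · have := hε (det B (ref m))
    rw [ip_comm, h.ip_sum, map_sum, _root_.sum_apply] at this
    rw [← this]
    refine Finset.sum_congr rfl fun n _ => ?_
    rw [map_smul, smul_apply, hA.apply_ref h, smul_eq_mul, mul_comm]

end JM

end

/-! ### Equivalences and eigenvalue problems -/

theorem mainTheorem3 {N M : ℕ} {K : ℕ∞} (hN : 1 ≤ N) (hM : 1 ≤ M) (B : OrbitalSet K)
    (ref : Fin M → State N K) (href : Function.Injective ref)
    (H : H1K B N →L[ℝ] JM.Dual B N)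
    (Ψ : Fin M → H1K B N) (horth : ∀ m n, m ≠ n → ip (Ψ m) (Ψ n) = 0)
    (hover : ∀ m, ∃ n, ip (Ψ m) (det B (ref n)) ≠ 0) :
    -- the cluster operators and the extensions of their exponentials are well defined
    (∀ m, ∀ t ∈ ampSpace B ref m,
      (∃! T : Op B N, IsClusterOp B ref m t T) ∧ IsClusterOp B ref m t (clusterOp B ref m t) ∧
      (∃! E, IsDualExt (NormedSpace.exp (-clusterOp B ref m t)) E) ∧
      IsDualExt (NormedSpace.exp (-clusterOp B ref m t))
        (dualExt (NormedSpace.exp (-clusterOp B ref m t)))) ∧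
    -- the equivalences
    (IsCompl (targetSpan Ψ) (l2Perp (modelSpace B ref)) →
      List.TFAE [WeaklyInvariant H Ψ,
        ∃ t : Amps ref, FullJMMRCC B ref H (targetSpan Ψ) t,
        ∃ c : Amps ref, FullMRCI B ref H (targetSpan Ψ) c]) ∧
    -- what remains without the complementarity condition
    ((∃ t : Amps ref, FullJMMRCC B ref H (targetSpan Ψ) t) →
      IsCompl (targetSpan Ψ) (l2Perp (modelSpace B ref)) ∧ WeaklyInvariant H Ψ) ∧
    ((∃ c : Amps ref, FullMRCI B ref H (targetSpan Ψ) c) →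
      IsCompl (targetSpan Ψ) (l2Perp (modelSpace B ref)) ∧ WeaklyInvariant H Ψ) ∧
    -- the eigenvalue problems for the expansion coefficients
    (∀ ε : Fin M → ℝ, (∀ m Φ, H (Ψ m) Φ = ε m * ip (Ψ m) Φ) →
      (∀ t : Amps ref, FullJMMRCC B ref H (targetSpan Ψ) t → ∀ j,
        ∃ a : Fin M → ℝ, a ≠ 0 ∧ Ψ j = ∑ n, a n • ccState B ref t n ∧
          (∀ b : Fin M → ℝ, Ψ j = ∑ n, b n • ccState B ref t n → b = a) ∧
          ∀ m, ∑ n, ccHeff B ref H t n m * a n = ε j * a m) ∧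
      (∀ c : Amps ref, FullMRCI B ref H (targetSpan Ψ) c → ∀ j,
        ∃ a : Fin M → ℝ, a ≠ 0 ∧ Ψ j = ∑ n, a n • ciState B ref c n ∧
          (∀ b : Fin M → ℝ, Ψ j = ∑ n, b n • ciState B ref c n → b = a) ∧
          ∀ m, ∑ n, ciHeff B ref H c n m * a n = ε j * a m)) := by
  have hcc : ∀ t : Amps ref, FullJMMRCC B ref H (targetSpan Ψ) t →
      IsCompl (targetSpan Ψ) (l2Perp (modelSpace B ref)) ∧ WeaklyInvariant H Ψ := fun t h => by
    obtain ⟨h1, h2, h3⟩ := (fullJMMRCC_iff href).1 h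
    exact ⟨h2 ▸ (ccState_isNormalized href h1).isCompl,
      (weaklyInvariant_iff_represents h2).2 ⟨_, h3⟩⟩
  have hci : ∀ c : Amps ref, FullMRCI B ref H (targetSpan Ψ) c →
      IsCompl (targetSpan Ψ) (l2Perp (modelSpace B ref)) ∧ WeaklyInvariant H Ψ := fun c h => by
    obtain ⟨h1, h2, h3⟩ := (fullMRCI_iff href).1 h
    exact ⟨h2 ▸ (ciState_isNormalized href h1).isCompl,
      (weaklyInvariant_iff_represents h2).2 ⟨_, h3⟩⟩
  have hne : ∀ j, Ψ j ≠ 0 := fun j hj => by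
    obtain ⟨n, hn⟩ := hover j
    exact hn (by rw [hj, ip_zero_left])
  have hmem : ∀ j, Ψ j ∈ targetSpan Ψ := fun j => Submodule.subset_span ⟨j, rfl⟩
  refine ⟨fun m t ht => ?_, fun hcompl => ?_, fun ⟨t, h⟩ => hcc t h, fun ⟨c, h⟩ => hci c h,
    fun ε hε => ⟨fun t h j => ?_, fun c h j => ?_⟩⟩
  · obtain ⟨A', hA, -⟩ := exists_adj_exp_neg ht
    exact ⟨⟨_, clusterOp_spec ht, fun T hT => hT.unique (clusterOp_spec ht)⟩, clusterOp_spec ht,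
      ⟨_, hA.isDualExt, fun E hE => hE.unique hA.isDualExt⟩, dualExt_spec hA⟩
  -- The same normalized family is parametrized linearly and exponentially. The matrix of `H` on it
  -- is then necessarily the effective matrix of either Ansatz.
  · obtain ⟨Ω, hΩ, hspan⟩ := exists_isNormalized href hcompl
    tfae_have 1 → 2 := fun h => by
      obtain ⟨A, hA⟩ := (weaklyInvariant_iff_represents hspan).1 h
      obtain ⟨t, ht, rfl⟩ := hΩ.exists_ccState href
      exact ⟨t, (fullJMMRCC_iff href).2 ⟨ht, hspan, (hA.ccHeff_eq href ht).symm ▸ hA⟩⟩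
    tfae_have 1 → 3 := fun h => by
      obtain ⟨A, hA⟩ := (weaklyInvariant_iff_represents hspan).1 h
      obtain ⟨c, hc, rfl⟩ := hΩ.exists_ciState href
      exact ⟨c, (fullMRCI_iff href).2 ⟨hc, hspan, (hA.ciHeff_eq href hc).symm ▸ hA⟩⟩
    tfae_have 2 → 1 := fun ⟨t, h⟩ => (hcc t h).2
    tfae_have 3 → 1 := fun ⟨c, h⟩ => (hci c h).2
    tfae_finish
  · obtain ⟨h1, h2, h3⟩ := (fullJMMRCC_iff href).1 h
    exact (ccState_isNormalized href h1).eigen h3 (hne j) (h2 ▸ hmem j) (hε j)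
  · obtain ⟨h1, h2, h3⟩ := (fullMRCI_iff href).1 h
    exact (ciState_isNormalized href h1).eigen h3 (hne j) (h2 ▸ hmem j) (hε j)
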